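/- Let $\Bbbk$ be a field of characteristic zero; elements of graded vector spaces are homogeneous. A homotopy probability algebra $\mathcal C_C=(\mathcal C,1_{\mathcal C},\underline M,K)$ is a pointed cochain complex $(\mathcal C,1_{\mathcal C},K)$ over $\Bbbk$ (so $K1_{\mathcal C}=0$, $1_{\mathcal C}\notin\operatorname{Im}K$) with degree $0$ linear maps $M_n:S^n\mathcal C\to\mathcal C$, $n\ge1$, such that $M_1=\mathrm{id}$ and $M_{n+1}(x_1,\dots,x_n,1_{\mathcal C})=M_n(x_1,\dots,x_n)$. Let $[\mathfrak c]$ be a pointed cochain homotopy class of pointed cochain maps $\mathfrak c:\mathcal C\to\Bbbk$. For a partition $\pi=B_1\sqcup\dots\sqcup B_{|\pi|}\in P(n)$, with blocks ordered by their maxima, $\epsilon(\pi)$ denotes the Koszul sign of $x_1\otimes\cdots\otimes x_n\mapsto x_{B_1}\otimes\cdots\otimes x_{B_{|\pi|}}$, and $\epsilon(\pi,i)=\epsilon(\pi)(-1)^{|x_{B_1}|+\dots+|x_{B_{i-1}}|}$. The descendant unital $sL_\infty$-algebra $(\mathcal C,\underline\ell^K)$ is defined recursively by $$KM_n(x_1,\dots,x_n)=\sum_{\pi\in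 P(n),\,|B_i|=n-|\pi|+1}\epsilon(\pi,i)\,M_{|\pi|}\big(x_{B_1},\dots,\ell^K(x_{B_i}),\dots,x_{B_{|\pi|}}\big).$$ For degree $-1$ maps $\Lambda_n:S^n\mathcal C\to\Bbbk$ with $\Lambda_1(1_{\mathcal C})=0$ and $\Lambda_{n+1}(x_1,\dots,x_n,1_{\mathcal C})=\Lambda_n(x_1,\dots,x_n)$, the descendant $\underline\phi^{\mathfrak c,\underline\Lambda}$ of $\mathfrak c$ is defined recursively by $$\mathfrak c\big(M_n(x_1,\dots,x_n)\big)=\sum_{\pi\in P(n)}\epsilon(\pi)\prod_{i}\phi^{\mathfrak c,\underline\Lambda}(x_{B_i})+\sum_{\pi\in P(n),\,|B_i|=n-|\pi|+1}\epsilon(\pi,i)\,\Lambda_{|\pi|}\big(x_{B_1},\dots,\ell^K(x_{B_i}),\dots,x_{B_{|\pi|}}\big).$$ A complete space $\boldsymbol{\mathcal S}$ is a pointed graded vector space $\mathcal S$ with zero $sL_\infty$-structure together with the homotopy type $[\boldsymbol{\mathcal S}]$ of a unital $sL_\infty$-quasi-isomorphism $\underline\varphi:(\mathcal S,\underline 0)\to(\mathcal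 C,\underline\ell^K)$. For a representative $\underline\varphi$ put $$\Pi^{\underline\varphi}_n(s_1,\dots,s_n)=\sum_{\pi\in P(n)}\epsilon(\pi)\,M_{|\pi|}\big(\varphi(s_{B_1}),\dots,\varphi(s_{B_{|\pi|}})\big),$$ $$\big(\underline\phi^{\mathfrak c,\underline\Lambda}\bullet\underline\varphi\big)_n(s_1,\dots,s_n)=\sum_{\pi\in P(n)}\epsilon(\pi)\,\phi^{\mathfrak c,\underline\Lambda}_{|\pi|}\big(\varphi(s_{B_1}),\dots,\varphi(s_{B_{|\pi|}})\big).$$ **Theorem.** On $\mathcal S$ there is a canonical structure $\iota^{\boldsymbol{\mathcal S}}:\mathcal S_C\to\Bbbk$ of an algebraic probability space, that is, a homotopy probability algebra $\mathcal S_C=(\mathcal S,1_{\mathcal S},\underline M^{\boldsymbol{\mathcal S}},0)$ with zero differential together with a degree $0$ linear map $\iota^{\boldsymbol{\mathcal S}}$ with $\iota^{\boldsymbol{\mathcal S}}(1_{\mathcal S})=1$. It is the unique such structure with $$M^{\boldsymbol{\mathcal S}}_n=h\circ\Pi^{\underline\varphi}_n\ (n\ge1),\qquad \iota^{\boldsymbol{\mathcal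 S}}=\mathfrak c\circ f,\qquad f=\varphi_1,$$ for every representative $\underline\varphi$ of $[\boldsymbol{\mathcal S}]$, every representative $\mathfrak c$ of $[\mathfrak c]$, and every homotopy inverse $h:\mathcal C\to\mathcal S$ of $f$ (degree $0$, $h f=I_{\mathcal S}$, $f h=I_{\mathcal C}+K\beta+\beta K$ with $\beta$ of degree $-1$ and $\beta(1_{\mathcal C})=0$); such an $h$ exists for every $\underline\varphi$. There are also unique families of degree $0$ linear maps $\mu^{\boldsymbol{\mathcal S}}_n,\kappa^{\boldsymbol{\mathcal S}}_n:S^n\mathcal S\to\Bbbk$, $n\ge1$ (the moment and cumulant morphisms), with $\mu^{\boldsymbol{\mathcal S}}_n=\mathfrak c\circ\Pi^{\underline\varphi}_n$ and $\kappa^{\boldsymbol{\mathcal S}}_n=(\underline\phi^{\mathfrak c,\underline\Lambda}\bullet\underline\varphi)_n$ for all representatives $\underline\varphi$, $\mathfrak c$ and all $\underline\Lambda$. For all $n\ge1$ and $s_1,\dots,s_n\in\mathcal S$, $$\iota^{\boldsymbol{\mathcal S}}\big(M^{\boldsymbol{\mathcal S}}_n(s_1,\dots,s_n)\big)=\mu^{\boldsymbol{\mathcal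 S}}_n(s_1,\dots,s_n)=\sum_{\pi\in P(n)}\epsilon(\pi)\,\kappa^{\boldsymbol{\mathcal S}}(s_{B_1})\cdots\kappa^{\boldsymbol{\mathcal S}}(s_{B_{|\pi|}}).$$ -/

import Mathlib

universe u v w

noncomputable section

/-! ### Pointed graded vector spaces -/

/-- A pointed `ℤ`-graded vector space: the direct sum of the subspaces `deg j` of homogeneous
elements of degree `j`, together with a distinguished element `one` of degree `0`. -/
structure PointedGraded (k : Type u) [Field k] where
  carrier : Type v
  [addCommGroup : AddCommGroup carrier]
  [module : Module k carrier]
  deg : ℤ → Submodule k carrier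
  isInternal : DirectSum.IsInternal deg
  one : carrier
  one_mem : one ∈ deg 0

namespace PointedGraded

attribute [instance] PointedGraded.addCommGroup PointedGraded.module

instance {k : Type u} [Field k] : CoeSort (PointedGraded.{u, v} k) (Type v) := ⟨carrier⟩

/-- The tuple `x` consists of homogeneous elements of degrees `d`. -/
def Homog {k : Type u} [Field k] (V : PointedGraded.{u, v} k) {n : ℕ} (d : Fin n → ℤ)
    (x : Fin n → V) : Prop :=
  ∀ i, x i ∈ V.deg (d i)

end PointedGraded

/-- The Koszul sign of `x₁ ⊗ ⋯ ⊗ xₙ ↦ x_{σ(1)} ⊗ ⋯ ⊗ x_{σ(n)}` for elements of degrees `d`: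
each inversion contributes the sign of the transposition of the two elements involved. -/
def koszulPerm {n : ℕ} (d : Fin n → ℤ) (σ : Equiv.Perm (Fin n)) : ℤˣ :=
  ∏ i : Fin n, ∏ j : Fin n, if i < j ∧ σ j < σ i then (d (σ i) * d (σ j)).negOnePow else 1

/-- A family of linear maps `f_n : Sⁿ V → W`, `n ≥ 1`, of degree `e`, given as multilinear maps
which are symmetric in the graded sense. There is no component of arity `0`, which is expressed by
the normalisation `map 0 = 0`. -/
@[ext]
structure SymFamily {k : Type u} [Field k] (V : PointedGraded.{u, v} k)
    (W : PointedGraded.{u, w} k) (e : ℤ) where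
  map : ∀ n : ℕ, MultilinearMap k (fun _ : Fin n => V.carrier) W.carrier
  map_zero_arity : map 0 = 0
  map_mem : ∀ (n : ℕ) (d : Fin n → ℤ) (x : Fin n → V), V.Homog d x →
    map n x ∈ W.deg (∑ i, d i + e)
  map_symm : ∀ (n : ℕ) (d : Fin n → ℤ) (x : Fin n → V) (σ : Equiv.Perm (Fin n)), V.Homog d x →
    map n x = koszulPerm d σ • map n (x ∘ σ)

/-! ### Partitions

`OrderedFinpartition n` is the set of partitions of `{1, …, n}` in strictly ordered
representation: the blocks are ordered by their greatest elements, each block is enumerated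
increasingly. `π.length` is the number of blocks, `π.emb i` enumerates the `i`-th block. -/

namespace OrderedFinpartition

variable {n : ℕ} (π : OrderedFinpartition n)

/-- The restriction `x_{B_i}` of a tuple to the `i`-th block. -/
def block {α : Type*} (x : Fin n → α) (i : Fin π.length) : Fin (π.partSize i) → α :=
  fun r => x (π.emb i r)

/-- The first entry of each block: for a singleton block this is its only entry. -/
def first {α : Type*} (x : Fin n → α) (i : Fin π.length) : α :=
  x (π.emb i ⟨0, π.partSize_pos i⟩)

/-- The total degree `|x_{B_i}|`. -/
def blockDeg (d : Fin n → ℤ) (i : Fin π.length) : ℤ := ∑ r, π.block d i r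

/-- The Koszul sign `ε(π)` of the permutation
`x₁ ⊗ ⋯ ⊗ xₙ ↦ x_{B_1} ⊗ ⋯ ⊗ x_{B_{|π|}}`: `a < b` are interchanged exactly if the block of `b`
precedes that of `a`. -/
def sign (d : Fin n → ℤ) : ℤˣ :=
  ∏ a : Fin n, ∏ b : Fin n,
    if a < b ∧ π.index b < π.index a then (d a * d b).negOnePow else 1

/-- The sign `ε(π, i) = ε(π) (-1)^{|x_{B_1}| + ⋯ + |x_{B_{i-1}}|}`. -/
def signAt (d : Fin n → ℤ) (i : Fin π.length) : ℤˣ :=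
  π.sign d * (∑ j with j < i, π.blockDeg d j).negOnePow

/-- `|B_i| = n - |π| + 1`, that is, all blocks other than `B_i` are singletons. -/
def OthersSingleton (i : Fin π.length) : Prop := π.partSize i + π.length = n + 1

instance (i : Fin π.length) : Decidable (π.OthersSingleton i) :=
  inferInstanceAs (Decidable (_ = _))

theorem partSize_lt (h : π.length ≠ 1) (i : Fin π.length) : π.partSize i < n := by
  have hs : ∑ m : Fin π.length, π.partSize m = n := by
    simpa using π.sum_sigma_eq_sum (fun _ => (1 : ℕ))
  have hl : 1 < π.length := by have := i.2; omega
  obtain ⟨j, hj⟩ : ∃ j : Fin π.length, j ≠ i := by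
    have : Nontrivial (Fin π.length) := Fin.nontrivial_iff_two_le.2 hl
    exact exists_ne i
  have h2 : π.partSize i + π.partSize j ≤ ∑ m : Fin π.length, π.partSize m := by
    rw [← Finset.sum_pair (f := π.partSize) hj.symm]
    exact Finset.sum_le_sum_of_subset (Finset.subset_univ _)
  have := π.partSize_pos j
  omega

end OrderedFinpartition

/-! ### Correlation algebras and homotopy probability spaces -/

/-- A correlation algebra structure on a pointed graded vector space. -/
structure CorrelationAlgebra {k : Type u} [Field k] (V : PointedGraded.{u, v} k) where
  M : SymFamily V V 0
  M_one_arity : ∀ x : V, M.map 1 (fun _ => x) = x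
  M_unit : ∀ (n : ℕ), 1 ≤ n → ∀ x : Fin n → V,
    M.map (n + 1) (Fin.snoc (α := fun _ => V.carrier) x V.one) = M.map n x

/-- A homotopy probability algebra: a correlation algebra and a pointed cochain complex on the
same pointed graded vector space. -/
structure HomotopyProbabilityAlgebra {k : Type u} [Field k] (V : PointedGraded.{u, v} k) extends
    CorrelationAlgebra V where
  K : V.carrier →ₗ[k] V.carrier
  K_mem : ∀ (j : ℤ) (x : V), x ∈ V.deg j → K x ∈ V.deg (j + 1)
  K_K : ∀ x : V, K (K x) = 0
  K_one : K V.one = 0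
  one_notMem_range : ∀ x : V, K x ≠ V.one

namespace HomotopyProbabilityAlgebra

/-- A morphism of homotopy probability algebras is a pointed cochain map. -/
@[ext]
structure Hom {k : Type u} [Field k] {V : PointedGraded.{u, v} k} {W : PointedGraded.{u, w} k}
    (A : HomotopyProbabilityAlgebra V) (B : HomotopyProbabilityAlgebra W) where
  toLin : V.carrier →ₗ[k] W.carrier
  map_mem : ∀ (j : ℤ) (x : V), x ∈ V.deg j → toLin x ∈ W.deg j
  map_one : toLin V.one = W.one
  map_K : ∀ x : V, toLin (A.K x) = B.K (toLin x)

/-- Pointed cochain homotopy of morphisms: `f - g = K' s + s K` with `s` of degree `-1` killing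
the unit. -/
def Hom.Homotopic {k : Type u} [Field k] {V : PointedGraded.{u, v} k}
    {W : PointedGraded.{u, w} k} {A : HomotopyProbabilityAlgebra V}
    {B : HomotopyProbabilityAlgebra W} (f g : A.Hom B) : Prop :=
  ∃ s : V.carrier →ₗ[k] W.carrier,
    (∀ (j : ℤ) (x : V), x ∈ V.deg j → s x ∈ W.deg (j - 1)) ∧ s V.one = 0 ∧
      ∀ x : V, f.toLin x - g.toLin x = B.K (s x) + s (A.K x)

end HomotopyProbabilityAlgebra

/-- The ground field as a pointed graded vector space, concentrated in degree `0`. -/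
@[reducible]
def groundSpace (k : Type u) [Field k] : PointedGraded.{u, u} k where
  carrier := k
  deg := fun j => if j = 0 then ⊤ else ⊥
  isInternal := by
    rw [DirectSum.isInternal_submodule_iff_iSupIndep_and_iSup_eq_top]
    constructor
    · intro i
      by_cases hi : i = 0
      · subst hi
        have : (⨆ j, ⨆ (_ : j ≠ (0 : ℤ)), (if j = 0 then (⊤ : Submodule k k) else ⊥)) = ⊥ := by
          refine iSup₂_eq_bot.2 fun j hj => if_neg hj
        rw [this]
        exact disjoint_bot_right
      · simp only [if_neg hi]
        exact disjoint_bot_left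
    · refine eq_top_iff.2 (le_trans ?_ (le_iSup _ (0 : ℤ)))
      simp
  one := 1
  one_mem := by simp

/-- The ground field as a homotopy probability algebra: zero differential, `M_n` is the `n`-fold
product. -/
def groundAlgebra (k : Type u) [Field k] : HomotopyProbabilityAlgebra (groundSpace k) where
  M :=
    { map := fun n => if n = 0 then 0 else MultilinearMap.mkPiAlgebra k (Fin n) k
      map_zero_arity := if_pos rfl
      map_mem := by
        intro n d x hx
        by_cases hd : ∀ i, d i = 0
        · simp [hd]
        · push Not at hd
          obtain ⟨i, hi⟩ := hd
          have hxi : x i = 0 := by simpa [hi] using hx i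
          have hz : (if n = 0 then (0 : MultilinearMap k (fun _ : Fin n => k) k)
              else MultilinearMap.mkPiAlgebra k (Fin n) k) x = 0 := MultilinearMap.map_coord_zero _ i hxi
          rw [hz]
          exact Submodule.zero_mem _
      map_symm := by
        intro n d x σ hx
        by_cases hd : ∀ i, d i = 0
        · have h1 : koszulPerm d σ = 1 := by simp [koszulPerm, hd]
          rw [h1, one_smul]
          by_cases hn : n = 0
          · simp [hn]
          · simp only [if_neg hn, MultilinearMap.mkPiAlgebra_apply, Function.comp]
            exact (Equiv.prod_comp σ x).symm
        · push Not at hd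
          obtain ⟨i, hi⟩ := hd
          have hxi : x i = 0 := by simpa [hi] using hx i
          have hz : (if n = 0 then (0 : MultilinearMap k (fun _ : Fin n => k) k)
              else MultilinearMap.mkPiAlgebra k (Fin n) k) x = 0 := MultilinearMap.map_coord_zero _ i hxi
          have hz' : (if n = 0 then (0 : MultilinearMap k (fun _ : Fin n => k) k)
              else MultilinearMap.mkPiAlgebra k (Fin n) k) (x ∘ σ) = 0 :=
            MultilinearMap.map_coord_zero _ (σ.symm i) (by simpa using hxi)
          rw [hz, hz', smul_zero] }
  M_one_arity := by intro x; simp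
  M_unit := by
    intro n hn x
    have hn' : n ≠ 0 := by omega
    simp only [if_neg hn', if_neg (Nat.succ_ne_zero n), MultilinearMap.mkPiAlgebra_apply]
    rw [Fin.prod_univ_castSucc]
    simp
  K := 0
  K_mem := by intro j x _; simp
  K_K := by simp
  K_one := by simp
  one_notMem_range := by intro x; simp

/-- A homotopy probability space: a homotopy probability algebra with a morphism, in the homotopy
category, to the ground field, that is, a homotopy class of expectations. -/
structure HomotopyProbabilitySpace {k : Type u} [Field k] (C : PointedGraded.{u, v} k) where
  alg : HomotopyProbabilityAlgebra C
  expectation : Quot (HomotopyProbabilityAlgebra.Hom.Homotopic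
    (A := alg) (B := groundAlgebra k))

/-- An algebraic probability space on a graded vector space: a homotopy probability algebra with
zero differential together with an expectation to the ground field. -/
@[ext]
structure AlgebraicProbabilitySpace {k : Type u} [Field k] (S : PointedGraded.{u, v} k) where
  alg : HomotopyProbabilityAlgebra S
  K_eq_zero : alg.K = 0
  expectation : alg.Hom (groundAlgebra k)

/-! ### `sL_∞` structures, morphisms and homotopies -/

/-- A family of operations in `n` homogeneous arguments, which may depend on their degrees (needed
for signs): `ℓ n d x` is `ℓ_n(x₁, …, xₙ)` for `x_i` homogeneous of degree `d i`. -/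
abbrev GradedOps {k : Type u} [Field k] (V : PointedGraded.{u, v} k)
    (W : PointedGraded.{u, w} k) :=
  ∀ n : ℕ, (Fin n → ℤ) → (Fin n → V) → W

section SL

variable {k : Type u} [Field k] {V : PointedGraded.{u, v} k} {W : PointedGraded.{u, w} k}

/-- The images `f(x_{B_1}), …, f(x_{B_{|π|}})` of the blocks of a tuple. -/
def SymFamily.onBlocks {e : ℤ} (f : SymFamily V W e) {n : ℕ} (π : OrderedFinpartition n)
    (x : Fin n → V) : Fin π.length → W :=
  fun i => f.map (π.partSize i) (π.block x i)

/-- `∑ ε(π) ℓ'_{|π|}(φ(x_{B_1}), …, φ(x_{B_{|π|}}))` over all partitions. For unital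
`sL_∞`-morphisms `ℓ'`, `φ` this is their composition. -/
def compOps {U : PointedGraded.{u, v} k} {X : PointedGraded k} (ℓ' : GradedOps W X)
    (φ : SymFamily U W 0) : GradedOps U X :=
  fun n d x => ∑ π : OrderedFinpartition n,
    π.sign d • ℓ' π.length (π.blockDeg d) (φ.onBlocks π x)

/-- `∑ ε(π, i) f_{|π|}(x_{B_1}, …, ℓ(x_{B_i}), …, x_{B_{|π|}})` over all partitions with a chosen
block `B_i` such that all other blocks are singletons. -/
def insertOps {e : ℤ} (f : SymFamily V W e) (ℓ : GradedOps V V) : GradedOps V W :=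
  fun n d x => ∑ π : OrderedFinpartition n, ∑ i with π.OthersSingleton i,
    π.signAt d i • f.map π.length
      (Function.update (π.first x) i (ℓ (π.partSize i) (π.block d i) (π.block x i)))

/-- A morphism of unital `sL_∞`-algebras `(V, ℓ) → (W, ℓ')`. -/
structure UnitalSLHom (ℓ : GradedOps V V) (ℓ' : GradedOps W W) where
  family : SymFamily V W 0
  relation : ∀ n : ℕ, 1 ≤ n → ∀ (d : Fin n → ℤ) (x : Fin n → V), V.Homog d x →
    compOps ℓ' family n d x = insertOps family ℓ n d x
  unit_one : family.map 1 (fun _ => V.one) = W.one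
  unit_higher : ∀ n : ℕ, 1 ≤ n → ∀ x : Fin n → V,
    family.map (n + 1) (Fin.snoc (α := fun _ => V.carrier) x V.one) = 0

/-- The right hand side of the homotopy flow equation,
`∑ ε(π, i) ℓ'_{|π|}(Φ(x_{B_1}), …, η(x_{B_i}), …, Φ(x_{B_{|π|}}))` over all partitions (the
one-block partition contributes `ℓ'_1 (η_n(x))`) plus
`∑ ε(π, i) η_{|π|}(x_{B_1}, …, ℓ(x_{B_i}), …, x_{B_{|π|}})`. -/
def flowOps (ℓ : GradedOps V V) (ℓ' : GradedOps W W) (Φ : SymFamily V W 0)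
    (η : SymFamily V W (-1)) : GradedOps V W :=
  fun n d x =>
    (∑ π : OrderedFinpartition n, ∑ i : Fin π.length,
      π.signAt d i • ℓ' π.length (Function.update (π.blockDeg d) i (π.blockDeg d i - 1))
        (Function.update (Φ.onBlocks π x) i (η.onBlocks π x i))) +
    insertOps η ℓ n d x

/-- The value at `τ` of the polynomial `∑ τ^m p_m` with coefficients in a vector space. -/
def polyEval {E : Type*} [AddCommGroup E] [Module k E] (p : ℕ →₀ E) (τ : k) : E :=
  p.sum fun m a => τ ^ m • a

/-- The value at `τ` of the derivative of the polynomial `∑ τ^m p_m`. -/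
def polyDerivEval {E : Type*} [AddCommGroup E] [Module k E] (p : ℕ →₀ E) (τ : k) : E :=
  p.sum fun m a => ((m : k) * τ ^ (m - 1)) • a

/-- Two unital `sL_∞`-morphisms are related if the second one is the value at `τ = 1` of a solution
`Φ`, polynomial in `τ`, of the homotopy flow equation generated by a polynomial family `η` of unital
`sL_∞`-homotopies, starting at the first one at `τ = 0`. Over the infinite field `k` a polynomial in
`τ` is the same as its function of values. -/
def UnitalSLHom.Homotopic {ℓ : GradedOps V V} {ℓ' : GradedOps W W}
    (φ ψ : UnitalSLHom ℓ ℓ') : Prop :=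
  ∃ (Φ : k → SymFamily V W 0) (η : k → SymFamily V W (-1)),
    (∀ (n : ℕ) (x : Fin n → V), ∃ p : ℕ →₀ W.carrier, ∀ τ : k, (η τ).map n x = polyEval p τ) ∧
    (∀ (τ : k) (n : ℕ) (x : Fin n → V),
      (η τ).map (n + 1) (Fin.snoc (α := fun _ => V.carrier) x V.one) = 0) ∧
    (∀ (n : ℕ), 1 ≤ n → ∀ (d : Fin n → ℤ) (x : Fin n → V), V.Homog d x →
      ∃ p : ℕ →₀ W.carrier, ∀ τ : k, (Φ τ).map n x = polyEval p τ ∧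
        polyDerivEval p τ = flowOps ℓ ℓ' (Φ τ) (η τ) n d x) ∧
    Φ 0 = φ.family ∧ Φ 1 = ψ.family

/-- The linear part of an `sL_∞`-morphism induces an isomorphism of cohomology
`Ker ℓ_1 / Im ℓ_1 → Ker ℓ'_1 / Im ℓ'_1`; `d`, `d'` are the differentials. -/
def SymFamily.IsQuasiIso (φ : SymFamily V W 0) (d : V.carrier →ₗ[k] V.carrier)
    (d' : W.carrier →ₗ[k] W.carrier) : Prop :=
  (∀ x : V, d x = 0 → (∃ y : W, φ.map 1 (fun _ => x) = d' y) → ∃ z : V, x = d z) ∧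
  (∀ y : W, d' y = 0 → ∃ x : V, d x = 0 ∧ ∃ z : W, y = φ.map 1 (fun _ => x) + d' z)

end SL

/-! ### Descendants -/

namespace HomotopyProbabilityAlgebra

variable {k : Type u} [Field k] {V : PointedGraded.{u, v} k} {W : PointedGraded.{u, w} k}

/-- The operations `ℓ^K` of the descendant `sL_∞`-algebra, defined recursively by
`K M_n(x) = ∑ ε(π, i) M_{|π|}(x_{B_1}, …, ℓ^K(x_{B_i}), …, x_{B_{|π|}})`, the sum being over
`|B_i| = n - |π| + 1`, solved for the summand `ℓ^K_n(x)` of the one-block partition. -/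
def descendantOps (A : HomotopyProbabilityAlgebra V) (n : ℕ) (d : Fin n → ℤ) (x : Fin n → V) :
    V :=
  A.K (A.M.map n x) -
    ∑ π : {π : OrderedFinpartition n // π.length ≠ 1}, ∑ i with π.1.OthersSingleton i,
      π.1.signAt d i • A.M.map π.1.length
        (Function.update (π.1.first x) i
          (descendantOps A (π.1.partSize i) (π.1.block d i) (π.1.block x i)))
termination_by n
decreasing_by exact π.1.partSize_lt π.2 i

/-- A homotopy `Λ` up to which the descendant of a morphism is formed: maps `Sⁿ V → W` of degree
`-1` with `Λ_1(1) = 0` and `Λ_{n+1}(x₁, …, xₙ, 1) = Λ_n(x₁, …, xₙ)`. -/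
structure DescentHomotopy (V : PointedGraded.{u, v} k) (W : PointedGraded.{u, w} k) where
  family : SymFamily V W (-1)
  unit_one : family.map 1 (fun _ => V.one) = 0
  unit_higher : ∀ n : ℕ, 1 ≤ n → ∀ x : Fin n → V,
    family.map (n + 1) (Fin.snoc (α := fun _ => V.carrier) x V.one) = family.map n x

/-- The descendant `φ^{f,Λ}` of a morphism `f` up to the homotopy `Λ`, defined recursively by
`f(M_n(x)) = ∑ ε(π) M'_{|π|}(φ^{f,Λ}(x_{B_1}), …, φ^{f,Λ}(x_{B_{|π|}})) + K' Λ_n(x)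
+ ∑ ε(π, i) Λ_{|π|}(x_{B_1}, …, ℓ^K(x_{B_i}), …, x_{B_{|π|}})`,
solved for the summand `φ^{f,Λ}_n(x)` of the one-block partition. -/
def descendantMor {A : HomotopyProbabilityAlgebra V} {B : HomotopyProbabilityAlgebra W}
    (f : A.Hom B) (Λ : DescentHomotopy V W) (n : ℕ) (d : Fin n → ℤ) (x : Fin n → V) : W :=
  f.toLin (A.M.map n x)
    - (∑ π : {π : OrderedFinpartition n // π.length ≠ 1},
        π.1.sign d • B.M.map π.1.length
          (fun i => descendantMor f Λ (π.1.partSize i) (π.1.block d i) (π.1.block x i)))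
    - B.K (Λ.family.map n x)
    - insertOps Λ.family A.descendantOps n d x
termination_by n
decreasing_by exact π.1.partSize_lt π.2 i

/-- The correlation densities
`Π^φ_n(x) = ∑ ε(π) M_{|π|}(φ(x_{B_1}), …, φ(x_{B_{|π|}}))`. -/
def density (A : HomotopyProbabilityAlgebra W) (φ : SymFamily V W 0) : GradedOps V W :=
  compOps (fun n _ y => A.M.map n y) φ

end HomotopyProbabilityAlgebra

/-! ### Complete spaces of homotopical random variables -/

section Complete

variable {k : Type u} [Field k] {C : PointedGraded.{u, v} k} {S : PointedGraded.{u, w} k}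

/-- Unital `sL_∞`-morphisms from `S` with zero `sL_∞`-structure to the descendant of `A`. -/
abbrev RandomVariables (A : HomotopyProbabilityAlgebra C) (S : PointedGraded.{u, w} k) :=
  UnitalSLHom (V := S) (W := C) (fun _ _ _ => 0) A.descendantOps

/-- A complete space of homotopical random variables: the pointed graded vector space `S` with
zero `sL_∞`-structure together with the homotopy type (class for the equivalence relation generated
by homotopy) of a unital `sL_∞`-quasi-isomorphism to the descendant of the homotopy probability
algebra. -/
structure CompleteRVSpace (X : HomotopyProbabilitySpace C) (S : PointedGraded.{u, w} k) where
  homotopyType : Quot (UnitalSLHom.Homotopic (V := S) (W := C) (ℓ := fun _ _ _ => 0)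
    (ℓ' := X.alg.descendantOps))
  quasiIso : ∃ φ : RandomVariables X.alg S, Quot.mk _ φ = homotopyType ∧
    φ.family.IsQuasiIso 0 X.alg.K

/-- A homotopy inverse `h` of the cochain map `f = φ_1 : (S, 0) → (C, K)`:
`h ∘ f = I` and `f ∘ h = I + K β + β K`, with `β` of degree `-1` killing the unit. -/
structure HomotopyInverse (A : HomotopyProbabilityAlgebra C) (φ : RandomVariables A S) where
  h : C.carrier →ₗ[k] S.carrier
  h_mem : ∀ (j : ℤ) (y : C), y ∈ C.deg j → h y ∈ S.deg j
  β : C.carrier →ₗ[k] C.carrier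
  β_mem : ∀ (j : ℤ) (y : C), y ∈ C.deg j → β y ∈ C.deg (j - 1)
  β_one : β C.one = 0
  h_comp : ∀ s : S, h (φ.family.map 1 (fun _ => s)) = s
  comp_h : ∀ y : C, φ.family.map 1 (fun _ => h y) = y + A.K (β y) + β (A.K y)

namespace CompleteRVSpace

variable {X : HomotopyProbabilitySpace C} (T : CompleteRVSpace X S)

/-- `P` is the structure `(S, M^S, 0)` with expectation `ι^S`, where `M^S_n = h ∘ Π^φ_n` and
`ι^S = c ∘ φ_1` for every representative `φ` of the homotopy type of the complete space, every
homotopy inverse `h` of `φ_1` and every representative `c` of the expectation. -/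
def IsCanonicalStructure (P : AlgebraicProbabilitySpace S) : Prop :=
  ∀ φ : RandomVariables X.alg S, Quot.mk _ φ = T.homotopyType →
    (∀ (I : HomotopyInverse X.alg φ) (n : ℕ), 1 ≤ n → ∀ (d : Fin n → ℤ) (s : Fin n → S),
      S.Homog d s → P.alg.M.map n s = I.h (X.alg.density φ.family n d s)) ∧
    (∀ c : X.alg.Hom (groundAlgebra k), Quot.mk _ c = X.expectation →
      ∀ s : S, P.expectation.toLin s = c.toLin (φ.family.map 1 (fun _ => s)))

/-- `μ` is the moment morphism: `μ_n = c ∘ Π^φ_n` for all representatives `φ` and `c`. -/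
def IsMomentMorphism (μ : SymFamily S (groundSpace k) 0) : Prop :=
  ∀ φ : RandomVariables X.alg S, Quot.mk _ φ = T.homotopyType →
    ∀ c : X.alg.Hom (groundAlgebra k), Quot.mk _ c = X.expectation →
      ∀ n : ℕ, 1 ≤ n → ∀ (d : Fin n → ℤ) (s : Fin n → S), S.Homog d s →
        μ.map n s = c.toLin (X.alg.density φ.family n d s)

/-- `κ` is the cumulant morphism: `κ_n = (φ^{c,Λ} • φ)_n` for all representatives `φ` and `c` and
all homotopies `Λ`. -/
def IsCumulantMorphism (κ : SymFamily S (groundSpace k) 0) : Prop :=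
  ∀ φ : RandomVariables X.alg S, Quot.mk _ φ = T.homotopyType →
    ∀ c : X.alg.Hom (groundAlgebra k), Quot.mk _ c = X.expectation →
      ∀ (Λ : HomotopyProbabilityAlgebra.DescentHomotopy C (groundSpace k)) (n : ℕ), 1 ≤ n →
        ∀ (d : Fin n → ℤ) (s : Fin n → S), S.Homog d s →
          κ.map n s =
            compOps (HomotopyProbabilityAlgebra.descendantMor c Λ) φ.family n d s

end CompleteRVSpace

end Complete

end

/-! Composition below means composition over partitions. A representative `φ` starts from the zero
structure, so its morphism relation says that `ℓ` composed with `φ` vanishes. The recursion for `ℓ`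
expresses `K` of `M` as the insertion of `ℓ` into `M`. Composing with `φ` turns the inserted
operation into the composite of `ℓ` with `φ`, hence every density `Π^φ_n` is a cocycle
(`K_density`). Along a polynomial homotopy, the derivative of the density is `K` of the same sum
with one factor `Φ` replaced by `η`. Integrating in `τ`, which characteristic zero permits, shows
that the cohomology class of `Π^φ_n` depends only on the homotopy type (`comp_flow`,
`density_sub_of_quot_eq`).

A homotopy inverse `h` and an expectation `c` kill the image of `K`, and their values on cocycles do
not depend on the representatives chosen. So `h ∘ Π`, `c ∘ f` and `c ∘ Π` are canonical. The
expectation of `M^S` is the moment because `f ∘ h` is the identity on a cocycle up to an exact term.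
Homotopy inverses exist by linear algebra over a field, followed by passing to homogeneous
components.

For the cumulants, compose the recursion for `φ^{c,Λ}` with `φ`: the `Λ`-term contains `ℓ` composed
with `φ` and disappears, and associativity of composition leaves the moments as sums of products of
cumulants (`map_comp_eq`). The one-block summand is the cumulant itself, so the system is
triangular: the moments determine the cumulants, which are therefore independent of all choices and
inherit degree and symmetry from the moments.

The Koszul signs are controlled by working with formal signed sums of lists of blocks. Partitions of
a word are generated by adding one letter at the front, either as a new first block or, through a
graded derivation, at the front of an existing block; the last letters, which order the blocks, are
untouched. The identity behind all compositions is `parts_assoc`. Operations applied to a single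
distinguished block are obtained from it by adjoining one extra letter of prescribed degree in front
of the word. -/

noncomputable section

set_option linter.unusedSectionVars false

/-! ### Formal signed sums -/

/-- A formal sum of elements of `β` with signs. -/
abbrev SignedSum (β : Type*) := List (ℤˣ × β)

namespace SignedSum

variable {α β γ X Y : Type*} [AddCommGroup X] [AddCommGroup Y]

/-- The value of a formal signed sum at a function. -/
def eval (u : SignedSum β) (F : β → X) : X := (u.map fun c => c.1 • F c.2).sum

/-- Multiplication of a formal sum by a sign. -/
def scale (s : ℤˣ) (u : SignedSum β) : SignedSum β := List.map (fun c => (s * c.1, c.2)) u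

/-- The image of a formal sum under a map. -/
def push (h : β → γ) (u : SignedSum β) : SignedSum γ := List.map (fun c => (c.1, h c.2)) u

/-- The linear extension of a map to formal sums. -/
def extend (D : β → SignedSum γ) : SignedSum β → SignedSum γ
  | [] => []
  | c :: u => scale c.1 (D c.2) ++ extend D u

@[simp] theorem eval_nil (F : β → X) : eval [] F = 0 := rfl

@[simp] theorem eval_cons (c : ℤˣ × β) (u : SignedSum β) (F : β → X) :
    eval (c :: u) F = c.1 • F c.2 + eval u F := by simp [eval]

@[simp] theorem eval_append (u v : SignedSum β) (F : β → X) :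
    eval (u ++ v) F = eval u F + eval v F := by simp [eval]

@[simp] theorem eval_scale (s : ℤˣ) (u : SignedSum β) (F : β → X) :
    eval (scale s u) F = s • eval u F := by
  induction u with
  | nil => simp [scale]
  | cons c u ih =>
    simp only [scale, List.map_cons, eval_cons, smul_add] at ih ⊢
    rw [ih, mul_smul]

@[simp] theorem eval_push (h : β → γ) (u : SignedSum β) (F : γ → X) :
    eval (push h u) F = eval u (fun b => F (h b)) := by
  simp [eval, push, Function.comp_def]

@[simp] theorem eval_extend (D : β → SignedSum γ) (u : SignedSum β) (F : γ → X) :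
    eval (extend D u) F = eval u (fun b => eval (D b) F) := by
  induction u with
  | nil => rfl
  | cons c u ih => simp [extend, ih]

theorem eval_add (u : SignedSum β) (F G : β → X) :
    eval u (fun b => F b + G b) = eval u F + eval u G := by
  induction u with
  | nil => simp
  | cons c u ih => simp only [eval_cons, ih, smul_add]; abel

theorem eval_zero (u : SignedSum β) : eval u (fun _ => (0 : X)) = 0 := by
  induction u with
  | nil => simp
  | cons c u ih => simp [ih]

theorem eval_smul (u : SignedSum β) (s : ℤˣ) (F : β → X) :
    eval u (fun b => s • F b) = s • eval u F := by
  induction u with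
  | nil => simp
  | cons c u ih => simp only [eval_cons, ih, smul_add, smul_smul, mul_comm]

theorem map_eval (h : X →+ Y) (u : SignedSum β) (F : β → X) :
    h (eval u F) = eval u (fun b => h (F b)) := by
  induction u with
  | nil => simp
  | cons c u ih => simp only [eval_cons, map_add, ih, Units.smul_def, map_zsmul]

theorem eval_comm (u : SignedSum β) (v : SignedSum γ) (F : β → γ → X) :
    eval u (fun b => eval v (F b)) = eval v (fun c => eval u (fun b => F b c)) := by
  induction u with
  | nil => simp [eval_zero]
  | cons c u ih => simp only [eval_cons, ih, eval_add, eval_smul]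

theorem eval_congr {u : SignedSum β} {F G : β → X} (h : ∀ c ∈ u, F c.2 = G c.2) :
    eval u F = eval u G := by
  induction u with
  | nil => simp
  | cons c u ih =>
    rw [eval_cons, eval_cons, h c (by simp), ih fun c hc => h c (by simp [hc])]

/-- The sign `(-1)^m`. -/
def sg (m : ℤ) : ℤˣ := m.negOnePow

@[simp] theorem sg_zero : sg 0 = 1 := Int.negOnePow_zero

theorem sg_add (m n : ℤ) : sg (m + n) = sg m * sg n := Int.negOnePow_add m n

theorem sg_mul_self (m : ℤ) : sg m * sg m = 1 := Int.units_mul_self _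

end SignedSum

/-! ### Partitions of words -/

namespace WordPartition

open SignedSum

variable {α β γ X : Type*} [AddCommGroup X]

/-- The total degree of a word. -/
def wt (g : β → ℤ) (p : List β) : ℤ := (p.map g).sum

@[simp] theorem wt_nil (g : β → ℤ) : wt g [] = 0 := rfl
@[simp] theorem wt_cons (g : β → ℤ) (b : β) (p : List β) : wt g (b :: p) = g b + wt g p := by
  simp [wt]
@[simp] theorem wt_append (g : β → ℤ) (p q : List β) : wt g (p ++ q) = wt g p + wt g q := by
  simp [wt]
theorem wt_perm (g : β → ℤ) {p q : List β} (h : p.Perm q) : wt g p = wt g q :=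
  (h.map g).sum_eq
theorem wt_flatten (g : β → ℤ) (p : List (List β)) : wt (wt g) p = wt g p.flatten := by
  induction p with
  | nil => rfl
  | cons B p ih => simp [ih]

/-- The derivation of degree `e` on words which acts on letters by `D`. -/
def der (e : ℤ) (g : β → ℤ) (D : β → SignedSum β) : List β → SignedSum (List β)
  | [] => []
  | b :: p => push (· :: p) (D b) ++ scale (sg (e * g b)) (push (b :: ·) (der e g D p))

/-- Adding the letter `a` at the front of a word. -/
def consOp (a : α) (B : List α) : SignedSum (List α) := [(1, a :: B)]

/-- Adding a letter to a partition, as a new first block or at the front of a block. -/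
def insertLetter (g : α → ℤ) (a : α) (p : List (List α)) : SignedSum (List (List α)) :=
  (1, [a] :: p) :: der (g a) (wt g) (consOp a) p

/-- The signed sum of the partitions of a word, with blocks ordered by their last letters. -/
def parts (g : α → ℤ) : List α → SignedSum (List (List α))
  | [] => [(1, [])]
  | a :: L => extend (insertLetter g a) (parts g L)

/-- The signed sum of all the ways to partition each of the words of a list. -/
def prodParts (g : α → ℤ) : List (List α) → SignedSum (List (List (List α)))
  | [] => [(1, [])]
  | B :: q => extend (fun r => push (r :: ·) (prodParts g q)) (parts g B)

@[simp] theorem eval_consOp (a : α) (B : List α) (F : List α → X) :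
    eval (consOp a B) F = F (a :: B) := by simp [consOp]

@[simp] theorem eval_der_nil (e : ℤ) (g : β → ℤ) (D : β → SignedSum β) (F : List β → X) :
    eval (der e g D []) F = 0 := rfl

@[simp] theorem eval_der_cons (e : ℤ) (g : β → ℤ) (D : β → SignedSum β) (b : β) (p : List β)
    (F : List β → X) : eval (der e g D (b :: p)) F =
      eval (D b) (fun b' => F (b' :: p)) +
        sg (e * g b) • eval (der e g D p) (fun q => F (b :: q)) := by
  simp [der]

@[simp] theorem eval_insertLetter (g : α → ℤ) (a : α) (p : List (List α))
    (F : List (List α) → X) : eval (insertLetter g a p) F =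
      F ([a] :: p) + eval (der (g a) (wt g) (consOp a) p) F := by
  simp [insertLetter]

@[simp] theorem eval_parts_nil (g : α → ℤ) (F : List (List α) → X) :
    eval (parts g []) F = F [] := by simp [parts]

@[simp] theorem eval_parts_cons (g : α → ℤ) (a : α) (L : List α) (F : List (List α) → X) :
    eval (parts g (a :: L)) F =
      eval (parts g L) (fun p => eval (insertLetter g a p) F) := by
  simp only [parts, eval_extend]

@[simp] theorem eval_prodParts_nil (g : α → ℤ) (F : List (List (List α)) → X) :
    eval (prodParts g []) F = F [] := by simp [prodParts]

@[simp] theorem eval_prodParts_cons (g : α → ℤ) (B : List α) (q : List (List α))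
    (F : List (List (List α)) → X) : eval (prodParts g (B :: q)) F =
      eval (parts g B) (fun r => eval (prodParts g q) (fun s => F (r :: s))) := by
  simp only [prodParts, eval_extend, eval_push]

/-- Signs are forgotten here: statements that hold summand by summand only need the shape of the
lists which occur. -/
theorem mem_der_consOp {e : ℤ} {g : List α → ℤ} {a : α} {p : List (List α)}
    {c : ℤˣ × List (List α)} (hc : c ∈ der e g (consOp a) p) :
    ∃ p₁ B p₂, p = p₁ ++ B :: p₂ ∧ c.2 = p₁ ++ (a :: B) :: p₂ := by
  induction p generalizing c with
  | nil => simp [der] at hc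
  | cons b p ih =>
    simp only [der, push, scale, consOp, List.map_cons, List.map_nil, List.map_map,
      List.cons_append, List.nil_append, List.mem_cons, List.mem_map, Function.comp] at hc
    rcases hc with rfl | ⟨c', hc', rfl⟩
    · exact ⟨[], b, p, rfl, rfl⟩
    · obtain ⟨p₁, B, p₂, rfl, h⟩ := ih hc'
      exact ⟨b :: p₁, B, p₂, rfl, by simp [h]⟩

/-- `p` is a decomposition of (a permutation of) the word `L` into nonempty blocks. -/
def IsDecomp (L : List α) (p : List (List α)) : Prop :=
  p.flatten.Perm L ∧ ∀ B ∈ p, B ≠ []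

theorem mem_extend {D : β → SignedSum γ} {u : SignedSum β} {c : ℤˣ × γ}
    (hc : c ∈ extend D u) : ∃ b ∈ u, ∃ c' ∈ D b.2, c'.2 = c.2 := by
  induction u with
  | nil => simp [extend] at hc
  | cons b u ih =>
    simp only [extend, scale, List.mem_append, List.mem_map] at hc
    rcases hc with ⟨c', hc', rfl⟩ | hc
    · exact ⟨b, by simp, c', hc', rfl⟩
    · obtain ⟨b', hb', h⟩ := ih hc
      exact ⟨b', by simp [hb'], h⟩

theorem isDecomp_of_mem_parts {g : α → ℤ} {L : List α} {c : ℤˣ × List (List α)}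
    (hc : c ∈ parts g L) : IsDecomp L c.2 := by
  induction L generalizing c with
  | nil =>
    simp only [parts, List.mem_singleton] at hc
    subst hc
    exact ⟨by simp, by simp⟩
  | cons a L ih =>
    obtain ⟨b, hb, c', hc', h⟩ := mem_extend hc
    rw [← h]
    obtain ⟨h₁, h₂⟩ := ih hb
    simp only [insertLetter, List.mem_cons] at hc'
    rcases hc' with rfl | hc'
    · exact ⟨by simpa using h₁, by simpa using h₂⟩
    · obtain ⟨p₁, B, p₂, hp, hc⟩ := mem_der_consOp hc'
      rw [hp] at h₁ h₂
      rw [hc]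
      constructor
      · simp only [List.flatten_append, List.flatten_cons, List.cons_append] at h₁ ⊢
        exact List.perm_middle.trans (h₁.cons a)
      · intro B' hB'
        simp only [List.mem_append, List.mem_cons] at hB'
        rcases hB' with h' | rfl | h'
        · exact h₂ _ (by simp [h'])
        · simp
        · exact h₂ _ (by simp [h'])

theorem eval_parts_congr {g : α → ℤ} {L : List α} {F G : List (List α) → X}
    (h : ∀ p, IsDecomp L p → F p = G p) : eval (parts g L) F = eval (parts g L) G :=
  eval_congr fun _ hc => h _ (isDecomp_of_mem_parts hc)

theorem IsDecomp.wt_eq {g : α → ℤ} {L : List α} {p : List (List α)} (h : IsDecomp L p) :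
    wt (wt g) p = wt g L := by rw [wt_flatten, wt_perm g h.1]

/-! ### Associativity -/

/-- Every summand of the derivation has the same total degree, that of `p` raised by `g a`, so a
sign depending only on the total degree is constant and can be pulled out. -/
theorem eval_der_sg (g : α → ℤ) (a : α) (m : ℤ) (p : List (List α)) (F : List (List α) → X) :
    eval (der (g a) (wt g) (consOp a) p) (fun x => sg (m * wt (wt g) x) • F x) =
      sg (m * (g a + wt (wt g) p)) • eval (der (g a) (wt g) (consOp a) p) F := by
  rw [← eval_smul]
  refine eval_congr fun c hc => ?_
  obtain ⟨p₁, B, p₂, rfl, h⟩ := mem_der_consOp hc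
  rw [h]
  congr 2
  simp only [wt_append, wt_cons]
  ring

/-- The graded commutator of two derivations is a derivation, determined by its action on one
letter. Here the letter `a` can enter the freshly added block `B` or another block; the second kind
of term cancels in the commutator, and what remains adds the block `a :: B`. -/
theorem eval_der_consOp_comm (g : α → ℤ) (a : α) (B : List α) (r : List (List (List α)))
    (G : List (List (List α)) → X) :
    eval (der (wt g B) (wt (wt g)) (consOp B) r)
        (fun x => eval (der (g a) (wt (wt g)) (der (g a) (wt g) (consOp a)) x) G) =
      eval (der (g a + wt g B) (wt (wt g)) (consOp (a :: B)) r) G +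
      sg (g a * wt g B) • eval (der (g a) (wt (wt g)) (der (g a) (wt g) (consOp a)) r)
        (fun x => eval (der (wt g B) (wt (wt g)) (consOp B) x) G) := by
  induction r generalizing G with
  | nil => simp
  | cons r₀ r ih =>
    simp only [eval_der_cons, eval_consOp, wt_cons, eval_add, eval_smul, ih, smul_add, smul_smul]
    rw [eval_der_sg, eval_comm (der (g a) (wt g) (consOp a) r₀)]
    have h := sg_mul_self (g a * wt g B)
    simp only [mul_add, add_mul, sg_add, smul_smul, mul_comm (wt g B) (g a)]
    generalize sg (g a * wt g B) = s₁ at *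
    generalize sg (g a * wt (wt g) r₀) = s₂
    generalize sg (wt g B * wt (wt g) r₀) = s₃
    rw [← mul_assoc s₁ s₁ s₃, h, one_mul, mul_comm s₃ s₂, mul_left_comm s₃ s₂ s₁, mul_comm s₃ s₁,
      mul_left_comm s₂ s₁ s₃]
    abel

/-- Lengthening a block of `p` does not affect how the blocks are grouped, so the derivation passes
through `parts`; the signs match by the commutator formula `eval_der_consOp_comm`. -/
theorem eval_der_parts (g : α → ℤ) (a : α) (p : List (List α)) (G : List (List (List α)) → X) :
    eval (der (g a) (wt g) (consOp a) p) (fun x => eval (parts (wt g) x) G) =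
      eval (parts (wt g) p)
        (fun r => eval (der (g a) (wt (wt g)) (der (g a) (wt g) (consOp a)) r) G) := by
  induction p generalizing G with
  | nil => simp
  | cons B p ih =>
    simp only [eval_der_cons, eval_consOp, eval_parts_cons, ih, ← eval_smul, ← eval_add]
    refine eval_parts_congr fun r _ => ?_
    simp only [eval_insertLetter, eval_der_cons, eval_consOp, eval_der_nil, smul_zero, add_zero,
      wt_cons, wt_nil, eval_der_consOp_comm, eval_add, eval_smul, smul_add]
    abel

/-- Once a word of `q` has received the letter `a`, the recursion for its partitions puts `a` in a
new block or in an old one. This is why the inner operation on the right is `insertLetter`. -/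
theorem eval_der_prodParts (g : α → ℤ) (a : α) (q : List (List α))
    (G : List (List (List α)) → X) :
    eval (der (g a) (wt g) (consOp a) q) (fun x => eval (prodParts g x) G) =
      eval (prodParts g q)
        (fun r => eval (der (g a) (wt (wt g)) (insertLetter g a) r) G) := by
  induction q generalizing G with
  | nil => simp
  | cons B q ih =>
    simp only [eval_der_cons, eval_consOp, eval_prodParts_cons, eval_parts_cons]
    rw [eval_comm _ (parts g B)]
    simp only [ih]
    rw [← eval_smul, ← eval_add]
    refine eval_parts_congr fun r hr => ?_
    rw [eval_add, eval_smul, eval_comm (prodParts g q), hr.wt_eq]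

/-- Partitions of a partition are the same as a partition with a partition of each block. -/
theorem parts_assoc (g : α → ℤ) (L : List α) (G : List (List (List α)) → X) :
    eval (parts g L) (fun p => eval (parts (wt g) p) G) =
      eval (parts g L) (fun q => eval (prodParts g q) G) := by
  induction L generalizing G with
  | nil => simp
  | cons a L ih =>
    -- Both sides satisfy the same recursion in the first letter: either `a` is alone at both
    -- levels, or it is inserted into one of the groups of blocks, as a new block there or inside a
    -- block.
    have h₁ : ∀ p, eval (insertLetter g a p) (fun p => eval (parts (wt g) p) G) =
        eval (parts (wt g) p) (fun r => G ([[a]] :: r) +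
          eval (der (g a) (wt (wt g)) (insertLetter g a) r) G) := by
      intro p
      rw [eval_insertLetter, eval_der_parts, eval_parts_cons, ← eval_add]
      refine eval_parts_congr fun r _ => ?_
      -- A derivation is additive in its action on letters, and `insertLetter` is the sum of adding
      -- the block `[a]` and of putting `a` into a block.
      have h : ∀ (r : List (List (List α))) (G : List (List (List α)) → X),
          eval (der (wt g [a]) (wt (wt g)) (consOp [a]) r) G +
            eval (der (g a) (wt (wt g)) (der (g a) (wt g) (consOp a)) r) G =
          eval (der (g a) (wt (wt g)) (insertLetter g a) r) G := by
        intro r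
        induction r with
        | nil => simp
        | cons r₀ r ih =>
          intro G
          simp only [eval_der_cons, eval_consOp, eval_insertLetter, ← ih, smul_add, wt_cons,
            wt_nil, add_zero]
          abel
      rw [eval_insertLetter, add_assoc, h]
    have h₂ : ∀ q, eval (insertLetter g a q) (fun p => eval (prodParts g p) G) =
        eval (prodParts g q) (fun r => G ([[a]] :: r) +
          eval (der (g a) (wt (wt g)) (insertLetter g a) r) G) := by
      intro q
      simp [eval_der_prodParts, eval_add]
    simp only [eval_parts_cons, h₁, h₂, ih]

end WordPartition

open SignedSum WordPartition

/-! ### Ordered finite partitions as partitions of words -/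

theorem negOnePow_eq_sg (m : ℤ) : m.negOnePow = sg m := rfl

theorem SignedSum.sg_sum {ι : Type*} (s : Finset ι) (m : ι → ℤ) :
    sg (∑ i ∈ s, m i) = ∏ i ∈ s, sg (m i) := by
  classical
  induction s using Finset.induction_on with
  | empty => simp
  | insert i s hi ih => rw [Finset.sum_insert hi, Finset.prod_insert hi, sg_add, ih]

namespace WordPartition

variable {α X : Type*} [AddCommGroup X]

theorem wt_ofFn {β : Type*} (g : β → ℤ) {n : ℕ} (y : Fin n → β) :
    wt g (List.ofFn y) = ∑ i, g (y i) := by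
  simp [wt, List.sum_ofFn, Function.comp_def]

theorem sum_filter_lt_succ {m : ℕ} (i : Fin m) (h : Fin (m + 1) → ℤ) :
    ∑ j with j < i.succ, h j = h 0 + ∑ j with j < i, h j.succ := by
  simp only [Finset.sum_filter]
  rw [Fin.sum_univ_succ]
  simp

theorem eval_der_ofFn (e : ℤ) (g : List α → ℤ) (a : α) {m : ℕ} (b : Fin m → List α)
    (F : List (List α) → X) :
    eval (der e g (consOp a) (List.ofFn b)) F =
      ∑ i, sg (e * ∑ j with j < i, g (b j)) •
        F (List.ofFn (Function.update b i (a :: b i))) := by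
  induction m generalizing F with
  | zero => simp
  | succ m ih =>
    rw [List.ofFn_succ, eval_der_cons, eval_consOp, ih, Fin.sum_univ_succ, Finset.smul_sum]
    congr 1
    · simp [List.ofFn_succ, Finset.filter_false_of_mem]
    · refine Finset.sum_congr rfl fun i _ => ?_
      rw [smul_smul, ← sg_add, sum_filter_lt_succ, mul_add]
      congr 2
      rw [List.ofFn_succ (f := Function.update b i.succ _)]
      refine congrArg₂ List.cons (Function.update_of_ne (Fin.succ_ne_zero i).symm _ _).symm
        (congrArg List.ofFn ?_)
      funext j
      by_cases hj : j = i
      · subst hj; simp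
      · rw [Function.update_of_ne hj, Function.update_of_ne (by simpa using hj)]

end WordPartition

namespace OrderedFinpartition

variable {α X : Type*} [AddCommGroup X] {n : ℕ} (π : OrderedFinpartition n)

/-- The blocks of a tuple as a list of words. -/
def blocks (y : Fin n → α) : List (List α) := List.ofFn fun i => List.ofFn (π.block y i)

theorem index_emb (i : Fin π.length) (r : Fin (π.partSize i)) : π.index (π.emb i r) = i := by
  by_contra h
  exact π.emb_ne_emb_of_ne h (π.emb_invEmbedding _)

theorem blocks_extendLeft (a : α) (y : Fin n → α) :
    π.extendLeft.blocks (Fin.cons a y : Fin (n + 1) → α) = [a] :: π.blocks y := by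
  unfold blocks
  refine (List.ofFn_succ (n := π.length)).trans ?_
  congr 1

theorem block_extendMiddle (i j : Fin π.length) (a : α) (y : Fin n → α) :
    List.ofFn ((π.extendMiddle i).block (Fin.cons a y : Fin (n + 1) → α) j) =
      Function.update (fun i => List.ofFn (π.block y i)) i (a :: List.ofFn (π.block y i)) j := by
  by_cases hj : j = i
  · subst hj
    have h : (π.extendMiddle j).partSize j = π.partSize j + 1 := by simp
    rw [List.ofFn_congr h, Function.update_self, List.ofFn_succ]
    congr 1
    · simp only [block, extendMiddle, dif_pos]
      rfl
    · congr 1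
      funext r
      simp only [block, extendMiddle, dif_pos]
      rfl
  · have h : (π.extendMiddle i).partSize j = π.partSize j := by simp [hj]
    rw [List.ofFn_congr h, Function.update_of_ne hj]
    congr 1
    funext r
    simp only [block, extendMiddle, dif_neg hj]
    rfl

theorem blocks_extendMiddle (i : Fin π.length) (a : α) (y : Fin n → α) :
    (π.extendMiddle i).blocks (Fin.cons a y : Fin (n + 1) → α) =
      List.ofFn (Function.update (fun i => List.ofFn (π.block y i)) i
        (a :: List.ofFn (π.block y i))) := by
  unfold blocks
  congr 1
  funext j
  exact π.block_extendMiddle i j a y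

theorem index_extendLeft_zero : π.extendLeft.index 0 = (0 : Fin (π.length + 1)) :=
  π.extendLeft.index_emb (0 : Fin (π.length + 1)) (0 : Fin 1)

theorem index_extendLeft_succ (j : Fin n) :
    π.extendLeft.index j.succ = ((π.index j).succ : Fin (π.length + 1)) := by
  have h := π.extendLeft.index_emb ((π.index j).succ : Fin (π.length + 1)) (π.invEmbedding j)
  rw [← h]
  congr 1
  change j.succ = (π.emb (π.index j) (π.invEmbedding j)).succ
  rw [emb_invEmbedding]

theorem index_extendMiddle_succ (i : Fin π.length) (j : Fin n) :
    (π.extendMiddle i).index j.succ = π.index j := by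
  obtain ⟨r, hr⟩ : ∃ r, (π.extendMiddle i).emb (π.index j) r = j.succ := by
    by_cases h : π.index j = i
    · subst h
      have h : (π.extendMiddle (π.index j)).partSize (π.index j) =
        π.partSize (π.index j) + 1 := by simp
      exact ⟨Fin.cast h.symm (π.invEmbedding j).succ, by
        simp only [extendMiddle, dif_pos]
        exact congrArg Fin.succ (π.emb_invEmbedding j)⟩
    · have h' : (π.extendMiddle i).partSize (π.index j) = π.partSize (π.index j) := by simp [h]
      exact ⟨Fin.cast h'.symm (π.invEmbedding j), by
        simp only [extendMiddle, dif_neg h]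
        exact congrArg Fin.succ (π.emb_invEmbedding j)⟩
  rw [← hr]
  exact (π.extendMiddle i).index_emb _ r

theorem sign_extendLeft (a : ℤ) (d : Fin n → ℤ) :
    π.extendLeft.sign (Fin.cons a d : Fin (n + 1) → ℤ) = π.sign d := by
  unfold sign
  rw [Fin.prod_univ_succ]
  simp only [Fin.prod_univ_succ (n := n), index_extendLeft_zero, index_extendLeft_succ,
    Fin.cons_succ, Fin.cons_zero, Fin.succ_lt_succ_iff, lt_irrefl, false_and, if_false, one_mul,
    Fin.not_lt_zero, Fin.succ_pos, true_and]
  have h : ∀ x : Fin n, ¬ ((π.index x).succ < (0 : Fin (π.length + 1))) := fun x => Fin.not_lt_zero _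
  refine (congrArg (· * _) (Finset.prod_eq_one fun x _ => if_neg (h x))).trans ?_
  rw [one_mul]
  refine Finset.prod_congr rfl fun x _ => Finset.prod_congr rfl fun y _ => ?_
  refine if_congr (and_congr_right fun _ => ?_) rfl rfl
  exact Fin.succ_lt_succ_iff

/-- The new smallest element moves past exactly the elements of the blocks preceding its own; the
inversions among the old elements are unchanged. -/
theorem sign_extendMiddle (i : Fin π.length) (a : ℤ) (d : Fin n → ℤ) :
    (π.extendMiddle i).sign (Fin.cons a d : Fin (n + 1) → ℤ) =
      sg (a * ∑ j with j < i, π.blockDeg d j) * π.sign d := by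
  unfold sign
  rw [Fin.prod_univ_succ]
  simp only [Fin.prod_univ_succ (n := n), index_extendMiddle_zero, index_extendMiddle_succ,
    Fin.cons_succ, Fin.cons_zero, Fin.succ_lt_succ_iff, lt_irrefl, false_and, if_false, one_mul,
    Fin.not_lt_zero, Fin.succ_pos, true_and, negOnePow_eq_sg]
  congr 1
  rw [← π.prod_sigma_eq_prod, Finset.mul_sum, sg_sum, Finset.prod_filter]
  refine Finset.prod_congr rfl fun m _ => ?_
  simp only [index_emb]
  by_cases hm : m < i
  · have h : π.blockDeg d m = ∑ r, d (π.emb m r) := rfl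
    have hm' : ((show Fin (π.extendMiddle i).length from m) < i) := hm
    simp only [hm, if_true, h, Finset.mul_sum, sg_sum]
    exact Finset.prod_congr rfl fun x _ => if_pos hm'
  · have hm' : ¬ ((show Fin (π.extendMiddle i).length from m) < i) := hm
    simp only [hm]
    exact Finset.prod_eq_one fun x _ => if_neg hm'

theorem wt_block (g : α → ℤ) (y : Fin n → α) (i : Fin π.length) :
    wt g (List.ofFn (π.block y i)) = π.blockDeg (fun j => g (y j)) i := wt_ofFn _ _

/-- Signed sums over the partitions of `{1, …, n}` are evaluations of `parts`. -/
theorem sum_sign_smul_blocks (g : α → ℤ) {n : ℕ} (y : Fin n → α) (F : List (List α) → X) :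
    ∑ π : OrderedFinpartition n, π.sign (fun i => g (y i)) • F (π.blocks y) =
      eval (parts g (List.ofFn y)) F := by
  induction n generalizing F with
  | zero =>
    rw [Fintype.sum_unique]
    simp [sign, blocks]
  | succ n ih =>
    obtain ⟨a, y, rfl⟩ : ∃ a z, y = (Fin.cons a z : Fin (n + 1) → α) :=
      ⟨y 0, Fin.tail y, (Fin.cons_self_tail y).symm⟩
    have hd : (fun i => g ((Fin.cons a y : Fin (n + 1) → α) i)) =
        (Fin.cons (g a) (fun i => g (y i)) : Fin (n + 1) → ℤ) := by
      funext i; refine Fin.cases ?_ (fun _ => ?_) i <;> simp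
    -- `extendEquiv` builds the partitions of `n + 1` elements from those of `n` by the rule that
    -- defines `parts`: `none` is a new first block and `some i` enlarges the block `i`.
    rw [List.ofFn_cons, eval_parts_cons, ← ih, ← (extendEquiv n).sum_comp, Fintype.sum_sigma, hd]
    refine Finset.sum_congr rfl fun π _ => ?_
    rw [Fintype.sum_option, eval_insertLetter, smul_add]
    congr 1
    · change π.extendLeft.sign _ • F (π.extendLeft.blocks _) = _
      rw [sign_extendLeft, blocks_extendLeft]
    · rw [blocks, eval_der_ofFn, Finset.smul_sum]
      refine Finset.sum_congr rfl fun i _ => ?_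
      change (π.extendMiddle i).sign _ • F ((π.extendMiddle i).blocks _) = _
      rw [sign_extendMiddle, blocks_extendMiddle, smul_smul, mul_comm]
      simp only [wt_block]

end OrderedFinpartition

namespace WordPartition

variable {α β X W : Type*} [AddCommGroup X] [AddCommGroup W]

/-! ### Decompositions -/

theorem IsDecomp.ne_nil {L : List α} {p : List (List α)} (h : IsDecomp L p) (hL : L ≠ []) :
    p ≠ [] := by
  rintro rfl
  exact hL (List.nil_perm.1 h.1)

theorem IsDecomp.subset {L : List α} {p : List (List α)} (h : IsDecomp L p) {B : List α}
    (hB : B ∈ p) : B ⊆ L := fun _ hx => h.1.subset (List.mem_flatten.2 ⟨B, hB, hx⟩)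

theorem IsDecomp.length_lt {L : List α} {p : List (List α)} (h : IsDecomp L p)
    (hp : p.length ≠ 1) {B : List α} (hB : B ∈ p) : B.length < L.length := by
  rw [← h.1.length_eq]
  obtain ⟨p₁, p₂, rfl⟩ := List.append_of_mem hB
  have hne : p₁ ++ p₂ ≠ [] := by
    intro h'
    rw [List.append_eq_nil_iff] at h'
    simp [h'.1, h'.2] at hp
  obtain ⟨B', hB'⟩ := List.exists_mem_of_ne_nil _ hne
  have hpos : 0 < (p₁ ++ p₂).flatten.length := by
    obtain ⟨x, hx⟩ := List.exists_mem_of_ne_nil _ (h.2 B' (by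
      simp only [List.mem_append, List.mem_cons] at hB' ⊢; tauto))
    exact List.length_pos_of_mem (List.mem_flatten.2 ⟨B', hB', hx⟩)
  simp only [List.flatten_append, List.flatten_cons, List.length_append] at hpos ⊢
  omega

theorem eval_parts_eq_single {g : α → ℤ} {L : List α} (hL : L ≠ []) {F : List (List α) → X}
    (hF : ∀ p, IsDecomp L p → p.length ≠ 1 → F p = 0) : eval (parts g L) F = F [L] := by
  -- Cutting `F` off to zero outside lists of length one makes the hypothesis independent of `L`, so
  -- that the induction can replace `F` freely.
  suffices H : ∀ (L : List α), L ≠ [] → ∀ F : List (List α) → X,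
      (∀ p : List (List α), p.length ≠ 1 → F p = 0) → eval (parts g L) F = F [L] by
    have h := H L hL (fun p => if p.length = 1 then F p else 0) (fun p hp => if_neg hp)
    refine Eq.trans ?_ (h.trans (if_pos rfl))
    refine eval_parts_congr fun p hp => ?_
    by_cases h1 : p.length = 1
    · rw [if_pos h1]
    · rw [if_neg h1, hF p hp h1]
  intro L
  induction L with
  | nil => intro h; exact absurd rfl h
  | cons a L ih =>
    intro _ F hF
    rw [eval_parts_cons]
    by_cases hL : L = []
    · subst hL; simp
    · have hlen : ∀ p, p ≠ [] → eval (insertLetter g a p) F =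
          eval (der (g a) (wt g) (consOp a) p) F := by
        intro p hp
        rw [eval_insertLetter, hF _ (by simpa using hp), zero_add]
      rw [eval_parts_congr (fun p hp => hlen p (hp.ne_nil hL)), ih hL]
      · simp
      · intro p hp
        rw [← eval_zero (X := X) (der (g a) (wt g) (consOp a) p)]
        refine eval_congr fun c hc => ?_
        obtain ⟨p₁, B, p₂, rfl, h⟩ := mem_der_consOp hc
        rw [h]
        exact hF _ (by simpa using hp)

theorem eval_der_map (e : ℤ) {g' : β → ℤ} {g : α → ℤ} (h : α → β) (hg : ∀ a, g' (h a) = g a)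
    (a : α) (p : List (List α)) (F : List (List β) → X) :
    eval (der e (wt g') (consOp (h a)) (p.map (List.map h))) F =
      eval (der e (wt g) (consOp a) p) (fun q => F (q.map (List.map h))) := by
  have hw : ∀ B : List α, wt g' (B.map h) = wt g B := fun B => by
    simp [wt, Function.comp_def, hg]
  induction p generalizing F with
  | nil => simp
  | cons B p ih => simp [ih, hw]

theorem eval_parts_map {g' : β → ℤ} {g : α → ℤ} (h : α → β) (hg : ∀ a, g' (h a) = g a)
    (L : List α) (F : List (List β) → X) :
    eval (parts g' (L.map h)) F = eval (parts g L) (fun p => F (p.map (List.map h))) := by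
  induction L generalizing F with
  | nil => simp
  | cons a L ih =>
    rw [List.map_cons, eval_parts_cons, eval_parts_cons, ih]
    refine eval_parts_congr fun p _ => ?_
    simp [hg, eval_der_map _ h hg]

/-! ### Compositions and insertions -/

/-- A function on words of vectors with degrees which is additive in each vector. -/
def MultiAdd (f : List (ℤ × W) → X) : Prop :=
  ∀ (L₁ : List (ℤ × W)) (m : ℤ) (L₂ : List (ℤ × W)) (u v : W),
    f (L₁ ++ (m, u + v) :: L₂) = f (L₁ ++ (m, u) :: L₂) + f (L₁ ++ (m, v) :: L₂)

theorem MultiAdd.cons {f : List (ℤ × W) → X} (hf : MultiAdd f) (c : ℤ × W) :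
    MultiAdd (fun L => f (c :: L)) := fun L₁ => hf (c :: L₁)

/-- The value of a multiadditive function as an additive map in its first argument. -/
def MultiAdd.headHom {f : List (ℤ × W) → X} (hf : MultiAdd f) (m : ℤ) (L : List (ℤ × W)) :
    W →+ X := AddMonoidHom.mk' (fun u => f ((m, u) :: L)) (hf [] m L)

theorem MultiAdd.zero_head {f : List (ℤ × W) → X} (hf : MultiAdd f) (m : ℤ)
    (L : List (ℤ × W)) : f ((m, 0) :: L) = 0 := (hf.headHom m L).map_zero

theorem MultiAdd.eval_head {f : List (ℤ × W) → X} (hf : MultiAdd f) (m : ℤ)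
    (L : List (ℤ × W)) (U : SignedSum β) (F : β → W) :
    f ((m, eval U F) :: L) = eval U (fun b => f ((m, F b) :: L)) :=
  map_eval (hf.headHom m L) U F

/-- A block together with its total degree and value. -/
def tag (g : α → ℤ) (φ : List α → W) (B : List α) : ℤ × W := (wt g B, φ B)

theorem tag_def (g : α → ℤ) (φ : List α → W) : tag g φ = fun B => (wt g B, φ B) := rfl

/-- The sum of `ε(π) f(φ(B_1), …, φ(B_m))` over the partitions of a word. -/
def comp (g : α → ℤ) (f : List (ℤ × W) → X) (φ : List α → W) (L : List α) : X :=
  eval (parts g L) (fun p => f (p.map (tag g φ)))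

/-- The sum of `± f(φ(B_1), …, θ(B_i), …, φ(B_m))` over the blocks of a decomposition, where `θ`
is an operation of degree `e`. -/
def mark (e : ℤ) (g : α → ℤ) (φ θ : List α → W) : (List (ℤ × W) → X) → List (List α) → X
  | _, [] => 0
  | f, B :: p => f ((wt g B + e, θ B) :: p.map (tag g φ)) +
      sg (e * wt g B) • mark e g φ θ (fun L => f (tag g φ B :: L)) p

/-- The sum of `ε(π) mark f φ θ` over the partitions of a word. -/
def markSum (e : ℤ) (g : α → ℤ) (f : List (ℤ × W) → X) (φ θ : List α → W) (L : List α) : X :=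
  eval (parts g L) (mark e g φ θ f)

/-- The value of a word with one letter, and `0` on other words. -/
def single : List (ℤ × W) → W
  | [c] => c.2
  | _ => 0

/-- The sum of `± f(x_{B_1}, …, ℓ(x_{B_i}), …, x_{B_m})` over the partitions of a word with all
blocks but the chosen one singletons. -/
def ins (f : List (ℤ × W) → X) (l : List (ℤ × W) → W) (L : List (ℤ × W)) : X :=
  markSum 1 Prod.fst f single l L

theorem mark_congr {e : ℤ} {g : α → ℤ} {φ θ φ' θ' : List α → W} {f : List (ℤ × W) → X}
    {p : List (List α)} (hφ : ∀ B ∈ p, φ B = φ' B) (hθ : ∀ B ∈ p, θ B = θ' B) :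
    mark e g φ θ f p = mark e g φ' θ' f p := by
  induction p generalizing f with
  | nil => rfl
  | cons B p ih =>
    have h : p.map (tag g φ) = p.map (tag g φ') :=
      List.map_congr_left fun B hB => by simp [tag, hφ B (by simp [hB])]
    have h' : tag g φ B = tag g φ' B := by simp [tag, hφ B]
    simp only [mark, h, h', hθ B (by simp),
      ih (fun B hB => hφ B (by simp [hB])) (fun B hB => hθ B (by simp [hB]))]

theorem comp_congr {g : α → ℤ} {f f' : List (ℤ × W) → X} {φ φ' : List α → W} {L : List α}
    (hf : ∀ p, IsDecomp L p → f (p.map (tag g φ)) = f' (p.map (tag g φ)))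
    (hφ : ∀ B, B ≠ [] → B ⊆ L → φ B = φ' B) : comp g f φ L = comp g f' φ' L := by
  refine eval_parts_congr fun p hp => ?_
  rw [hf p hp]
  congr 1
  exact List.map_congr_left fun B hB => by simp [tag, hφ B (hp.2 B hB) (hp.subset hB)]

theorem mark_eq_zero {e : ℤ} {g : α → ℤ} {φ θ : List α → W} {f : List (ℤ × W) → X}
    (hf : MultiAdd f) {p : List (List α)} (hθ : ∀ B ∈ p, θ B = 0) : mark e g φ θ f p = 0 := by
  induction p generalizing f with
  | nil => rfl
  | cons B p ih =>
    rw [mark, hθ B (by simp), hf.zero_head, ih (hf.cons _) fun B hB => hθ B (by simp [hB])]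
    simp

theorem mark_of_eq_zero {e : ℤ} {g : α → ℤ} {φ θ : List α → W} {f : List (ℤ × W) → X}
    (hf : ∀ L, f L = 0) {p : List (List α)} : mark e g φ θ f p = 0 := by
  induction p generalizing f with
  | nil => rfl
  | cons B p ih => rw [mark, hf, ih fun L => hf _]; simp

theorem markSum_eq_head {e : ℤ} {g : α → ℤ} {φ θ : List α → W} {f : List (ℤ × W) → X}
    (hf : MultiAdd f) {L : List α} (hL : L ≠ [])
    (hθ : ∀ B, B ≠ [] → B.length < L.length → B ⊆ L → θ B = 0) :
    markSum e g f φ θ L = f [(wt g L + e, θ L)] := by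
  rw [markSum, eval_parts_eq_single hL]
  · simp [mark]
  · intro p hp hp1
    exact mark_eq_zero hf fun B hB => hθ B (hp.2 B hB) (hp.length_lt hp1 hB) (hp.subset hB)

/-- Expanding a multiadditive function whose arguments are all sums amounts to choosing a partition
of each block independently. The degree tags agree because a decomposition keeps the total degree.
-/
theorem eval_prodParts_map (g : α → ℤ) {f : List (ℤ × W) → X} (hf : MultiAdd f)
    (A : List (List α) → W) (q : List (List α)) :
    eval (prodParts g q) (fun r => f (r.map (tag (wt g) A))) =
      f (q.map (tag g fun B => eval (parts g B) A)) := by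
  induction q generalizing f with
  | nil => simp
  | cons B q ih =>
    rw [eval_prodParts_cons, List.map_cons, tag, hf.eval_head]
    refine eval_parts_congr fun r hr => ?_
    have h := ih (hf.cons (wt g B, A r))
    simp only [List.map_cons] at h ⊢
    rw [← h]
    simp only [tag, hr.wt_eq]

theorem eval_prodParts_mark (e : ℤ) (g : α → ℤ) {f : List (ℤ × W) → X} (hf : MultiAdd f)
    (A D : List (List α) → W) (q : List (List α)) :
    eval (prodParts g q) (mark e (wt g) A D f) =
      mark e g (fun B => eval (parts g B) A) (fun B => eval (parts g B) D) f q := by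
  induction q generalizing f with
  | nil => simp [mark]
  | cons B q ih =>
    simp only [eval_prodParts_cons, mark, eval_add, eval_smul]
    have h : ∀ (A' : List (List α) → W) (m : List (List α) → ℤ) (r : List (List α)),
        eval (prodParts g q) (fun s => f ((m r, A' r) :: s.map (tag (wt g) A))) =
        f ((m r, A' r) :: q.map (tag g fun B => eval (parts g B) A)) := fun A' m r =>
      eval_prodParts_map g (hf.cons (m r, A' r)) A q
    rw [hf.eval_head]
    congr 1
    · refine eval_parts_congr fun r hr => ?_
      rw [h D (fun r => wt (wt g) r + e) r, hr.wt_eq]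
    · have hsum : ∀ r, IsDecomp B r → sg (e * wt (wt g) r) • eval (prodParts g q)
            (mark e (wt g) A D fun L => f (tag (wt g) A r :: L)) =
          sg (e * wt g B) • mark e g (fun B => eval (parts g B) A)
            (fun B => eval (parts g B) D) (fun L => f ((wt g B, A r) :: L)) q := by
        intro r hr
        rw [ih (hf.cons _)]
        simp only [tag, hr.wt_eq]
      rw [eval_parts_congr hsum, eval_smul]
      congr 1
      -- `mark` is additive in the function it is applied to, so the sum over partitions of `B` can
      -- be moved into that function.
      have hlin : ∀ (p : List (List α)) (φ θ : List α → W) (F : List (List α) → List (ℤ × W) → X),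
          eval (parts g B) (fun r => mark e g φ θ (F r) p) =
            mark e g φ θ (fun L => eval (parts g B) (fun r => F r L)) p := by
        intro p φ θ
        induction p with
        | nil => intro F; simp [mark, eval_zero]
        | cons C p ih' => intro F; simp only [mark, eval_add, eval_smul, ih']
      rw [hlin]
      congr 1
      funext L
      rw [tag, hf.eval_head]

/-- Composition is associative. -/
theorem comp_assoc {U : Type*} [AddCommGroup U] (g : α → ℤ) {f : List (ℤ × W) → X}
    (hf : MultiAdd f) (ψ : List (ℤ × U) → W) (φ : List α → U) (L : List α) :
    comp g (comp Prod.fst f ψ) φ L = comp g f (comp g ψ φ) L := by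
  have h := parts_assoc g L (fun r => f (r.map (tag (wt g) fun s => ψ (s.map (tag g φ)))))
  simp only [eval_prodParts_map g hf] at h
  refine Eq.trans (eval_parts_congr fun p _ => ?_) h
  rw [comp, eval_parts_map (g := wt g) (tag g φ) (fun _ => rfl)]
  refine eval_parts_congr fun r _ => ?_
  rw [List.map_map]
  congr 2
  funext s
  simp [tag, Function.comp_def, wt]
  rfl

theorem mark_map {e : ℤ} {g' : β → ℤ} {g : α → ℤ} {h : α → β} (hg : ∀ a, g' (h a) = g a)
    (φ θ : List β → W) (f : List (ℤ × W) → X) (p : List (List α)) :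
    mark e g' φ θ f (p.map (List.map h)) =
      mark e g (fun B => φ (B.map h)) (fun B => θ (B.map h)) f p := by
  have hw : ∀ B : List α, wt g' (B.map h) = wt g B := fun B => by
    simp [wt, Function.comp_def, hg]
  induction p generalizing f with
  | nil => rfl
  | cons B p ih => simp [mark, ih, hw, tag, Function.comp_def, tag_def]

/-- Insertion followed by composition. -/
theorem comp_ins (g : α → ℤ) {f : List (ℤ × W) → X} (hf : MultiAdd f)
    (l : List (ℤ × W) → W) (φ : List α → W) (L : List α) :
    comp g (ins f l) φ L = markSum 1 g f φ (comp g l φ) L := by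
  -- The outer blocks are partitioned with `l` on the marked block and `single` on all the others;
  -- `single` forces each unmarked inner partition to have one block, on which its value is that of
  -- `φ`.
  have h := parts_assoc g L (mark 1 (wt g) (fun s => single (s.map (tag g φ)))
    (fun s => l (s.map (tag g φ))) f)
  simp only [eval_prodParts_mark 1 g hf] at h
  refine Eq.trans (eval_parts_congr fun p _ => ?_) (h.trans (eval_parts_congr fun q hq => ?_))
  · rw [ins, markSum, eval_parts_map (g := wt g) (tag g φ) (fun _ => rfl)]
    refine eval_parts_congr fun r _ => ?_
    exact mark_map (fun _ => rfl) _ _ _ _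
  · refine mark_congr (fun B hB => ?_) fun B _ => rfl
    rw [eval_parts_eq_single (hq.2 B hB)]
    · rfl
    · intro p _ hp
      match p with
      | [] => rfl
      | [a] => exact absurd rfl hp
      | a :: b :: p => rfl

/-! ### An additional letter -/

/-- The degree of letters, with an additional letter of degree `e`. -/
def optDeg (e : ℤ) (g : α → ℤ) : Option α → ℤ := fun a => a.elim e g

/-- The operation which is `θ` on words starting with the additional letter and `φ` on words
without it. -/
def optOp (φ θ : List α → W) : List (Option α) → W
  | none :: B => θ B.reduceOption
  | B => φ B.reduceOption

theorem reduceOption_map_some (B : List α) : (B.map some).reduceOption = B := by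
  induction B with
  | nil => rfl
  | cons a B ih => simp [ih]

@[simp] theorem optOp_map_some (φ θ : List α → W) (B : List α) :
    optOp φ θ (B.map some) = φ B := by
  cases B with
  | nil => rfl
  | cons a B => simp [optOp, reduceOption_map_some]

@[simp] theorem optOp_none_cons (φ θ : List α → W) (B : List α) :
    optOp φ θ (none :: B.map some) = θ B := by simp [optOp, reduceOption_map_some]

@[simp] theorem wt_optDeg_map_some (e : ℤ) (g : α → ℤ) (B : List α) :
    wt (optDeg e g) (B.map some) = wt g B := by simp [wt, optDeg, Function.comp_def]

@[simp] theorem optDeg_none (e : ℤ) (g : α → ℤ) : optDeg e g none = e := rfl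

theorem tag_optOp (e : ℤ) (g : α → ℤ) (φ θ : List α → W) (p : List (List α)) :
    (p.map (List.map some)).map (tag (optDeg e g) (optOp φ θ)) = p.map (tag g φ) := by
  simp [tag, Function.comp_def]

theorem eval_der_none (e : ℤ) (g : α → ℤ) (f : List (ℤ × W) → X) (φ θ : List α → W)
    (p : List (List α)) :
    eval (der e (wt (optDeg e g)) (consOp none) (p.map (List.map some)))
      (fun q => f (q.map (tag (optDeg e g) (optOp φ θ)))) = mark e g φ θ f p := by
  induction p generalizing f with
  | nil => simp [mark]
  | cons B p ih =>
    simp only [List.map_cons, eval_der_cons, eval_consOp, tag_optOp, mark]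
    rw [ih (fun L => f (tag (optDeg e g) (optOp φ θ) (B.map some) :: L))]
    simp [tag, add_comm]

theorem eval_parts_none (e : ℤ) (g : α → ℤ) (L : List α) (F : List (List (Option α)) → X) :
    eval (parts (optDeg e g) (none :: L.map some)) F =
      eval (parts g L) (fun p => F ([none] :: p.map (List.map some)) +
        eval (der e (wt (optDeg e g)) (consOp none) (p.map (List.map some))) F) := by
  rw [eval_parts_cons, eval_parts_map (g := g) some (fun _ => rfl)]
  refine eval_parts_congr fun p _ => ?_
  simp

/-- The extra letter joins exactly one block of a partition of `L`, where it turns `φ` into `θ`, and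
the sign of moving it there is the sign of `mark`. The case in which it forms its own block drops
out by `hθ`. -/
theorem comp_none (e : ℤ) (g : α → ℤ) {f : List (ℤ × W) → X} (hf : MultiAdd f)
    (φ : List α → W) {θ : List α → W} (hθ : θ [] = 0) (L : List α) :
    comp (optDeg e g) f (optOp φ θ) (none :: L.map some) = markSum e g f φ θ L := by
  rw [comp, eval_parts_none]
  refine eval_parts_congr fun p _ => ?_
  have h : tag (optDeg e g) (optOp φ θ) [none] = (wt (optDeg e g) [none], 0) := by
    simpa [tag, optOp] using hθ
  rw [eval_der_none, List.map_cons, h, hf.zero_head, zero_add]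

theorem comp_map_some (e : ℤ) (g : α → ℤ) (f : List (ℤ × W) → X)
    (φ θ : List α → W) (L : List α) :
    comp (optDeg e g) f (optOp φ θ) (L.map some) = comp g f φ L := by
  rw [comp, eval_parts_map (g := g) some (fun _ => rfl)]
  simp only [tag_optOp]
  rfl

/-- With several blocks, `θ` vanishes on those without the extra letter, so the marked block must be
the one containing it; with one block there is no choice. The degrees `e` and `-e` then pass the
same earlier blocks and their signs cancel, leaving a marking of degree `0`. -/
theorem eval_der_none_mark (e : ℤ) (g : α → ℤ) {f : List (ℤ × W) → X} (hf : MultiAdd f)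
    (φ η : List α → W) (θ : List (Option α) → W) (p : List (List α))
    (hp : p.length ≠ 1 → ∀ B ∈ p, θ (B.map some) = 0) :
    eval (der e (wt (optDeg e g)) (consOp none) (p.map (List.map some)))
      (mark (-e) (optDeg e g) (optOp φ η) θ f) =
      mark 0 g φ (fun B => θ (none :: B.map some)) f p := by
  by_cases h1 : p.length = 1
  · obtain ⟨B, rfl⟩ := List.length_eq_one_iff.1 h1
    simp [mark]
  replace hp := hp h1
  clear h1
  induction p generalizing f with
  | nil => simp [mark]
  | cons B p ih =>
    have hp' : ∀ B ∈ p, θ (B.map some) = 0 := fun B hB => hp B (by simp [hB])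
    simp only [List.map_cons, eval_der_cons, eval_consOp, mark, tag_optOp, hp B (by simp),
      hf.zero_head, zero_add]
    rw [mark_eq_zero (hf.cons _) (by simpa using hp'), eval_smul, smul_smul, ← sg_add]
    rw [ih (hf.cons _) hp']
    simp [tag]

/-- The generator of a flow: inserting `l` into a composition with one operation `η` of degree `e`
gives the composition with one operation `markSum e g l φ η`, provided that `comp g l φ` vanishes
on shorter words. -/
theorem comp_ins_none (g : α → ℤ) {f : List (ℤ × W) → X} (hf : MultiAdd f)
    {l : List (ℤ × W) → W} (hl : MultiAdd l) {φ η : List α → W} (hη : η [] = 0) {L : List α}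
    (h0 : ∀ B, B ≠ [] → B.length < L.length → B ⊆ L → comp g l φ B = 0) :
    comp (optDeg (-1) g) (ins f l) (optOp φ η) (none :: L.map some) =
      markSum 0 g f φ (markSum (-1) g l φ η) L := by
  rw [comp_ins _ hf, markSum, eval_parts_none]
  refine eval_parts_congr fun p hp => ?_
  have h1 : comp (optDeg (-1) g) l (optOp φ η) [none] = 0 := by
    have := comp_none (-1) g hl φ hη []
    simpa [markSum, mark] using this
  have h2 : tag (optDeg (-1) g) (optOp φ η) [none] = (wt (optDeg (-1) g) [none], 0) := by
    simpa [tag, optOp] using hη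
  have h3 := eval_der_none_mark (-1) g hf φ η (comp (optDeg (-1) g) l (optOp φ η)) p (by
    intro h B hB
    rw [comp_map_some]
    exact h0 B (hp.2 B hB) (hp.length_lt h hB) (hp.subset hB))
  -- The inserted operation has degree `1`, opposite to the degree `-1` of the extra letter, as the
  -- cancellation of signs requires.
  rw [neg_neg] at h3
  rw [h3, mark, h1, hf.zero_head, h2, mark_of_eq_zero fun L => hf.zero_head _ _]
  simp only [smul_zero, zero_add, comp_none (-1) g hl φ hη]

end WordPartition

/-! ### Operations as functions on words -/

section Words

variable {k : Type u} [Field k] {V : PointedGraded.{u, v} k} {W : PointedGraded.{u, w} k}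

/-- The word of the entries of a tuple with their degrees. -/
def word {V : Type*} {n : ℕ} (d : Fin n → ℤ) (x : Fin n → V) : List (ℤ × V) :=
  List.ofFn fun i => (d i, x i)

theorem exists_word {V : Type*} (L : List (ℤ × V)) :
    ∃ (d : Fin L.length → ℤ) (x : Fin L.length → V), L = word d x :=
  ⟨fun i => (L.get i).1, fun i => (L.get i).2, (List.ofFn_get L).symm⟩

@[simp] theorem length_word {V : Type*} {n : ℕ} (d : Fin n → ℤ) (x : Fin n → V) :
    (word d x).length = n := List.length_ofFn

theorem word_ne_nil {V : Type*} {n : ℕ} (hn : 1 ≤ n) (d : Fin n → ℤ) (x : Fin n → V) :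
    word d x ≠ [] := by
  intro h
  have := congrArg List.length h
  simp only [length_word, List.length_nil] at this
  omega

/-- A family of operations as a function on words. -/
def opWord (l : GradedOps V W) (L : List (ℤ × V)) : W :=
  l L.length (fun i => (L.get i).1) (fun i => (L.get i).2)

theorem opWord_word (l : GradedOps V W) {n : ℕ} (d : Fin n → ℤ) (x : Fin n → V) :
    opWord l (word d x) = l n d x := by
  have H : ∀ (m : ℕ) (h : m = n) (d' : Fin m → ℤ) (x' : Fin m → V),
      (∀ i, d' i = d (Fin.cast h i)) → (∀ i, x' i = x (Fin.cast h i)) → l m d' x' = l n d x := by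
    rintro m rfl d' x' hd hx
    congr 1
    · exact funext hd
    · exact funext hx
  refine H _ (length_word d x) _ _ 
    (fun i => congrArg Prod.fst (List.get_ofFn _ i)) fun i => congrArg Prod.snd (List.get_ofFn _ i)

/-- A symmetric family as a function on words. -/
def SymFamily.onWord {e : ℤ} (f : SymFamily V W e) : List (ℤ × V) → W :=
  opWord fun n _ x => f.map n x

theorem SymFamily.onWord_word {e : ℤ} (f : SymFamily V W e) {n : ℕ} (d : Fin n → ℤ)
    (x : Fin n → V) : f.onWord (word d x) = f.map n x := opWord_word _ d x

/-- For `η` this is what excludes the partitions in which the extra letter is a block by itself. -/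
theorem SymFamily.onWord_nil {e : ℤ} (f : SymFamily V W e) : f.onWord [] = 0 := by
  have h : f.map 0 = 0 := f.map_zero_arity
  simp [onWord, opWord, h]

/-- For fixed degrees, the operations are multilinear. -/
def IsMultilinear (l : GradedOps V W) : Prop :=
  ∀ (n : ℕ) (d : Fin n → ℤ), ∃ m : MultilinearMap k (fun _ : Fin n => V.carrier) W.carrier,
    ∀ x, m x = l n d x

theorem IsMultilinear.multiAdd {l : GradedOps V W} (hl : IsMultilinear l) :
    MultiAdd (opWord l) := by
  intro L₁ c L₂ u v
  obtain ⟨m, hm⟩ := hl (L₁ ++ (c, (0 : V)) :: L₂).length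
    (fun i => ((L₁ ++ (c, (0 : V)) :: L₂).get i).1)
  have hlen : L₁.length < (L₁ ++ (c, (0 : V)) :: L₂).length := by simp
  have H : ∀ z : V, opWord l (L₁ ++ (c, z) :: L₂) = m (Function.update
      (fun i => ((L₁ ++ (c, (0 : V)) :: L₂).get i).2) ⟨L₁.length, hlen⟩ z) := by
    intro z
    rw [hm, ← opWord_word l]
    congr 1
    apply List.ext_getElem
    · simp
    · intro i h₁ h₂
      simp only [word, List.getElem_ofFn, List.get_eq_getElem]
      rcases lt_trichotomy i L₁.length with h | h | h
      · rw [Function.update_of_ne (by simp [Fin.ext_iff]; omega)]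
        simp [List.getElem_append_left h]
      · subst h
        have hu : Function.update (fun i => ((L₁ ++ (c, (0 : V)) :: L₂).get i).2)
            ⟨L₁.length, hlen⟩ z ⟨L₁.length, hlen⟩ = z := Function.update_self _ _ _
        exact Prod.ext (by simp) (Eq.trans (show _ = z by simp) hu.symm)
      · rw [Function.update_of_ne (by simp [Fin.ext_iff]; omega)]
        obtain ⟨j, rfl⟩ : ∃ j, i = L₁.length + (j + 1) := ⟨i - L₁.length - 1, by omega⟩
        simp [List.getElem_append_right]
  rw [H, H, H, m.map_update_add]

theorem SymFamily.multiAdd {e : ℤ} (f : SymFamily V W e) : MultiAdd f.onWord :=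
  IsMultilinear.multiAdd fun n _ => ⟨f.map n, fun _ => rfl⟩

end Words

namespace OrderedFinpartition

variable {n : ℕ} (π : OrderedFinpartition n)

theorem blocks_word {V : Type*} (d : Fin n → ℤ) (x : Fin n → V) :
    π.blocks (fun i => (d i, x i)) = List.ofFn fun i => word (π.block d i) (π.block x i) := rfl

theorem wt_word_block {V : Type*} (d : Fin n → ℤ) (x : Fin n → V) (i : Fin π.length) :
    wt Prod.fst (word (π.block d i) (π.block x i)) = π.blockDeg d i :=
  π.wt_block Prod.fst (fun i => (d i, x i)) i

theorem map_tag_blocks {V W : Type*} (d : Fin n → ℤ) (x : Fin n → V) (φ : List (ℤ × V) → W) :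
    (π.blocks fun i => (d i, x i)).map (tag Prod.fst φ) =
      word (π.blockDeg d) fun i => φ (word (π.block d i) (π.block x i)) := by
  rw [blocks_word, List.map_ofFn, word]
  congr 1
  funext i
  simp [tag, wt_word_block]

/-- The numbers `|B| - 1` are nonnegative with sum `n - |π|`, so `B_i` accounts for the whole sum
exactly if the other terms vanish. -/
theorem othersSingleton_iff (i : Fin π.length) :
    π.OthersSingleton i ↔ ∀ j, j ≠ i → π.partSize j = 1 := by
  have hs : ∑ m : Fin π.length, π.partSize m = n := by
    simpa using π.sum_sigma_eq_sum (fun _ => (1 : ℕ))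
  have h1 : ∑ m : Fin π.length, π.partSize m =
      ∑ m : Fin π.length, (π.partSize m - 1) + π.length := by
    have : ∀ m : Fin π.length, π.partSize m = (π.partSize m - 1) + 1 := fun m => by
      have := π.partSize_pos m; omega
    rw [Finset.sum_congr rfl fun m _ => this m, Finset.sum_add_distrib]
    simp
  rw [← Finset.add_sum_erase _ _ (Finset.mem_univ i)] at h1
  have hi := π.partSize_pos i
  have h2 : π.OthersSingleton i ↔
      ∑ m ∈ Finset.univ.erase i, (π.partSize m - 1) = 0 := by
    unfold OthersSingleton
    have h3 := Finset.add_sum_erase Finset.univ (fun m => π.partSize m - 1) (Finset.mem_univ i)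
    have h4 := Finset.add_sum_erase Finset.univ π.partSize (Finset.mem_univ i)
    omega
  rw [h2, Finset.sum_eq_zero_iff]
  constructor
  · intro h j hj
    have := h j (by simp [hj])
    have := π.partSize_pos j
    omega
  · intro h j hj
    simp [h j (by simpa using hj)]

end OrderedFinpartition

theorem WordPartition.mark_ofFn {α X W : Type*} [AddCommGroup X] (e : ℤ) (g : α → ℤ)
    (φ θ : List α → W) (f : List (ℤ × W) → X) {m : ℕ} (b : Fin m → List α) :
    mark e g φ θ f (List.ofFn b) =
      ∑ i, sg (e * ∑ j with j < i, wt g (b j)) • f (word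
        (Function.update (fun j => wt g (b j)) i (wt g (b i) + e))
        (Function.update (fun j => φ (b j)) i (θ (b i)))) := by
  induction m generalizing f with
  | zero => simp [mark]
  | succ m ih =>
    rw [List.ofFn_succ, mark, ih, Fin.sum_univ_succ, Finset.smul_sum]
    congr 1
    · simp [word, List.ofFn_succ, List.map_ofFn, Function.comp_def, tag,
        Finset.filter_false_of_mem]
    · refine Finset.sum_congr rfl fun i _ => ?_
      rw [smul_smul, ← sg_add, WordPartition.sum_filter_lt_succ, mul_add]
      congr 2
      simp only [word]
      rw [List.ofFn_succ (n := m)]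
      simp only [Function.update_of_ne (Fin.succ_ne_zero i).symm]
      refine congrArg₂ List.cons rfl (congrArg List.ofFn ?_)
      funext j
      by_cases hj : j = i
      · subst hj; simp
      · have hj' : j.succ ≠ i.succ := by simpa using hj
        simp only [Function.update_of_ne hj, Function.update_of_ne hj']

/-! ### The operations on tuples expressed through words. -/

section Translate

variable {k : Type u} [Field k] {V : PointedGraded.{u, v} k} {W : PointedGraded.{u, w} k}

theorem compOps_eq_comp {X : PointedGraded k} (l : GradedOps W X) (φ : SymFamily V W 0) (n : ℕ)
    (d : Fin n → ℤ) (x : Fin n → V) :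
    compOps l φ n d x = comp Prod.fst (opWord l) φ.onWord (word d x) := by
  rw [comp, word, ← OrderedFinpartition.sum_sign_smul_blocks]
  refine Finset.sum_congr rfl fun π _ => ?_
  rw [OrderedFinpartition.map_tag_blocks, opWord_word]
  congr 2
  funext i
  rw [SymFamily.onWord_word]
  rfl

/-- On the right every block may be marked, whatever the sizes of the other blocks; `single` removes
the terms with an unmarked block that is not a singleton. -/
theorem sum_othersSingleton {e : ℤ} (f : SymFamily V W e) (l : GradedOps V V) {n : ℕ}
    (π : OrderedFinpartition n) (d : Fin n → ℤ) (x : Fin n → V) :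
    ∑ i with π.OthersSingleton i, π.signAt d i • f.map π.length
      (Function.update (π.first x) i (l (π.partSize i) (π.block d i) (π.block x i))) =
    π.sign d • mark 1 Prod.fst single (opWord l) f.onWord (π.blocks fun i => (d i, x i)) := by
  rw [OrderedFinpartition.blocks_word, WordPartition.mark_ofFn, Finset.sum_filter,
    Finset.smul_sum]
  refine Finset.sum_congr rfl fun i _ => ?_
  rw [SymFamily.onWord_word, opWord_word, smul_smul, one_mul]
  simp only [π.wt_word_block]
  by_cases hi : π.OthersSingleton i
  · rw [if_pos hi, OrderedFinpartition.signAt, negOnePow_eq_sg]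
    congr 2
    funext j
    by_cases hj : j = i
    · subst hj; simp
    · rw [Function.update_of_ne hj, Function.update_of_ne hj, word,
        List.ofFn_congr ((π.othersSingleton_iff i).1 hi j hj)]
      rfl
  · rw [if_neg hi]
    rw [π.othersSingleton_iff] at hi
    push Not at hi
    obtain ⟨j, hj, hj'⟩ := hi
    rw [(f.map π.length).map_coord_zero j, smul_zero]
    rw [Function.update_of_ne hj]
    have hlen := length_word (π.block d j) (π.block x j)
    match h : word (π.block d j) (π.block x j) with
    | [] => rfl
    | [a] => rw [h] at hlen; exact absurd hlen.symm hj'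
    | a :: b :: p => rfl

theorem insertOps_eq_ins {e : ℤ} (f : SymFamily V W e) (l : GradedOps V V) (n : ℕ)
    (d : Fin n → ℤ) (x : Fin n → V) :
    insertOps f l n d x = ins f.onWord (opWord l) (word d x) := by
  rw [ins, markSum, word, ← OrderedFinpartition.sum_sign_smul_blocks]
  exact Finset.sum_congr rfl fun π _ => sum_othersSingleton f l π d x

theorem insertOps_zero {e : ℤ} (f : SymFamily V W e) (n : ℕ) (d : Fin n → ℤ) (x : Fin n → V) :
    insertOps f (fun _ _ _ => 0) n d x = 0 := by
  refine Finset.sum_eq_zero fun π _ => Finset.sum_eq_zero fun i _ => ?_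
  rw [(f.map π.length).map_coord_zero i (by simp), smul_zero]

theorem flowOps_eq_markSum (l : GradedOps W W) (Φ : SymFamily V W 0) (η : SymFamily V W (-1))
    (n : ℕ) (d : Fin n → ℤ) (x : Fin n → V) :
    flowOps (fun _ _ _ => 0) l Φ η n d x =
      markSum (-1) Prod.fst (opWord l) Φ.onWord η.onWord (word d x) := by
  rw [flowOps, insertOps_zero, add_zero, markSum, word,
    ← OrderedFinpartition.sum_sign_smul_blocks]
  refine Finset.sum_congr rfl fun π _ => ?_
  rw [OrderedFinpartition.blocks_word, WordPartition.mark_ofFn, Finset.smul_sum]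
  refine Finset.sum_congr rfl fun i _ => ?_
  simp only [π.wt_word_block, opWord_word, SymFamily.onWord_word]
  rw [OrderedFinpartition.signAt, negOnePow_eq_sg, smul_smul]
  congr 2
  rw [neg_one_mul]
  exact (Int.negOnePow_neg _).symm

/-- Splitting off the one-block partition of a nonempty word. -/
theorem sum_ne_one_add {X : Type*} [AddCommGroup X] {n : ℕ} (hn : 1 ≤ n) (d : Fin n → ℤ)
    (x : Fin n → V) (F : List (List (ℤ × V)) → X) :
    (∑ π : {π : OrderedFinpartition n // π.length ≠ 1},
        π.1.sign d • F (π.1.blocks fun i => (d i, x i))) + F [word d x] =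
      eval (parts Prod.fst (word d x)) F := by
  classical
  have h1 := eval_parts_eq_single (g := Prod.fst) (word_ne_nil hn d x)
    (F := fun p => if p.length = 1 then F p else 0) fun p _ hp => if_neg hp
  rw [← Finset.sum_subtype (Finset.univ.filter fun π : OrderedFinpartition n => π.length ≠ 1)
    (by simp) (fun π => π.sign d • F (π.blocks fun i => (d i, x i))), Finset.sum_filter]
  refine (congrArg _ (h1.trans (if_pos rfl)).symm).trans ?_
  rw [word, ← OrderedFinpartition.sum_sign_smul_blocks,
    ← OrderedFinpartition.sum_sign_smul_blocks, ← Finset.sum_add_distrib]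
  refine Finset.sum_congr rfl fun π _ => ?_
  have hl : (π.blocks fun i => (d i, x i)).length = π.length := by
    simp [OrderedFinpartition.blocks]
  rw [hl]
  by_cases h : π.length = 1 <;> simp [h]

end Translate

/-! ### The recursions for the descendants as identities on words. -/

namespace HomotopyProbabilityAlgebra

variable {k : Type u} [Field k] {V : PointedGraded.{u, v} k} {W : PointedGraded.{u, w} k}

theorem M_onWord_single (A : HomotopyProbabilityAlgebra V) (c : ℤ) (y : V) :
    A.M.onWord [(c, y)] = y :=
  (A.M.onWord_word (fun _ : Fin 1 => c) fun _ => y).trans (A.M_one_arity y)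

/-- The defining relation of the descendant operations. -/
theorem K_M_onWord (A : HomotopyProbabilityAlgebra V) {L : List (ℤ × V)} (hL : L ≠ []) :
    A.K (A.M.onWord L) = ins A.M.onWord (opWord A.descendantOps) L := by
  obtain ⟨d, x, h⟩ := exists_word L
  have hn : 1 ≤ L.length := List.length_pos_iff.2 hL
  generalize L.length = n at *
  subst h
  rw [ins, markSum, ← sum_ne_one_add hn, SymFamily.onWord_word]
  simp only [mark, List.map_nil, smul_zero, add_zero, M_onWord_single, opWord_word]
  rw [descendantOps]
  simp only [sum_othersSingleton]
  abel

/-- The defining relation of the descendant of a morphism. -/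
theorem map_M_onWord {A : HomotopyProbabilityAlgebra V} {B : HomotopyProbabilityAlgebra W}
    (f : A.Hom B) (Λ : DescentHomotopy V W) {L : List (ℤ × V)} (hL : L ≠ []) :
    f.toLin (A.M.onWord L) = comp Prod.fst B.M.onWord (opWord (descendantMor f Λ)) L +
      B.K (Λ.family.onWord L) + ins Λ.family.onWord (opWord A.descendantOps) L := by
  obtain ⟨d, x, h⟩ := exists_word L
  have hn : 1 ≤ L.length := List.length_pos_iff.2 hL
  generalize L.length = n at *
  subst h
  rw [← insertOps_eq_ins, comp, ← sum_ne_one_add hn]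
  simp only [OrderedFinpartition.map_tag_blocks, SymFamily.onWord_word, opWord_word, tag,
    List.map_cons, List.map_nil, M_onWord_single]
  conv_rhs => rw [descendantMor]
  abel

end HomotopyProbabilityAlgebra

/-! ### Multilinearity -/

section Multilinear

variable {k : Type u} [Field k] {V : Type v} {W : Type w} [AddCommGroup V] [Module k V]
  [AddCommGroup W] [Module k W]

variable (k) in
/-- A function of several vectors is multilinear. -/
def IsML {n : ℕ} (g : (Fin n → V) → W) : Prop :=
  ∃ m : MultilinearMap k (fun _ : Fin n => V) W, ∀ x, m x = g x

variable {n : ℕ}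

theorem IsML.sum {ι : Type*} (s : Finset ι) {g : ι → (Fin n → V) → W}
    (h : ∀ i ∈ s, IsML k (g i)) : IsML k fun x => ∑ i ∈ s, g i x := by
  classical
  choose! m hm using h
  exact ⟨∑ i ∈ s, m i, fun x => by
    rw [sum_apply]; exact Finset.sum_congr rfl fun i hi => hm i hi x⟩

theorem IsML.units_smul {g : (Fin n → V) → W} (s : ℤˣ) (h : IsML k g) :
    IsML k fun x => s • g x := by
  obtain ⟨m, hm⟩ := h
  refine ⟨(s : ℤ) • m, fun x => ?_⟩
  change (s : ℤ) • m x = s • g x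
  rw [hm]
  rfl

theorem IsML.sub {g g' : (Fin n → V) → W} (h : IsML k g) (h' : IsML k g') :
    IsML k fun x => g x - g' x := by
  obtain ⟨m, hm⟩ := h
  obtain ⟨m', hm'⟩ := h'
  exact ⟨m - m', fun x => by simp [hm, hm']⟩

theorem IsML.linear {X : Type*} [AddCommGroup X] [Module k X] {g : (Fin n → V) → W}
    (f : W →ₗ[k] X) (h : IsML k g) : IsML k fun x => f (g x) := by
  obtain ⟨m, hm⟩ := h
  exact ⟨f.compMultilinearMap m, fun x => by simp [hm]⟩

/-- Each entry lies in exactly one block, so changing it changes one argument of `f`, and that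
argument depends linearly on the entry. -/
theorem IsML.comp_block {X : Type*} [AddCommGroup X] [Module k X] (π : OrderedFinpartition n)
    (f : MultilinearMap k (fun _ : Fin π.length => W) X)
    {G : ∀ i : Fin π.length, (Fin (π.partSize i) → V) → W} (hG : ∀ i, IsML k (G i)) :
    IsML k fun x : Fin n → V => f fun i => G i (π.block x i) := by
  classical
  choose m hm using hG
  have hb : ∀ (x : Fin n → V) (a : Fin n) (v : V),
      (fun i => G i (π.block (Function.update x a v) i)) =
      Function.update (fun i => G i (π.block x i)) (π.index a)
        (m (π.index a) (Function.update (π.block x (π.index a)) (π.invEmbedding a) v)) := by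
    intro x a v
    funext i
    by_cases hi : i = π.index a
    · subst hi
      rw [Function.update_self, hm]
      congr 1
      funext r
      simp only [OrderedFinpartition.block]
      by_cases hr : r = π.invEmbedding a
      · subst hr
        rw [Function.update_self, π.emb_invEmbedding, Function.update_self]
      · rw [Function.update_of_ne hr, Function.update_of_ne]
        · rfl
        · intro h
          conv_rhs at h => rw [← π.emb_invEmbedding a]
          exact hr ((π.emb_strictMono _).injective h)
    · rw [Function.update_of_ne hi]
      congr 1
      funext r
      simp only [OrderedFinpartition.block]
      rw [Function.update_of_ne]
      rintro rfl
      exact hi (π.index_emb i r).symm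
  refine ⟨MultilinearMap.mk' (fun x => f fun i => G i (π.block x i)) (fun x a v v' => ?_)
    (fun x a c v => ?_), fun _ => rfl⟩
  · simp only [hb, MultilinearMap.map_update_add]
  · simp only [hb, MultilinearMap.map_update_smul]

/-- The hypothesis on `i` is essential: the first entry of a block is a multilinear function of that
block only if the block is a singleton. -/
theorem IsML.insert_block {X : Type*} [AddCommGroup X] [Module k X] (π : OrderedFinpartition n)
    (f : MultilinearMap k (fun _ : Fin π.length => V) X) (i : Fin π.length)
    (hi : π.OthersSingleton i) {G : (Fin (π.partSize i) → V) → V} (hG : IsML k G) :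
    IsML k fun x : Fin n → V => f (Function.update (π.first x) i (G (π.block x i))) := by
  classical
  have h := IsML.comp_block π f
    (G := fun j y => if h : j = i then G (fun r => y (Fin.cast (by rw [h]) r)) else
      y ⟨0, π.partSize_pos j⟩) (fun j => ?_)
  · convert h using 4 with x j
    by_cases hj : j = i
    · subst hj; simp
    · rw [Function.update_of_ne hj, dif_neg hj]; rfl
  · by_cases hj : j = i
    · subst hj; simpa using hG
    · have h1 : π.partSize j = 1 := (π.othersSingleton_iff i).1 hi j hj
      have : Subsingleton (Fin (π.partSize j)) := by rw [h1]; infer_instance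
      refine ⟨MultilinearMap.ofSubsingleton k V V ⟨0, π.partSize_pos j⟩ LinearMap.id, fun y => ?_⟩
      simp [hj]

end Multilinear

section MultilinearOps

variable {k : Type u} [Field k] {V : PointedGraded.{u, v} k} {W : PointedGraded.{u, w} k}

theorem compOps_isML {X : PointedGraded k} {l : GradedOps W X} (hl : IsMultilinear l)
    (φ : SymFamily V W 0) : IsMultilinear (compOps l φ) := by
  intro n d
  refine IsML.sum _ fun π _ => IsML.units_smul _ ?_
  obtain ⟨m, hm⟩ := hl π.length (π.blockDeg d)
  simp only [← hm]
  exact IsML.comp_block π m fun i => ⟨φ.map _, fun _ => rfl⟩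

theorem HomotopyProbabilityAlgebra.descendantOps_isML (A : HomotopyProbabilityAlgebra V) :
    IsMultilinear A.descendantOps := by
  intro n
  induction n using Nat.strong_induction_on with
  | _ n ih =>
    intro d
    have h : IsML k (A.descendantOps n d) := by
      have h' := IsML.sub (IsML.linear (k := k) A.K ⟨A.M.map n, fun _ => rfl⟩)
        (IsML.sum (k := k) (Finset.univ : Finset {π : OrderedFinpartition n // π.length ≠ 1})
        (fun π _ => IsML.sum (Finset.univ.filter π.1.OthersSingleton)
          fun i hi => IsML.units_smul (π.1.signAt d i)
            (IsML.insert_block π.1 (A.M.map π.1.length) i (by simpa using hi)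
              (ih _ (π.1.partSize_lt π.2 i) (π.1.block d i)))))
      obtain ⟨m, hm⟩ := h'
      refine ⟨m, fun x => ?_⟩
      rw [hm, descendantOps]
    exact h

theorem HomotopyProbabilityAlgebra.descendantMor_isML {A : HomotopyProbabilityAlgebra V}
    {B : HomotopyProbabilityAlgebra W} (f : A.Hom B) (Λ : DescentHomotopy V W) :
    IsMultilinear (descendantMor f Λ) := by
  intro n
  induction n using Nat.strong_induction_on with
  | _ n ih =>
    intro d
    have h : IsML k (descendantMor f Λ n d) := by
      have h' := IsML.sub (IsML.sub (IsML.sub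
        (IsML.linear (k := k) f.toLin ⟨A.M.map n, fun _ => rfl⟩)
        (IsML.sum (k := k) (Finset.univ : Finset {π : OrderedFinpartition n // π.length ≠ 1})
        (fun π _ => IsML.units_smul (π.1.sign d)
            (IsML.comp_block π.1 (B.M.map π.1.length)
              fun i => ih _ (π.1.partSize_lt π.2 i) (π.1.block d i)))))
        (IsML.linear (k := k) B.K ⟨Λ.family.map n, fun _ => rfl⟩))
        (IsML.sum (k := k) Finset.univ fun π _ => IsML.sum (Finset.univ.filter π.OthersSingleton)
          fun i hi => IsML.units_smul (π.signAt d i) (IsML.insert_block π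
            (Λ.family.map π.length) i (by simpa using hi)
            (A.descendantOps_isML (π.partSize i) (π.block d i))))
      obtain ⟨m, hm⟩ := h'
      refine ⟨m, fun x => ?_⟩
      rw [hm, descendantMor]
      rfl
    exact h

end MultilinearOps

/-! ### Multilinear maps and homogeneous elements -/

section Homogeneous

variable {k : Type u} [Field k] (V : PointedGraded.{u, v} k) {W : PointedGraded.{u, w} k}

/-- The decomposition of a graded vector space into homogeneous parts. -/
@[reducible] def PointedGraded.decomposition : DirectSum.Decomposition V.deg :=
  V.isInternal.chooseDecomposition

variable {V}

theorem multilinearMap_ext_homog {E : Type*} [AddCommGroup E] [Module k E] {n : ℕ}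
    {f g : MultilinearMap k (fun _ : Fin n => V.carrier) E}
    (h : ∀ (d : Fin n → ℤ) (x : Fin n → V), V.Homog d x → f x = g x) : f = g := by
  classical
  let _ := V.decomposition
  let D := DirectSum.decomposeLinearEquiv V.deg
  have H : f.compLinearMap (fun _ => D.symm.toLinearMap) =
      g.compLinearMap (fun _ => D.symm.toLinearMap) := by
    refine MultilinearMap.dfinsupp_ext fun p => ?_
    ext x
    exact h p _ fun i => by
      change (DirectSum.decompose V.deg).symm (DirectSum.of _ (p i) (x i)) ∈ _
      rw [DirectSum.decompose_symm_of]
      exact (x i).2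
  ext x
  have := DFunLike.congr_fun H fun i => D (x i)
  simpa using this

theorem SymFamily.ext_homog {e : ℤ} {f g : SymFamily V W e}
    (h : ∀ n, 1 ≤ n → ∀ (d : Fin n → ℤ) (x : Fin n → V), V.Homog d x → f.map n x = g.map n x) :
    f = g := by
  ext1
  funext n
  obtain rfl | hn := Nat.eq_zero_or_pos n
  · rw [f.map_zero_arity, g.map_zero_arity]
  · exact multilinearMap_ext_homog (h n hn)

/-- The operation may differ from one multidegree to another because of signs; the direct sum
decomposition glues the separate multilinear maps into one. -/
theorem exists_multilinearMap {n : ℕ} {l : (Fin n → ℤ) → (Fin n → V) → W}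
    (hl : ∀ d, IsML k (l d)) : ∃ m : MultilinearMap k (fun _ : Fin n => V.carrier) W.carrier,
      ∀ (d : Fin n → ℤ) (x : Fin n → V), V.Homog d x → m x = l d x := by
  classical
  let _ := V.decomposition
  choose m hm using hl
  let D := DirectSum.decomposeLinearEquiv V.deg
  refine ⟨(MultilinearMap.fromDFinsuppEquiv (fun _ : Fin n => ℤ) k
    (M := fun _ j => V.deg j) fun d => (m d).compLinearMap
      fun i => (V.deg (d i)).subtype).compLinearMap (fun _ => D.toLinearMap), fun d x hx => ?_⟩
  have hD : (fun i => D.toLinearMap (x i)) =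
      fun i => DFinsupp.single (β := fun j => V.deg j) (d i) ⟨x i, hx i⟩ := by
    funext i
    exact DirectSum.decompose_of_mem V.deg (hx i)
  rw [MultilinearMap.compLinearMap_apply, hD, MultilinearMap.fromDFinsuppEquiv_single, ← hm]
  rfl

theorem exists_symFamily {e : ℤ} {l : GradedOps V W} (hl : IsMultilinear l)
    (hmem : ∀ n, 1 ≤ n → ∀ (d : Fin n → ℤ) (x : Fin n → V), V.Homog d x →
      l n d x ∈ W.deg (∑ i, d i + e))
    (hsymm : ∀ n, 1 ≤ n → ∀ (d : Fin n → ℤ) (x : Fin n → V) (σ : Equiv.Perm (Fin n)),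
      V.Homog d x → l n d x = koszulPerm d σ • l n (d ∘ σ) (x ∘ σ)) :
    ∃ F : SymFamily V W e, ∀ n, 1 ≤ n → ∀ (d : Fin n → ℤ) (x : Fin n → V), V.Homog d x →
      F.map n x = l n d x := by
  choose m hm using fun n => exists_multilinearMap (hl n)
  -- Arity `0` is overwritten by zero to meet the normalisation of symmetric families.
  refine ⟨⟨fun n => if n = 0 then 0 else m n, if_pos rfl, fun n d x hx => ?_,
    fun n d x σ hx => ?_⟩, fun n hn d x hx => ?_⟩
  · by_cases hn : n = 0
    · rw [if_pos hn]; exact Submodule.zero_mem _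
    · rw [if_neg hn, hm n d x hx]; exact hmem n (by omega) d x hx
  · by_cases hn : n = 0
    · simp [if_pos hn]
    · rw [if_neg hn, hm n d x hx, hm n (d ∘ σ) (x ∘ σ) fun i => hx (σ i)]
      exact hsymm n (by omega) d x σ hx
  · change (if n = 0 then 0 else m n) x = _
    rw [if_neg (by omega), hm n d x hx]

end Homogeneous

/-! ### Polynomial functions -/

section Poly

variable {k : Type u} [Field k] {E F G : Type*} [AddCommGroup E] [Module k E] [AddCommGroup F]
  [Module k F] [AddCommGroup G] [Module k G]

/-- `g` is a polynomial function with derivative `g'`. -/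
def HasPolyDeriv (g g' : k → E) : Prop :=
  ∃ p : ℕ →₀ E, ∀ τ, g τ = polyEval p τ ∧ g' τ = polyDerivEval p τ

theorem polyEval_add (p q : ℕ →₀ E) (τ : k) :
    polyEval (p + q) τ = polyEval p τ + polyEval q τ :=
  Finsupp.sum_add_index' (by simp) (by simp)

theorem polyDerivEval_add (p q : ℕ →₀ E) (τ : k) :
    polyDerivEval (p + q) τ = polyDerivEval p τ + polyDerivEval q τ :=
  Finsupp.sum_add_index' (by simp) (by simp)

theorem polyEval_single (m : ℕ) (a : E) (τ : k) :
    polyEval (Finsupp.single m a) τ = τ ^ m • a := Finsupp.sum_single_index (by simp)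

theorem polyDerivEval_single (m : ℕ) (a : E) (τ : k) :
    polyDerivEval (Finsupp.single m a) τ = ((m : k) * τ ^ (m - 1)) • a :=
  Finsupp.sum_single_index (by simp)

theorem HasPolyDeriv.add {g g' h h' : k → E} (H : HasPolyDeriv g g') (H' : HasPolyDeriv h h') :
    HasPolyDeriv (fun τ => g τ + h τ) (fun τ => g' τ + h' τ) := by
  obtain ⟨p, hp⟩ := H
  obtain ⟨q, hq⟩ := H'
  exact ⟨p + q, fun τ => by
    simp only
    rw [polyEval_add, polyDerivEval_add, (hp τ).1, (hp τ).2, (hq τ).1, (hq τ).2]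
    exact ⟨rfl, rfl⟩⟩

theorem HasPolyDeriv.zero : HasPolyDeriv (fun _ : k => (0 : E)) (fun _ => 0) :=
  ⟨0, fun _ => ⟨rfl, rfl⟩⟩

theorem HasPolyDeriv.const (a : E) : HasPolyDeriv (fun _ : k => a) (fun _ => 0) :=
  ⟨Finsupp.single 0 a, fun τ => by rw [polyEval_single, polyDerivEval_single]; simp⟩

theorem HasPolyDeriv.monomial (m : ℕ) (a : E) :
    HasPolyDeriv (fun τ : k => τ ^ m • a) (fun τ => ((m : k) * τ ^ (m - 1)) • a) :=
  ⟨Finsupp.single m a, fun τ => by rw [polyEval_single, polyDerivEval_single]; exact ⟨rfl, rfl⟩⟩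

/-- An induction principle for polynomial functions. -/
theorem HasPolyDeriv.induction {P : (k → E) → (k → E) → Prop}
    (zero : P (fun _ => 0) (fun _ => 0))
    (add : ∀ g g' h h', P g g' → P h h' → P (fun τ => g τ + h τ) (fun τ => g' τ + h' τ))
    (monomial : ∀ (m : ℕ) (a : E), P (fun τ => τ ^ m • a) (fun τ => ((m : k) * τ ^ (m - 1)) • a))
    {g g' : k → E} (H : HasPolyDeriv g g') : P g g' := by
  obtain ⟨p, hp⟩ := H
  obtain rfl : g = polyEval p := funext fun τ => (hp τ).1
  obtain rfl : g' = polyDerivEval p := funext fun τ => (hp τ).2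
  clear hp
  induction p using Finsupp.induction_linear with
  | zero => exact zero
  | add p q hp hq =>
    have := add _ _ _ _ hp hq
    simp only [← polyEval_add, ← polyDerivEval_add] at this
    exact this
  | single m a =>
    have := monomial m a
    simp only [← polyEval_single, ← polyDerivEval_single] at this
    exact this

theorem HasPolyDeriv.linear (f : E →ₗ[k] F) {g g' : k → E} (H : HasPolyDeriv g g') :
    HasPolyDeriv (fun τ => f (g τ)) (fun τ => f (g' τ)) := by
  refine H.induction (P := fun g g' => HasPolyDeriv (fun τ => f (g τ)) (fun τ => f (g' τ)))
    ?_ ?_ ?_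
  · simpa using HasPolyDeriv.zero
  · intro g g' h h' H H'
    simpa using H.add H'
  · intro m a
    simpa using HasPolyDeriv.monomial m (f a)

theorem HasPolyDeriv.bilinear (f : E →ₗ[k] F →ₗ[k] G) {g g' : k → E} {h h' : k → F}
    (H : HasPolyDeriv g g') (H' : HasPolyDeriv h h') :
    HasPolyDeriv (fun τ => f (g τ) (h τ)) (fun τ => f (g' τ) (h τ) + f (g τ) (h' τ)) := by
  refine H.induction (P := fun g g' => HasPolyDeriv (fun τ => f (g τ) (h τ))
    (fun τ => f (g' τ) (h τ) + f (g τ) (h' τ))) ?_ ?_ ?_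
  · simpa using HasPolyDeriv.zero
  · intro g g' l l' H₁ H₂
    have := H₁.add H₂
    simp only [map_add, LinearMap.add_apply]
    convert this using 2
    abel
  · intro m a
    refine H'.induction (P := fun h h' => HasPolyDeriv (fun τ => f (τ ^ m • a) (h τ))
      (fun τ => f (((m : k) * τ ^ (m - 1)) • a) (h τ) + f (τ ^ m • a) (h' τ))) ?_ ?_ ?_
    · simpa using HasPolyDeriv.zero
    · intro g g' l l' H₁ H₂
      have := H₁.add H₂
      simp only [map_add]
      convert this using 2
      abel
    · intro n b
      have := HasPolyDeriv.monomial (k := k) (m + n) (f a b)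
      convert this using 2 with τ τ
      · simp [pow_add, mul_smul, smul_comm (τ ^ m)]
      · simp only [map_smul, LinearMap.smul_apply, smul_smul, ← add_smul]
        congr 1
        -- Exponents `m - 1` are truncated at `m = 0`, where only the vanishing coefficient makes
        -- the formula correct, hence the separate cases.
        rcases m with _ | m <;> rcases n with _ | n <;>
          simp [pow_add, show ∀ a b : ℕ, a + 1 + (b + 1) - 1 = a + b + 1 by intros; omega]
        ring

/-- The Leibniz rule. The multilinear map is allowed to vary with `τ` so that the induction can
absorb the first argument by currying. -/
theorem HasPolyDeriv.multilinear {n : ℕ}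
    {f f' : k → MultilinearMap k (fun _ : Fin n => E) F} (hf : HasPolyDeriv f f')
    {y y' : Fin n → k → E} (hy : ∀ i, HasPolyDeriv (y i) (y' i)) :
    HasPolyDeriv (fun τ => f τ fun i => y i τ) (fun τ => (f' τ fun i => y i τ) +
      ∑ i, f τ (Function.update (fun j => y j τ) i (y' i τ))) := by
  induction n with
  | zero =>
    simp only [Finset.univ_eq_empty, Finset.sum_empty, add_zero]
    let Φ : MultilinearMap k (fun _ : Fin 0 => E) F →ₗ[k] F :=
      { toFun := fun m => m 0, map_add' := fun _ _ => rfl, map_smul' := fun _ _ => rfl }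
    have h := hf.linear Φ
    convert h using 3 <;> exact congrArg _ (Subsingleton.elim _ _)
  | succ n ih =>
    let Φ : MultilinearMap k (fun _ : Fin (n + 1) => E) F →ₗ[k]
        E →ₗ[k] MultilinearMap k (fun _ : Fin n => E) F :=
      { toFun := fun m => m.curryLeft, map_add' := fun _ _ => rfl, map_smul' := fun _ _ => rfl }
    have h := ih (hf.bilinear Φ (hy 0)) fun i => hy i.succ
    have hc : ∀ (m : MultilinearMap k (fun _ : Fin (n + 1) => E) F) (a : E) (z : Fin n → E),
        Φ m a z = m (Fin.cons a z) := fun m a z => rfl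
    have hy0 : ∀ τ, (Fin.cons (y 0 τ) (fun i => y i.succ τ) : Fin (n + 1) → E) =
        fun i => y i τ := fun τ => by
      funext i; refine Fin.cases ?_ (fun _ => ?_) i <;> simp
    convert h using 2 with τ τ
    · rw [hc, hy0]
    · rw [Fin.sum_univ_succ, add_apply, hc, hc, hy0, add_assoc]
      congr 2
      · congr 1
        funext i; refine Fin.cases ?_ (fun _ => ?_) i <;> simp
      · refine Finset.sum_congr rfl fun i _ => ?_
        rw [hc, Fin.cons_update, hy0]

variable [CharZero k]

/-- Linear functionals separate points, which reduces the claim to scalar polynomials over an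
infinite field. -/
theorem eq_zero_of_polyEval_eq_zero {p : ℕ →₀ E} (h : ∀ τ : k, polyEval p τ = 0) : p = 0 := by
  ext m
  refine (Module.forall_dual_apply_eq_zero_iff k (p m)).1 fun f => ?_
  let q : Polynomial k := p.sum fun m a => Polynomial.monomial m (f a)
  have hq : q = 0 := by
    refine Polynomial.funext fun τ => ?_
    have := congrArg f (h τ)
    simp only [polyEval, Finsupp.sum, map_sum, map_smul, map_zero, smul_eq_mul] at this
    simp only [q, Finsupp.sum, Polynomial.eval_finsetSum, Polynomial.eval_monomial,
      Polynomial.eval_zero]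
    rw [← this]
    exact Finset.sum_congr rfl fun _ _ => mul_comm _ _
  have hm : q.coeff m = f (p m) := by
    simp only [q, Finsupp.sum, Polynomial.finsetSum_coeff, Polynomial.coeff_monomial]
    rw [Finset.sum_ite_eq' p.support m fun i => f (p i)]
    by_cases hm : p m = 0 <;> simp [hm]
  rw [← hm, hq, Polynomial.coeff_zero]

theorem HasPolyDeriv.eq_of_deriv_eq_zero {g : k → E} (H : HasPolyDeriv g fun _ => 0) (τ : k) :
    g τ = g 0 := by
  obtain ⟨p, hp⟩ := H
  -- The coefficients of the derivative. Truncation puts the summand `m = 0` in degree `0`, with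
  -- coefficient zero.
  let q : ℕ →₀ E := p.sum fun m a => Finsupp.single (m - 1) ((m : k) • a)
  have hq : q = 0 := by
    refine eq_zero_of_polyEval_eq_zero (k := k) fun τ => ?_
    refine Eq.trans ?_ (show polyDerivEval p τ = 0 from (hp τ).2.symm)
    have hs : ∀ (s : Finset ℕ) (r : ℕ → ℕ →₀ E),
        polyEval (∑ m ∈ s, r m) τ = ∑ m ∈ s, polyEval (r m) τ := fun s r =>
      map_sum (AddMonoidHom.mk' (fun p : ℕ →₀ E => polyEval p τ) fun p q =>
        polyEval_add p q τ) r s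
    simp only [q, Finsupp.sum, hs, polyEval_single, polyDerivEval, smul_smul]
    exact Finset.sum_congr rfl fun m _ => by rw [mul_comm]
  have hpm : ∀ m, p (m + 1) = 0 := by
    intro m
    have h := DFunLike.congr_fun hq m
    simp only [q, Finsupp.sum, Finsupp.finsetSum_apply, Finsupp.coe_zero, Pi.zero_apply] at h
    by_contra hne
    rw [Finset.sum_eq_single (m + 1)] at h
    · simp only [Nat.add_sub_cancel, Finsupp.single_eq_same, smul_eq_zero, hne, or_false] at h
      exact Nat.cast_ne_zero.2 (Nat.succ_ne_zero m) h
    · intro b _ hb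
      rcases b with _ | b
      · simp
      · rw [Finsupp.single_eq_of_ne]
        omega
    · intro h'
      simp [Finsupp.notMem_support_iff.1 h']
  have hps : p = Finsupp.single 0 (p 0) := by
    ext m
    rcases m with _ | m
    · simp
    · rw [hpm m, Finsupp.single_eq_of_ne (by omega)]
  rw [(hp τ).1, (hp 0).1, hps, polyEval_single, polyEval_single]
  simp

/-- Every polynomial function has an antiderivative. -/
theorem HasPolyDeriv.exists_antideriv {g g' : k → E} (H : HasPolyDeriv g g') :
    ∃ h : k → E, HasPolyDeriv h g := by
  refine H.induction (P := fun g _ => ∃ h : k → E, HasPolyDeriv h g) ⟨_, HasPolyDeriv.zero⟩ ?_ ?_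
  · rintro g g' h h' ⟨a, ha⟩ ⟨b, hb⟩
    exact ⟨_, ha.add hb⟩
  · intro m a
    have h := HasPolyDeriv.monomial (k := k) (m + 1) (((m + 1 : ℕ) : k)⁻¹ • a)
    refine ⟨fun τ => τ ^ (m + 1) • ((m + 1 : ℕ) : k)⁻¹ • a, ?_⟩
    convert h using 2 with τ
    have : ((m + 1 : ℕ) : k) ≠ 0 := Nat.cast_ne_zero.2 (Nat.succ_ne_zero m)
    rw [smul_smul, mul_comm, ← mul_assoc, inv_mul_cancel₀ this, one_mul, Nat.add_sub_cancel]

/-- If the derivative of `g` is `K ∘ h`, with `h` polynomial, the values of `g` differ by elements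
of the image of `K`. -/
theorem HasPolyDeriv.exists_sub_eq (K : F →ₗ[k] E) {g : k → E} {h h' : k → F}
    (H : HasPolyDeriv g fun τ => K (h τ)) (H' : HasPolyDeriv h h') (τ : k) :
    ∃ z, g τ - g 0 = K z := by
  obtain ⟨a, ha⟩ := H'.exists_antideriv
  have h0 := HasPolyDeriv.add H (HasPolyDeriv.linear (k := k) (-K) ha)
  simp only [LinearMap.neg_apply, add_neg_cancel] at h0
  have := h0.eq_of_deriv_eq_zero τ
  refine ⟨a τ - a 0, ?_⟩
  rw [map_sub, sub_eq_sub_iff_add_eq_add]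
  rw [← sub_eq_add_neg, ← sub_eq_add_neg, sub_eq_sub_iff_add_eq_add] at this
  rw [this, add_comm]

end Poly

/-! ### Homotopy invariance of the correlation densities -/

section PolyComp

variable {k : Type u} [Field k] {α : Type*} {V : PointedGraded.{u, v} k}
  {W : PointedGraded.{u, w} k}

theorem HasPolyDeriv.units_smul {E : Type*} [AddCommGroup E] [Module k E] {g g' : k → E}
    (s : ℤˣ) (H : HasPolyDeriv g g') : HasPolyDeriv (fun τ => s • g τ) (fun τ => s • g' τ) := by
  have h := H.linear (((s : ℤ) : k) • (LinearMap.id : E →ₗ[k] E))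
  simpa [Units.smul_def, Int.cast_smul_eq_zsmul] using h

theorem HasPolyDeriv.eval {β E : Type*} [AddCommGroup E] [Module k E] (U : SignedSum β)
    {F F' : k → β → E} (h : ∀ c ∈ U, HasPolyDeriv (fun τ => F τ c.2) (fun τ => F' τ c.2)) :
    HasPolyDeriv (fun τ => U.eval (F τ)) (fun τ => U.eval (F' τ)) := by
  induction U with
  | nil => exact HasPolyDeriv.zero
  | cons c U ih =>
    simp only [eval_cons]
    exact ((h c (by simp)).units_smul c.1).add (ih fun c hc => h c (by simp [hc]))

/-- Differentiation in `τ` carries no degree, so the Leibniz rule is a marking of degree `0`,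
without signs. -/
theorem HasPolyDeriv.onWord {e : ℤ} (f : SymFamily V W e) (g : α → ℤ) {φ φ' : k → List α → V}
    {p : List (List α)} (h : ∀ B ∈ p, HasPolyDeriv (fun τ => φ τ B) (fun τ => φ' τ B)) :
    HasPolyDeriv (fun τ => f.onWord (p.map (tag g (φ τ))))
      (fun τ => mark 0 g (φ τ) (φ' τ) f.onWord p) := by
  obtain ⟨n, b, rfl⟩ : ∃ (n : ℕ) (b : Fin n → List α), p = List.ofFn b :=
    ⟨p.length, p.get, (List.ofFn_get p).symm⟩
  have H := HasPolyDeriv.multilinear (HasPolyDeriv.const (k := k) (f.map n))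
    (y := fun i τ => φ τ (b i)) (y' := fun i τ => φ' τ (b i)) fun i => h _ (by simp)
  convert H using 2 with τ τ
  · rw [List.map_ofFn]
    exact f.onWord_word (fun i => wt g (b i)) _
  · rw [WordPartition.mark_ofFn]
    simp [SymFamily.onWord_word]

theorem HasPolyDeriv.comp {e : ℤ} (f : SymFamily V W e) (g : α → ℤ) {φ φ' : k → List α → V}
    {L : List α}
    (h : ∀ B, B ≠ [] → B ⊆ L → HasPolyDeriv (fun τ => φ τ B) (fun τ => φ' τ B)) :
    HasPolyDeriv (fun τ => comp g f.onWord (φ τ) L)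
      (fun τ => markSum 0 g f.onWord (φ τ) (φ' τ) L) := by
  refine HasPolyDeriv.eval _ fun c hc => HasPolyDeriv.onWord f g fun B hB => ?_
  have hd := isDecomp_of_mem_parts hc
  exact h B (hd.2 B hB) (hd.subset hB)

end PolyComp

/-- A word of homogeneous elements with their degrees. -/
def HomogWord {k : Type u} [Field k] (V : PointedGraded.{u, v} k) (L : List (ℤ × V)) : Prop :=
  ∀ c ∈ L, c.2 ∈ V.deg c.1

section Words

variable {k : Type u} [Field k] {V : PointedGraded.{u, v} k}

theorem homogWord_word {n : ℕ} {d : Fin n → ℤ} {x : Fin n → V} :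
    HomogWord V (word d x) ↔ V.Homog d x := by
  simp [HomogWord, word, List.mem_ofFn, PointedGraded.Homog]

theorem HomogWord.exists_word {L : List (ℤ × V)} (hL : HomogWord V L) :
    ∃ (d : Fin L.length → ℤ) (x : Fin L.length → V), V.Homog d x ∧ L = word d x := by
  obtain ⟨d, x, h⟩ := _root_.exists_word L
  exact ⟨d, x, homogWord_word.1 (h ▸ hL), h⟩

theorem HomogWord.subset {L L' : List (ℤ × V)} (hL : HomogWord V L) (h : L' ⊆ L) :
    HomogWord V L' := fun c hc => hL c (h hc)

end Words

namespace HomotopyProbabilityAlgebra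

variable {k : Type u} [Field k] {C : PointedGraded.{u, v} k} {S : PointedGraded.{u, w} k}
  (A : HomotopyProbabilityAlgebra C)

/-- The descendant operations as a function on words. -/
abbrev ell : List (ℤ × C) → C := opWord A.descendantOps

theorem multiAdd_ell : MultiAdd A.ell := A.descendantOps_isML.multiAdd

theorem K_comp {α : Type*} (g : α → ℤ) (φ : List α → C) {L : List α} (hL : L ≠ []) :
    A.K (comp g A.M.onWord φ L) = comp g (ins A.M.onWord A.ell) φ L := by
  have h : A.K (comp g A.M.onWord φ L) =
      eval (parts g L) fun p => A.K (A.M.onWord (p.map (tag g φ))) :=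
    map_eval A.K.toAddMonoidHom _ _
  rw [h]
  refine eval_parts_congr fun p hp => A.K_M_onWord ?_
  simpa using hp.ne_nil hL

/-- Only the one-block summand of the insertion can survive, and `M_1` is the identity. This is used
in both directions: to show that densities are closed, and to recover the composite of `ℓ` with `Φ`
from the density along a flow. -/
theorem K_comp_eq {α : Type*} (g : α → ℤ) (φ : List α → C) {L : List α} (hL : L ≠ [])
    (h : ∀ B, B ≠ [] → B.length < L.length → B ⊆ L → comp g A.ell φ B = 0) :
    A.K (comp g A.M.onWord φ L) = comp g A.ell φ L := by
  rw [A.K_comp g φ hL, comp_ins _ A.M.multiAdd, markSum_eq_head A.M.multiAdd hL h,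
    M_onWord_single]

theorem density_eq_comp (φ : SymFamily S C 0) {n : ℕ} (d : Fin n → ℤ) (x : Fin n → S) :
    A.density φ n d x = comp Prod.fst A.M.onWord φ.onWord (word d x) := compOps_eq_comp _ _ _ _ _

variable {A}

theorem comp_ell_eq_zero (φ : RandomVariables A S) {L : List (ℤ × S)} (hL : L ≠ [])
    (hh : HomogWord S L) : comp Prod.fst A.ell φ.family.onWord L = 0 := by
  obtain ⟨d, x, hx, h⟩ := hh.exists_word
  have hn : 1 ≤ L.length := List.length_pos_iff.2 hL
  generalize L.length = n at *
  subst h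
  rw [← compOps_eq_comp, φ.relation n hn d x hx, insertOps_zero]

theorem K_density (φ : RandomVariables A S) {n : ℕ} (hn : 1 ≤ n) {d : Fin n → ℤ}
    {x : Fin n → S} (hx : S.Homog d x) : A.K (A.density φ.family n d x) = 0 := by
  have hh := homogWord_word.2 hx
  rw [density_eq_comp, K_comp_eq _ _ _ (word_ne_nil hn d x),
    comp_ell_eq_zero φ (word_ne_nil hn d x) hh]
  exact fun B hB _ hs => comp_ell_eq_zero φ hB (hh.subset hs)

/-- Words starting with the extra letter are evaluated by `η`, which is polynomial on every word.
The others are evaluated by `Φ`, for which the flow equation is available only on nonempty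
homogeneous words, whence the information kept in `h2`. -/
theorem optOp_cases {P : List (Option (ℤ × S)) → Prop} {L : List (ℤ × S)}
    {B : List (Option (ℤ × S))} (hB : B ≠ []) (hs : B ⊆ none :: L.map some)
    (h1 : ∀ B', P (none :: B'))
    (h2 : ∀ a B', a :: B'.reduceOption ⊆ L → P (some a :: B')) : P B := by
  match B with
  | [] => exact absurd rfl hB
  | none :: B' => exact h1 B'
  | some a :: B' =>
    refine h2 a B' fun c hc => ?_
    have hc' : some c ∈ some a :: B' := by
      rcases List.mem_cons.1 hc with rfl | hc
      · simp
      · exact List.mem_cons_of_mem _ (List.reduceOption_mem_iff.1 hc)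
    simpa using hs hc'

variable [CharZero k]

/-- The effect of a polynomial flow on the correlation densities. -/
theorem comp_flow {Φ : k → SymFamily S C 0} {η : k → SymFamily S C (-1)}
    (hη : ∀ L, ∃ g', HasPolyDeriv (fun τ => (η τ).onWord L) g')
    (hΦ : ∀ L, L ≠ [] → HomogWord S L → HasPolyDeriv (fun τ => (Φ τ).onWord L)
      fun τ => markSum (-1) Prod.fst A.ell (Φ τ).onWord (η τ).onWord L)
    (h0 : ∀ L, L ≠ [] → HomogWord S L → comp Prod.fst A.ell (Φ 0).onWord L = 0) :
    ∀ (n : ℕ) (L : List (ℤ × S)), L.length = n → L ≠ [] → HomogWord S L → ∀ τ,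
      comp Prod.fst A.ell (Φ τ).onWord L = 0 ∧
      ∃ z, comp Prod.fst A.M.onWord (Φ τ).onWord L -
        comp Prod.fst A.M.onWord (Φ 0).onWord L = A.K z := by
  intro n
  -- The flow equation does not say that `Φ τ` remains a morphism. Both assertions are proved
  -- together: vanishing on shorter words identifies the derivative of the density as exact, and
  -- this in turn gives vanishing on `L`.
  induction n using Nat.strong_induction_on with
  | _ n ih =>
    rintro L rfl hL hh τ
    have hlt : ∀ τ B, B ≠ [] → B.length < L.length → B ⊆ L →
        comp Prod.fst A.ell (Φ τ).onWord B = 0 := fun τ B hB hl hs =>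
      (ih _ hl B rfl hB (hh.subset hs) τ).1
    have hP := HasPolyDeriv.comp A.M Prod.fst (φ := fun τ => (Φ τ).onWord)
      (φ' := fun τ => markSum (-1) Prod.fst A.ell (Φ τ).onWord (η τ).onWord) (L := L)
      fun B hB hs => hΦ B hB (hh.subset hs)
    -- The primitive of the derivative is the density with one `Φ` replaced by `η`, written as a
    -- composition over the word with an extra letter of degree `-1`.
    have hK : ∀ τ, A.K (comp (optDeg (-1) Prod.fst) A.M.onWord
        (optOp (Φ τ).onWord (η τ).onWord) (none :: L.map some)) =
        markSum 0 Prod.fst A.M.onWord (Φ τ).onWord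
          (markSum (-1) Prod.fst A.ell (Φ τ).onWord (η τ).onWord) L := fun τ => by
      rw [A.K_comp _ _ (by simp), comp_ins_none _ A.M.multiAdd A.multiAdd_ell
        (η τ).onWord_nil (hlt τ)]
    have hlam : ∃ g', HasPolyDeriv (fun τ => comp (optDeg (-1) Prod.fst) A.M.onWord
        (optOp (Φ τ).onWord (η τ).onWord) (none :: L.map some)) g' := by
      have hpoly : ∀ B, B ≠ [] → B ⊆ none :: L.map some →
          ∃ g', HasPolyDeriv (fun τ => optOp (Φ τ).onWord (η τ).onWord B) g' := by
        intro B hB hs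
        refine optOp_cases (P := fun B => ∃ g', HasPolyDeriv
          (fun τ => optOp (Φ τ).onWord (η τ).onWord B) g') hB hs ?_ ?_
        · exact fun B' => hη _
        · intro a B' hs'
          have := hΦ _ (List.cons_ne_nil a B'.reduceOption) (hh.subset hs')
          exact ⟨_, this⟩
      choose! g' hg' using hpoly
      exact ⟨_, HasPolyDeriv.comp A.M (optDeg (-1) Prod.fst)
        (φ := fun τ => optOp (Φ τ).onWord (η τ).onWord) (φ' := fun τ B => g' B τ) hg'⟩
    simp only [← hK] at hP
    obtain ⟨g', hg'⟩ := hlam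
    obtain ⟨z, hz⟩ := hP.exists_sub_eq A.K hg' τ
    refine ⟨?_, z, hz⟩
    -- On `L` the composite of `ℓ` with `Φ τ` is `K` of the density, which is constant in `τ`
    -- because the density changes only by exact terms.
    rw [← A.K_comp_eq Prod.fst _ hL (hlt τ)]
    have h1 := congrArg A.K hz
    rw [map_sub, A.K_K, A.K_comp_eq Prod.fst (Φ 0).onWord hL (hlt 0), h0 L hL hh, sub_zero] at h1
    exact h1

/-- Up to the image of the differential, the correlation densities depend only on the homotopy
type. -/
theorem density_sub_of_homotopic {φ ψ : RandomVariables A S} (h : φ.Homotopic ψ) {n : ℕ}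
    (hn : 1 ≤ n) {d : Fin n → ℤ} {x : Fin n → S} (hx : S.Homog d x) :
    ∃ z, A.density ψ.family n d x - A.density φ.family n d x = A.K z := by
  obtain ⟨Φ, η, h1, -, h3, h4, h5⟩ := h
  have hη : ∀ L, ∃ g', HasPolyDeriv (fun τ => (η τ).onWord L) g' := by
    intro L
    obtain ⟨p, hp⟩ := h1 L.length fun i => (L.get i).2
    exact ⟨_, p, fun τ => ⟨hp τ, rfl⟩⟩
  have hΦ : ∀ L, L ≠ [] → HomogWord S L → HasPolyDeriv (fun τ => (Φ τ).onWord L)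
      fun τ => markSum (-1) Prod.fst A.ell (Φ τ).onWord (η τ).onWord L := by
    intro L hL hh
    obtain ⟨d, x, hx, h⟩ := hh.exists_word
    have hn : 1 ≤ L.length := List.length_pos_iff.2 hL
    generalize L.length = n at *
    subst h
    obtain ⟨p, hp⟩ := h3 n hn d x hx
    refine ⟨p, fun τ => ⟨?_, ?_⟩⟩
    · simp only
      rw [SymFamily.onWord_word, (hp τ).1]
    · rw [(hp τ).2, flowOps_eq_markSum]
  have := (comp_flow hη hΦ (fun L hL hh => by rw [h4]; exact comp_ell_eq_zero φ hL hh) _ _ rfl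
    (word_ne_nil hn d x) (homogWord_word.2 hx) 1).2
  rw [h4, h5] at this
  simpa only [density_eq_comp] using this

theorem density_sub_of_quot_eq {φ ψ : RandomVariables A S}
    (h : Quot.mk UnitalSLHom.Homotopic φ = Quot.mk UnitalSLHom.Homotopic ψ) {n : ℕ}
    (hn : 1 ≤ n) {d : Fin n → ℤ} {x : Fin n → S} (hx : S.Homog d x) :
    ∃ z, A.density ψ.family n d x - A.density φ.family n d x = A.K z := by
  replace h := Quot.eqvGen_exact h
  induction h with
  | rel φ ψ h => exact density_sub_of_homotopic h hn hx
  | refl φ => exact ⟨0, by simp⟩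
  | symm φ ψ _ ih =>
    obtain ⟨z, hz⟩ := ih
    exact ⟨-z, by rw [map_neg, ← hz, neg_sub]⟩
  | trans φ ψ χ _ _ ih₁ ih₂ =>
    obtain ⟨y, hy⟩ := ih₁
    obtain ⟨z, hz⟩ := ih₂
    exact ⟨z + y, by rw [map_add, ← hy, ← hz, sub_add_sub_cancel]⟩

end HomotopyProbabilityAlgebra

/-! ### Symmetry of sums over partitions -/

namespace WordPartition

variable {α X : Type*} [AddCommGroup X]

theorem eval_der_append {β : Type*} (e : ℤ) (g : β → ℤ) (D : β → SignedSum β) (p q : List β)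
    (F : List β → X) : eval (der e g D (p ++ q)) F =
      eval (der e g D p) (fun r => F (r ++ q)) +
        sg (e * wt g p) • eval (der e g D q) (fun r => F (p ++ r)) := by
  induction p generalizing F with
  | nil => simp
  | cons b p ih =>
    simp only [List.cons_append, eval_der_cons, ih, smul_add, smul_smul, ← sg_add, wt_cons,
      mul_add]
    abel

/-- A function of lists of blocks is symmetric in the blocks, and symmetric in each block. -/
structure BlockSymm (g : α → ℤ) (P : List α → Prop) (F : List (List α) → X) : Prop where
  swap_blocks : ∀ p₁ B B' p₂, P (p₁ ++ B :: B' :: p₂).flatten →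
    F (p₁ ++ B :: B' :: p₂) = sg (wt g B * wt g B') • F (p₁ ++ B' :: B :: p₂)
  swap_letters : ∀ p₁ B₁ a b B₂ p₂, P (p₁ ++ (B₁ ++ a :: b :: B₂) :: p₂).flatten →
    F (p₁ ++ (B₁ ++ a :: b :: B₂) :: p₂) =
      sg (g a * g b) • F (p₁ ++ (B₁ ++ b :: a :: B₂) :: p₂)

theorem flatten_perm_of_mem_der {e : ℤ} {g : List α → ℤ} {a : α} {p : List (List α)}
    {c : ℤˣ × List (List α)} (hc : c ∈ der e g (consOp a) p) :
    c.2.flatten.Perm (a :: p.flatten) := by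
  obtain ⟨p₁, B, p₂, rfl, h⟩ := mem_der_consOp hc
  rw [h]
  simp

/-- Inserting `a` runs over all positions, so exchanging two neighbouring blocks exchanges two of
the summands, up to the sign for moving `a` past a block. The predicate is shifted to words that
begin with `a`. -/
theorem BlockSymm.eval_insertLetter {g : α → ℤ} {P : List α → Prop}
    (hP : ∀ L L', List.Perm L L' → P L → P L') {F : List (List α) → X} (hF : BlockSymm g P F)
    (a : α) : BlockSymm g (fun L => P (a :: L)) (fun p => eval (insertLetter g a p) F) := by
  constructor
  · intro p₁ B B' p₂ hp
    simp only [WordPartition.eval_insertLetter, eval_der_append, eval_der_cons, eval_consOp,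
      smul_add]
    have h0 := hF.swap_blocks ([a] :: p₁) B B' p₂ (by simpa using hp)
    have h1 : eval (der (g a) (wt g) (consOp a) p₁) (fun r => F (r ++ B :: B' :: p₂)) =
        sg (wt g B * wt g B') •
          eval (der (g a) (wt g) (consOp a) p₁) (fun r => F (r ++ B' :: B :: p₂)) := by
      rw [← eval_smul]
      refine eval_congr fun c hc => hF.swap_blocks _ _ _ _ (hP _ _ ?_ hp)
      simpa using ((flatten_perm_of_mem_der hc).symm.append_right (B ++ (B' ++ p₂.flatten)))
    have h4 : eval (der (g a) (wt g) (consOp a) p₂) (fun r => F (p₁ ++ B :: B' :: r)) =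
        sg (wt g B * wt g B') •
          eval (der (g a) (wt g) (consOp a) p₂) (fun r => F (p₁ ++ B' :: B :: r)) := by
      rw [← eval_smul]
      refine eval_congr fun c hc => hF.swap_blocks _ _ _ _ (hP _ _ ?_ hp)
      have := (flatten_perm_of_mem_der hc).symm.append_left (p₁.flatten ++ (B ++ B'))
      refine List.Perm.trans ?_ (this.trans (by simp))
      simpa using (List.perm_middle (a := a) (l₁ := p₁.flatten ++ (B ++ B'))).symm
    have h2 := hF.swap_blocks p₁ (a :: B) B' p₂ (hP _ _ (by
      simpa using (List.perm_middle (a := a) (l₁ := p₁.flatten)).symm) hp)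
    have h3 := hF.swap_blocks p₁ B (a :: B') p₂ (hP _ _ (by
      simpa using (List.perm_middle (a := a) (l₁ := p₁.flatten ++ B)).symm) hp)
    simp only [List.cons_append] at h0
    rw [h0, h1, h2, h3, h4]
    simp only [wt_cons, mul_add, add_mul, sg_add, smul_smul]
    have e1 := sg_mul_self (g a * wt g B)
    have e2 := sg_mul_self (g a * wt g B')
    rw [mul_comm (wt g B) (g a)]
    generalize sg (g a * wt g B) = s₁ at *
    generalize sg (g a * wt g B') = s₂ at *
    generalize sg (wt g B * wt g B') = s₃
    generalize sg (g a * wt (wt g) p₁) = s₄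
    have c1 : s₄ * (s₁ * (s₁ * s₃)) = s₃ * s₄ := by
      rw [← mul_assoc s₁, e1, one_mul, mul_comm]
    have c2 : s₄ * (s₁ * (s₂ * s₃)) = s₃ * (s₄ * (s₂ * s₁)) := by
      simp only [mul_comm, mul_left_comm]
    have c3 : s₄ * (s₂ * s₃) = s₃ * (s₄ * s₂) := by simp only [mul_comm, mul_left_comm]
    rw [c1, c2, c3]
    abel
  · intro p₁ B₁ b c B₂ p₂ hp
    simp only [WordPartition.eval_insertLetter, eval_der_append, eval_der_cons, eval_consOp,
      smul_add]
    have h0 := hF.swap_letters ([a] :: p₁) B₁ b c B₂ p₂ (by simpa using hp)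
    have h1 : eval (der (g a) (wt g) (consOp a) p₁)
          (fun r => F (r ++ (B₁ ++ b :: c :: B₂) :: p₂)) =
        sg (g b * g c) • eval (der (g a) (wt g) (consOp a) p₁)
          (fun r => F (r ++ (B₁ ++ c :: b :: B₂) :: p₂)) := by
      rw [← eval_smul]
      refine eval_congr fun x hx => hF.swap_letters _ _ _ _ _ _ (hP _ _ ?_ hp)
      simpa using ((flatten_perm_of_mem_der hx).symm.append_right
        (B₁ ++ (b :: c :: (B₂ ++ p₂.flatten))))
    have h3 : eval (der (g a) (wt g) (consOp a) p₂)
          (fun r => F (p₁ ++ (B₁ ++ b :: c :: B₂) :: r)) =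
        sg (g b * g c) • eval (der (g a) (wt g) (consOp a) p₂)
          (fun r => F (p₁ ++ (B₁ ++ c :: b :: B₂) :: r)) := by
      rw [← eval_smul]
      refine eval_congr fun x hx => hF.swap_letters _ _ _ _ _ _ (hP _ _ ?_ hp)
      have := (flatten_perm_of_mem_der hx).symm.append_left
        (p₁.flatten ++ (B₁ ++ b :: c :: B₂))
      refine List.Perm.trans ?_ (this.trans (by simp))
      simpa using (List.perm_middle (a := a) (l₁ := p₁.flatten ++ (B₁ ++ b :: c :: B₂))).symm
    have h2 := hF.swap_letters p₁ (a :: B₁) b c B₂ p₂ (hP _ _ (by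
      simpa using (List.perm_middle (a := a) (l₁ := p₁.flatten)).symm) hp)
    have hw : wt g (B₁ ++ b :: c :: B₂) = wt g (B₁ ++ c :: b :: B₂) :=
      wt_perm g ((List.Perm.swap c b B₂).append_left B₁)
    simp only [List.cons_append] at h0 h2
    rw [h0, h1, h2, h3, hw]
    simp only [smul_smul]
    generalize sg (g b * g c) = s₁
    generalize sg (g a * wt (wt g) p₁) = s₂
    generalize sg (g a * wt g (B₁ ++ c :: b :: B₂)) = s₃
    rw [mul_comm s₂ s₁, mul_comm s₃ s₁, mul_left_comm s₂ s₁ s₃]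

/-- Insertions into different blocks commute up to the Koszul sign by themselves; `hF` is needed
only when both letters enter the same block. -/
theorem eval_der_der_swap {g : α → ℤ} (a b : α) (p : List (List α)) (F : List (List α) → X)
    (hF : ∀ p₁ B p₂, p = p₁ ++ B :: p₂ →
      F (p₁ ++ (a :: b :: B) :: p₂) = sg (g a * g b) • F (p₁ ++ (b :: a :: B) :: p₂)) :
    eval (der (g b) (wt g) (consOp b) p) (fun x => eval (der (g a) (wt g) (consOp a) x) F) =
      sg (g a * g b) •
        eval (der (g a) (wt g) (consOp a) p)
          (fun x => eval (der (g b) (wt g) (consOp b) x) F) := by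
  induction p generalizing F with
  | nil => simp
  | cons B p ih =>
    have h := ih (fun q => F (B :: q)) fun p₁ B' p₂ hp => by
      subst hp
      exact hF (B :: p₁) B' p₂ rfl
    have h0 := hF [] B p rfl
    simp only [List.nil_append] at h0
    simp only [eval_der_cons, eval_consOp, eval_add, eval_smul, h, h0, smul_add, smul_smul,
      wt_cons, mul_add, sg_add]
    rw [mul_comm (g b) (g a)]
    have e := sg_mul_self (g a * g b)
    generalize sg (g a * g b) = s₁ at *
    generalize sg (g a * wt g B) = s₂
    generalize sg (g b * wt g B) = s₃
    rw [← mul_assoc s₁ s₁ s₃, e, one_mul, mul_left_comm s₁ s₂ s₃, mul_left_comm s₃ s₂ s₁,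
      mul_comm s₃ s₁, mul_left_comm s₂ s₁ s₃]
    abel

theorem eval_insertLetter_swap {g : α → ℤ} {P : List α → Prop}
    (hP : ∀ L L', List.Perm L L' → P L → P L') {F : List (List α) → X} (hF : BlockSymm g P F)
    (a b : α) (p : List (List α)) (hp : P (a :: b :: p.flatten)) :
    eval (insertLetter g b p) (fun q => eval (insertLetter g a q) F) =
      sg (g a * g b) • eval (insertLetter g a p) (fun q => eval (insertLetter g b q) F) := by
  have h1 := hF.swap_blocks [] [a] [b] p (by simpa using hp)
  have h2 := hF.swap_letters [] [] a b [] p (by simpa using hp)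
  have h3 := eval_der_der_swap (g := g) a b p F fun p₁ B p₂ h => by
    subst h
    refine hF.swap_letters p₁ [] a b B p₂ (hP _ _ ?_ hp)
    simpa using (List.perm_append_comm (l₁ := p₁.flatten) (l₂ := [a, b])).symm.append_right
      (B ++ p₂.flatten)
  simp only [List.nil_append, wt_cons, wt_nil, add_zero] at h1 h2
  simp only [eval_insertLetter, eval_der_cons, eval_consOp, eval_add, h1, h2, h3, smul_add,
    smul_smul, wt_cons, wt_nil, add_zero]
  rw [mul_comm (g b) (g a), sg_mul_self, one_smul]
  abel

/-- The letters before `a` and `b` are absorbed into `F` one at a time, which reduces to the case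
where the two letters are the first ones. -/
theorem eval_parts_swap {g : α → ℤ} {P : List α → Prop}
    (hP : ∀ L L', List.Perm L L' → P L → P L') {F : List (List α) → X} (hF : BlockSymm g P F)
    (L₁ : List α) (a b : α) (L₂ : List α) (hL : P (L₁ ++ a :: b :: L₂)) :
    eval (parts g (L₁ ++ a :: b :: L₂)) F =
      sg (g a * g b) • eval (parts g (L₁ ++ b :: a :: L₂)) F := by
  induction L₁ generalizing P F with
  | nil =>
    simp only [List.nil_append, eval_parts_cons]
    rw [← eval_smul]
    refine eval_parts_congr fun p hp => ?_
    exact eval_insertLetter_swap hP hF a b p (hP _ _ ((hp.1.symm.cons b).cons a) hL)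
  | cons c L₁ ih =>
    simp only [List.cons_append, eval_parts_cons]
    exact ih (P := fun L => P (c :: L)) (fun L L' h => hP _ _ (h.cons c))
      (hF.eval_insertLetter hP c) hL

end WordPartition

/-! ### Koszul signs -/

section Koszul

/-- For symmetric `G` this is a product over unordered pairs, which a permutation merely rearranges.
-/
theorem prod_lt_comp_perm {n : ℕ} (G : Fin n → Fin n → ℤˣ) (hG : ∀ i j, G i j = G j i)
    (τ : Equiv.Perm (Fin n)) :
    ∏ i, ∏ j, (if i < j then G (τ i) (τ j) else 1) = ∏ i, ∏ j, if i < j then G i j else 1 := by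
  rw [← Fintype.prod_prod_type' (f := fun i j => if i < j then G (τ i) (τ j) else 1),
    ← Fintype.prod_prod_type' (f := fun i j => if i < j then G i j else 1),
    ← Finset.prod_filter, ← Finset.prod_filter]
  have key : ∀ (ρ : Equiv.Perm (Fin n)) (x : Fin n × Fin n), x.1 < x.2 →
      (if ρ x.1 < ρ x.2 then (ρ x.1, ρ x.2) else (ρ x.2, ρ x.1)) ∈
        Finset.univ.filter (fun x : Fin n × Fin n => x.1 < x.2) := by
    intro ρ x hx
    have hne : ρ x.1 ≠ ρ x.2 := fun h => hx.ne (ρ.injective h)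
    split_ifs with h
    · simpa using h
    · simpa using lt_of_le_of_ne (not_lt.1 h) hne.symm
  refine Finset.prod_nbij' (fun x => if τ x.1 < τ x.2 then (τ x.1, τ x.2) else (τ x.2, τ x.1))
    (fun x => if τ.symm x.1 < τ.symm x.2 then (τ.symm x.1, τ.symm x.2)
      else (τ.symm x.2, τ.symm x.1)) (fun x hx => key τ x (by simpa using hx))
    (fun x hx => key τ.symm x (by simpa using hx)) ?_ ?_ ?_
  · intro x hx
    have hx : x.1 < x.2 := by simpa using hx
    split_ifs with h₁ h₂ h₂ <;> simp_all [not_lt_of_gt]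
  · intro x hx
    have hx : x.1 < x.2 := by simpa using hx
    split_ifs with h₁ h₂ h₂ <;> simp_all [not_lt_of_gt]
  · intro x hx
    split_ifs with h
    · rfl
    · exact hG _ _

/-- A pair is inverted by the product exactly if it is inverted by one factor but not by both, and a
sign counted twice is `1`. Reindexing by `τ` requires the contributions of `σ` to be symmetrised,
which is the role of `G`. -/
theorem koszulPerm_mul {n : ℕ} (d : Fin n → ℤ) (σ τ : Equiv.Perm (Fin n)) :
    koszulPerm d (σ * τ) = koszulPerm d σ * koszulPerm (d ∘ σ) τ := by
  let E : Fin n → Fin n → ℤˣ := fun u v =>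
    if σ v < σ u then sg (d (σ u) * d (σ v)) else 1
  let G : Fin n → Fin n → ℤˣ := fun u v => if u < v then E u v else E v u
  have hG : ∀ i j, G i j = G j i := by
    intro i j
    rcases lt_trichotomy i j with h | rfl | h
    · simp [G, h, not_lt_of_gt h]
    · rfl
    · simp [G, h, not_lt_of_gt h]
  have hσ : koszulPerm d σ = ∏ i, ∏ j, if i < j then G i j else 1 := by
    refine Finset.prod_congr rfl fun i _ => Finset.prod_congr rfl fun j _ => ?_
    by_cases h : i < j <;> simp [G, E, h, negOnePow_eq_sg]
  rw [hσ, ← prod_lt_comp_perm G hG τ, koszulPerm, koszulPerm, ← Finset.prod_mul_distrib]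
  refine Finset.prod_congr rfl fun i _ => ?_
  rw [← Finset.prod_mul_distrib]
  refine Finset.prod_congr rfl fun j _ => ?_
  by_cases h : i < j
  · have hne : τ i ≠ τ j := fun h' => h.ne (τ.injective h')
    have hne' : σ (τ i) ≠ σ (τ j) := fun h' => hne (σ.injective h')
    have e := sg_mul_self (d (σ (τ i)) * d (σ (τ j)))
    simp only [h, true_and, if_true, Equiv.Perm.mul_apply, G, E, Function.comp, negOnePow_eq_sg]
    rcases lt_or_gt_of_ne hne with h1 | h1 <;> rcases lt_or_gt_of_ne hne' with h2 | h2 <;>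
      simp [h1, h2, not_lt_of_gt h1, not_lt_of_gt h2, mul_comm (d (σ (τ j))), e]
  · simp [h]

theorem koszulPerm_swap {n : ℕ} (d : Fin n → ℤ) {i j : Fin n} (hij : (j : ℕ) = i + 1) :
    koszulPerm d (Equiv.swap i j) = sg (d i * d j) := by
  have key : ∀ a b : Fin n, (a < b ∧ Equiv.swap i j b < Equiv.swap i j a) ↔ a = i ∧ b = j := by
    intro a b
    simp only [Equiv.swap_apply_def, Fin.ext_iff, Fin.lt_def]
    split_ifs <;> simp_all <;> omega
  unfold koszulPerm
  simp only [key]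
  rw [Finset.prod_eq_single i, Finset.prod_eq_single j]
  · simp [mul_comm, negOnePow_eq_sg]
  · intro b _ hb; simp [hb]
  · simp
  · intro b _ hb; simp [hb]
  · simp

theorem ofFn_comp_swap {α : Type*} {n : ℕ} (y : Fin n → α) {i j : Fin n}
    (hij : (j : ℕ) = i + 1) : ∃ L₁ L₂ : List α, L₁.length = i ∧
      List.ofFn y = L₁ ++ y i :: y j :: L₂ ∧
      List.ofFn (y ∘ Equiv.swap i j) = L₁ ++ y j :: y i :: L₂ := by
  have H : ∀ z : Fin n → α, List.ofFn z =
      (List.ofFn z).take i ++ z i :: z j :: (List.ofFn z).drop (i + 2) := by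
    intro z
    conv_lhs => rw [← List.take_append_drop i (List.ofFn z)]
    rw [List.drop_eq_getElem_cons (by simp),
      List.drop_eq_getElem_cons (i := i + 1) (by simpa [hij] using j.2)]
    simp only [List.getElem_ofFn, Fin.eta]
    congr 4
    exact Fin.ext hij.symm
  refine ⟨(List.ofFn y).take i, (List.ofFn y).drop (i + 2), by simp, H y, ?_⟩
  rw [H (y ∘ Equiv.swap i j)]
  congr 1
  · apply List.ext_getElem
    · simp
    · intro m h₁ h₂
      simp only [List.getElem_take, List.getElem_ofFn, Function.comp]
      simp only [List.length_take, lt_inf_iff] at h₁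
      rw [Equiv.swap_apply_of_ne_of_ne] <;> simp [Fin.ext_iff] <;> omega
  · simp only [Function.comp, Equiv.swap_apply_left, Equiv.swap_apply_right]
    congr 2
    apply List.ext_getElem
    · simp
    · intro m h₁ h₂
      simp only [List.getElem_drop, List.getElem_ofFn]
      rw [Function.comp, Equiv.swap_apply_of_ne_of_ne] <;> simp [Fin.ext_iff] <;> omega

end Koszul

/-! ### Graded symmetric functions of words -/

/-- Graded symmetry of a function of homogeneous words. -/
def SwapSymm {k : Type u} [Field k] (V : PointedGraded.{u, v} k) {X : Type*} [AddCommGroup X]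
    (f : List (ℤ × V) → X) : Prop :=
  ∀ L₁ a b L₂, HomogWord V (L₁ ++ a :: b :: L₂) →
    f (L₁ ++ a :: b :: L₂) = sg (a.1 * b.1) • f (L₁ ++ b :: a :: L₂)

section Symm

variable {k : Type u} [Field k] {U : PointedGraded k} {V : PointedGraded.{u, v} k}
  {W : PointedGraded.{u, w} k}

theorem SymFamily.swapSymm {e : ℤ} (f : SymFamily V W e) : SwapSymm V f.onWord := by
  intro L₁ a b L₂ hL
  obtain ⟨d, x, hx, h⟩ := hL.exists_word
  have hlen : L₁.length + 1 < (L₁ ++ a :: b :: L₂).length := by simp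
  generalize (L₁ ++ a :: b :: L₂).length = n at *
  let i : Fin n := ⟨L₁.length, by omega⟩
  let j : Fin n := ⟨L₁.length + 1, by omega⟩
  obtain ⟨L₁', L₂', hl, h₁, h₂⟩ := ofFn_comp_swap (fun i => (d i, x i)) (i := i) (j := j) rfl
  have h₃ : L₁ ++ a :: b :: L₂ = L₁' ++ (d i, x i) :: (d j, x j) :: L₂' := h.trans h₁
  obtain ⟨rfl, h₄⟩ := List.append_inj h₃ hl.symm
  simp only [List.cons.injEq] at h₄
  obtain ⟨rfl, rfl, rfl⟩ := h₄
  have h₅ : word (d ∘ Equiv.swap i j) (x ∘ Equiv.swap i j) =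
    L₁ ++ (d j, x j) :: (d i, x i) :: L₂ := h₂
  rw [h, ← h₅, SymFamily.onWord_word, SymFamily.onWord_word,
    f.map_symm n d x (Equiv.swap i j) hx, koszulPerm_swap d rfl]

/-- Adjacent transpositions generate the symmetric group and the Koszul sign is multiplicative in
the sense of `koszulPerm_mul`. -/
theorem SwapSymm.koszulPerm {l : GradedOps V W} (h : SwapSymm V (opWord l)) (n : ℕ)
    (d : Fin n → ℤ) (x : Fin n → V) (σ : Equiv.Perm (Fin n)) (hx : V.Homog d x) :
    l n d x = koszulPerm d σ • l n (d ∘ σ) (x ∘ σ) := by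
  rcases n with _ | n
  · have h1 : σ = 1 := Subsingleton.elim _ _
    subst h1
    have : _root_.koszulPerm d 1 = 1 := by simp [_root_.koszulPerm]
    rw [this, one_smul]
    rfl
  have hσ : σ ∈ Submonoid.closure
      (Set.range fun i : Fin n => Equiv.swap i.castSucc i.succ) := by
    rw [Equiv.Perm.mclosure_swap_castSucc_succ]; trivial
  induction hσ using Submonoid.closure_induction_right with
  | one =>
    have : _root_.koszulPerm d 1 = 1 := by
      refine Finset.prod_eq_one fun i _ => Finset.prod_eq_one fun j _ => if_neg ?_
      rintro ⟨h1, h2⟩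
      exact lt_asymm h1 h2
    rw [this, one_smul]
    rfl
  | mul_right σ hσ τ hτ ih =>
    obtain ⟨i, hi⟩ := hτ
    obtain rfl : Equiv.swap i.castSucc i.succ = τ := hi
    rw [koszulPerm_mul, mul_smul, ih]
    congr 1
    have hij : (i.succ : ℕ) = i.castSucc + 1 := by simp
    obtain ⟨L₁, L₂, -, h₁, h₂⟩ := ofFn_comp_swap (fun i => ((d ∘ σ) i, (x ∘ σ) i)) hij
    have hh : HomogWord V (word (d ∘ σ) (x ∘ σ)) := homogWord_word.2 fun i => hx (σ i)
    rw [← opWord_word l (d ∘ σ) (x ∘ σ),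
      ← opWord_word l (d ∘ ⇑(σ * Equiv.swap i.castSucc i.succ))
        (x ∘ ⇑(σ * Equiv.swap i.castSucc i.succ)), koszulPerm_swap _ hij]
    have h₃ : word (d ∘ ⇑(σ * Equiv.swap i.castSucc i.succ))
      (x ∘ ⇑(σ * Equiv.swap i.castSucc i.succ)) = _ := h₂
    have h₄ : word (d ∘ σ) (x ∘ σ) = _ := h₁
    rw [h₃, h₄]
    exact h _ _ _ _ (h₄ ▸ hh)

theorem SymFamily.onWord_mem {e : ℤ} (f : SymFamily V W e) {L : List (ℤ × V)}
    (hL : HomogWord V L) : f.onWord L ∈ W.deg (wt Prod.fst L + e) := by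
  obtain ⟨d, x, hx, h⟩ := hL.exists_word
  generalize L.length = n at *
  subst h
  rw [f.onWord_word, word, wt_ofFn]
  exact f.map_mem n d x hx

theorem SignedSum.eval_mem {β E : Type*} [AddCommGroup E] [Module k E] (P : Submodule k E)
    {s : SignedSum β} {F : β → E} (h : ∀ c ∈ s, F c.2 ∈ P) : eval s F ∈ P := by
  induction s with
  | nil => exact P.zero_mem
  | cons c s ih =>
    rw [eval_cons]
    refine P.add_mem ?_ (ih fun c hc => h c (by simp [hc]))
    rw [Units.smul_def]
    exact P.toAddSubgroup.zsmul_mem (h c (by simp)) _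

theorem homogWord_map_tag {φ : List (ℤ × U) → V}
    (hφ : ∀ L, HomogWord U L → φ L ∈ V.deg (wt Prod.fst L)) {p : List (List (ℤ × U))}
    (hp : HomogWord U p.flatten) : HomogWord V (p.map (tag Prod.fst φ)) := by
  intro c hc
  obtain ⟨B, hB, rfl⟩ := List.mem_map.1 hc
  exact hφ B fun c hc => hp c (List.mem_flatten.2 ⟨B, hB, hc⟩)

theorem comp_mem {e : ℤ} (f : SymFamily V W e) {φ : List (ℤ × U) → V}
    (hφ : ∀ L, HomogWord U L → φ L ∈ V.deg (wt Prod.fst L)) {L : List (ℤ × U)}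
    (hL : HomogWord U L) : comp Prod.fst f.onWord φ L ∈ W.deg (wt Prod.fst L + e) := by
  refine eval_mem _ fun c hc => ?_
  have hd := isDecomp_of_mem_parts hc
  have h := f.onWord_mem (homogWord_map_tag hφ (hL.subset hd.1.subset))
  rwa [show wt Prod.fst (c.2.map (tag Prod.fst φ)) = wt Prod.fst L by
    rw [← hd.wt_eq]; simp [wt, tag, Function.comp_def]; rfl] at h

theorem WordPartition.MultiAdd.units_smul {X E : Type*} [AddCommGroup X] [AddCommGroup E]
    {f : List (ℤ × E) → X} (hf : MultiAdd f) (L₁ : List (ℤ × E)) (m : ℤ) (L₂ : List (ℤ × E))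
    (s : ℤˣ) (u : E) : f (L₁ ++ (m, s • u) :: L₂) = s • f (L₁ ++ (m, u) :: L₂) := by
  rw [Units.smul_def, Units.smul_def]
  exact map_zsmul (AddMonoidHom.mk' (fun u => f (L₁ ++ (m, u) :: L₂)) (hf L₁ m L₂)) _ _

theorem comp_swapSymm {e : ℤ} (f : SymFamily V W e) {φ : List (ℤ × U) → V}
    (hφ : ∀ L, HomogWord U L → φ L ∈ V.deg (wt Prod.fst L)) (hs : SwapSymm U φ) :
    SwapSymm U (comp Prod.fst f.onWord φ) := by
  intro L₁ a b L₂ hL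
  refine eval_parts_swap (P := HomogWord U) (fun L L' h hL => hL.subset h.symm.subset) ?_
    L₁ a b L₂ hL
  constructor
  · intro p₁ B B' p₂ hp
    have h := homogWord_map_tag hφ hp
    simp only [List.map_append, List.map_cons] at h ⊢
    exact f.swapSymm _ _ _ _ h
  · intro p₁ B₁ a b B₂ p₂ hp
    have hB : HomogWord U (B₁ ++ a :: b :: B₂) := hp.subset
      fun c hc => List.mem_flatten.2 ⟨_, by simp, hc⟩
    have hw : wt Prod.fst (B₁ ++ a :: b :: B₂) = wt Prod.fst (B₁ ++ b :: a :: B₂) :=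
      wt_perm _ ((List.Perm.swap b a B₂).append_left B₁)
    simp only [List.map_append, List.map_cons]
    rw [tag, hs _ _ _ _ hB, hw, f.multiAdd.units_smul]
    rfl

end Symm

/-! ### Units -/

namespace WordPartition

variable {α X : Type*} [AddCommGroup X]

/-- A function of lists of blocks which vanishes if the last letter lies in a block with other
letters. -/
theorem eval_parts_snoc (g : α → ℤ) (u : α) (L : List α) {F : List (List α) → X}
    (hF : ∀ p B, B ≠ [] → F (p ++ [B ++ [u]]) = 0) :
    eval (parts g (L ++ [u])) F = eval (parts g L) fun p => F (p ++ [[u]]) := by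
  induction L generalizing F with
  | nil => simp
  | cons a L ih =>
    -- Letters are added in front, so `u` stays at the end of the last block; the hypothesis removes
    -- every way of letting another letter join it.
    rw [List.cons_append, eval_parts_cons, eval_parts_cons, ih]
    · refine eval_parts_congr fun p _ => ?_
      have h := hF p [a] (by simp)
      simp only [List.cons_append, List.nil_append] at h
      simp only [eval_insertLetter, eval_der_append, eval_der_cons, eval_consOp, eval_der_nil, h,
        smul_zero, add_zero, List.cons_append]
    · intro p B hB
      have h := hF p (a :: B) (by simp)
      simp only [List.cons_append] at h
      rw [eval_insertLetter, eval_der_append, eval_der_cons, eval_consOp, h,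
        eval_congr (G := fun _ => 0) fun c _ => hF _ _ hB, ← List.cons_append, hF _ _ hB]
      simp [eval_zero]

theorem MultiAdd.map_zero {W : Type*} [AddCommGroup W] {f : List (ℤ × W) → X} (hf : MultiAdd f)
    (L₁ : List (ℤ × W)) (m : ℤ) (L₂ : List (ℤ × W)) : f (L₁ ++ (m, 0) :: L₂) = 0 :=
  (AddMonoidHom.mk' (fun u => f (L₁ ++ (m, u) :: L₂)) (hf L₁ m L₂)).map_zero

end WordPartition

section Units

variable {k : Type u} [Field k] {V : PointedGraded.{u, v} k} {W : PointedGraded.{u, w} k}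

theorem word_snoc {n : ℕ} (d : Fin n → ℤ) (x : Fin n → V) (m : ℤ) (y : V) :
    word (Fin.snoc (α := fun _ => ℤ) d m) (Fin.snoc (α := fun _ => V.carrier) x y) =
      word d x ++ [(m, y)] := by
  rw [word, List.ofFn_succ']
  simp [word, List.concat_eq_append]

theorem CorrelationAlgebra.onWord_append_one (A : CorrelationAlgebra V) {L : List (ℤ × V)}
    (hL : L ≠ []) (m : ℤ) : A.M.onWord (L ++ [(m, V.one)]) = A.M.onWord L := by
  obtain ⟨d, x, h⟩ := exists_word L
  have hn : 1 ≤ L.length := List.length_pos_iff.2 hL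
  generalize L.length = n at *
  subst h
  rw [← word_snoc, SymFamily.onWord_word, SymFamily.onWord_word, A.M_unit n hn]

theorem UnitalSLHom.onWord_append_one {l : GradedOps V V} {l' : GradedOps W W}
    (φ : UnitalSLHom l l') {L : List (ℤ × V)} (hL : L ≠ []) (m : ℤ) :
    φ.family.onWord (L ++ [(m, V.one)]) = 0 := by
  obtain ⟨d, x, h⟩ := exists_word L
  have hn : 1 ≤ L.length := List.length_pos_iff.2 hL
  generalize L.length = n at *
  subst h
  rw [← word_snoc, SymFamily.onWord_word, φ.unit_higher n hn]

/-- The morphism kills every block in which the unit has company; alone it is sent to the unit,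
which `M` then discards. This yields the unit axiom of the canonical structure. -/
theorem comp_append_one {l : GradedOps V V} {l' : GradedOps W W} (A : CorrelationAlgebra W)
    (φ : UnitalSLHom l l') {L : List (ℤ × V)} (hL : L ≠ []) :
    comp Prod.fst A.M.onWord φ.family.onWord (L ++ [(0, V.one)]) =
      comp Prod.fst A.M.onWord φ.family.onWord L := by
  rw [comp, eval_parts_snoc]
  · refine eval_parts_congr fun p hp => ?_
    have h1 : tag Prod.fst φ.family.onWord [(0, V.one)] = (0, W.one) :=
      Prod.ext (by simp [tag]) ((φ.family.onWord_word (fun _ : Fin 1 => 0) fun _ => V.one).trans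
        φ.unit_one)
    rw [List.map_append, List.map_singleton, h1,
      A.onWord_append_one (by simpa using hp.ne_nil hL)]
  · intro p B hB
    rw [List.map_append, List.map_singleton, tag, φ.onWord_append_one hB]
    exact A.M.multiAdd.map_zero _ _ []

end Units

/-! ### Homogeneous components of linear maps -/

namespace PointedGraded

variable {k : Type u} [Field k] (V : PointedGraded.{u, v} k) {W : PointedGraded.{u, w} k}

theorem mem_of_homog (P : Submodule k V) (h : ∀ j, ∀ x ∈ V.deg j, x ∈ P) (x : V) : x ∈ P := by
  have : ⨆ j, V.deg j ≤ P := iSup_le fun j => h j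
  rw [V.isInternal.submodule_iSup_eq_top] at this
  exact this trivial

theorem linearMap_ext {E : Type*} [AddCommGroup E] [Module k E] {f g : V.carrier →ₗ[k] E}
    (h : ∀ j, ∀ x ∈ V.deg j, f x = g x) : f = g :=
  LinearMap.ext fun x => V.mem_of_homog (LinearMap.eqLocus f g) h x

open Classical in
/-- The projection to the homogeneous elements of degree `j`. -/
def proj (j : ℤ) : V.carrier →ₗ[k] V.carrier :=
  letI := V.decomposition
  (V.deg j).subtype ∘ₗ DirectSum.component k ℤ (fun j => V.deg j) j ∘ₗ
    (DirectSum.decomposeLinearEquiv V.deg).toLinearMap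

theorem proj_mem (j : ℤ) (x : V) : V.proj j x ∈ V.deg j := Subtype.property _

theorem proj_of_mem {i j : ℤ} {x : V} (hx : x ∈ V.deg i) :
    V.proj j x = if i = j then x else 0 := by
  classical
  let _ := V.decomposition
  change ((DirectSum.decompose V.deg x) j : V) = _
  rw [DirectSum.decompose_of_mem V.deg hx, DirectSum.coe_of_apply]
  split_ifs <;> rfl

theorem proj_self {j : ℤ} {x : V} (hx : x ∈ V.deg j) : V.proj j x = x := by
  rw [V.proj_of_mem hx, if_pos rfl]

variable {V}

theorem map_proj {f : V.carrier →ₗ[k] W.carrier} {e : ℤ}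
    (hf : ∀ (j : ℤ) (x : V), x ∈ V.deg j → f x ∈ W.deg (j + e)) (j : ℤ) (x : V) :
    f (V.proj j x) = W.proj (j + e) (f x) := by
  have : f ∘ₗ V.proj j = W.proj (j + e) ∘ₗ f := by
    refine V.linearMap_ext fun i x hx => ?_
    simp only [LinearMap.comp_apply, V.proj_of_mem hx, W.proj_of_mem (hf i x hx)]
    by_cases h : i = j <;> simp [h]
  exact LinearMap.congr_fun this x

/-- Splittings chosen by linear algebra need not respect the grading; this extracts their component
of a given degree. -/
theorem exists_homogPart (T : V.carrier →ₗ[k] W.carrier) (e : ℤ) :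
    ∃ T' : V.carrier →ₗ[k] W.carrier, ∀ (j : ℤ) (x : V), x ∈ V.deg j →
      T' x = W.proj (j + e) (T x) := by
  classical
  let _ := V.decomposition
  refine ⟨DirectSum.toModule k ℤ W (fun j => W.proj (j + e) ∘ₗ T ∘ₗ (V.deg j).subtype) ∘ₗ
    (DirectSum.decomposeLinearEquiv V.deg).toLinearMap, fun j x hx => ?_⟩
  change DirectSum.toModule k ℤ W _ (DirectSum.decompose V.deg x) = _
  rw [DirectSum.decompose_of_mem V.deg hx]
  exact DirectSum.toModule_lof k (M := fun j => V.deg j) j ⟨x, hx⟩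

end PointedGraded

/-! ### Homotopy inverses -/

/-- A linear map which induces an isomorphism on cohomology, with zero differential on the source,
has a homotopy inverse. -/
theorem exists_homotopyInverse_linear {k : Type u} [Field k] {E : Type v} {F : Type w}
    [AddCommGroup E] [Module k E] [AddCommGroup F] [Module k F] {f : E →ₗ[k] F} {K : F →ₗ[k] F}
    (hKK : ∀ y, K (K y) = 0) (hKf : ∀ x, K (f x) = 0)
    (hinj : ∀ x y, f x = K y → x = 0) (hsurj : ∀ y, K y = 0 → ∃ x z, y = f x + K z) :
    ∃ (h : F →ₗ[k] E) (β : F →ₗ[k] F), (∀ x, h (f x) = x) ∧ (∀ x, β (f x) = 0) ∧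
      ∀ y, f (h y) = y + K (β y) + β (K y) := by
  -- `f` stays injective modulo the image of `K`; `g` is a left inverse there. Below, `r` is a
  -- section of `K` over its image, `q` is the resulting projection onto cocycles, and `h` applies
  -- `g` to the class of `q y`.
  obtain ⟨g, hg⟩ := LinearMap.exists_leftInverse_of_injective
    ((LinearMap.range K).mkQ ∘ₗ f) (by
      rw [LinearMap.ker_eq_bot']
      intro x hx
      rw [LinearMap.comp_apply, Submodule.mkQ_apply, Submodule.Quotient.mk_eq_zero] at hx
      obtain ⟨y, hy⟩ := hx
      exact hinj x y hy.symm)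
  have hgf : ∀ x, g ((LinearMap.range K).mkQ (f x)) = x := LinearMap.congr_fun hg
  have hgK : ∀ y, g ((LinearMap.range K).mkQ (K y)) = 0 := fun y => by
    rw [Submodule.mkQ_apply, (Submodule.Quotient.mk_eq_zero _).2 (LinearMap.mem_range_self K y),
      map_zero]
  obtain ⟨r₀, hr₀⟩ := K.rangeRestrict.exists_rightInverse_of_surjective K.range_rangeRestrict
  obtain ⟨r, hr⟩ := LinearMap.exists_extend r₀
  have hKr : ∀ y, K (r (K y)) = K y := fun y => by
    have h1 := LinearMap.congr_fun hr ⟨K y, y, rfl⟩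
    have h2 := congrArg Subtype.val (LinearMap.congr_fun hr₀ ⟨K y, y, rfl⟩)
    simp only [LinearMap.comp_apply, Submodule.subtype_apply] at h1
    rw [h1]
    exact h2
  let q : F →ₗ[k] F := LinearMap.id - r ∘ₗ K
  have hq : ∀ y, q y = y - r (K y) := fun y => rfl
  have hqf : ∀ x, q (f x) = f x := fun x => by rw [hq, hKf, map_zero, sub_zero]
  have hqK : ∀ y, q (K y) = K y := fun y => by rw [hq, hKK, map_zero, sub_zero]
  have hKq : ∀ y, K (q y) = 0 := fun y => by rw [hq, map_sub, hKr, sub_self]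
  let h : F →ₗ[k] E := g ∘ₗ (LinearMap.range K).mkQ ∘ₗ q
  have hhf : ∀ x, h (f x) = x := fun x => by
    change g ((LinearMap.range K).mkQ (q (f x))) = x
    rw [hqf, hgf]
  have hhK : ∀ y, h (K y) = 0 := fun y => by
    change g ((LinearMap.range K).mkQ (q (K y))) = 0
    rw [hqK, hgK]
  have hhq : ∀ y, h (q y) = h y := fun y => by
    change g ((LinearMap.range K).mkQ (q (q y))) = g ((LinearMap.range K).mkQ (q y))
    rw [hq (q y), hKq, map_zero, sub_zero]
  -- On cocycles `f ∘ h - I` takes exact values, and `r` picks primitives for them; this is the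
  -- source of `β`.
  have hE : ∀ y, K y = 0 → K (r (f (h y) - y)) = f (h y) - y := by
    intro y hy
    obtain ⟨x, z, rfl⟩ := hsurj y hy
    have : f (h (f x + K z)) - (f x + K z) = K (-z) := by
      rw [map_add, hhf, hhK, add_zero, map_neg]
      abel
    rw [this, hKr]
  refine ⟨h, r ∘ₗ (f ∘ₗ h - LinearMap.id) ∘ₗ q, hhf, fun x => ?_, fun y => ?_⟩
  · simp [hqf, hhf]
  · have h1 := hE (q y) (hKq y)
    simp only [LinearMap.comp_apply, LinearMap.sub_apply, LinearMap.id_apply]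
    rw [h1, hqK, hhK, map_zero, zero_sub, map_neg, hhq, hq]
    abel

/-! ### Random variables and cohomology -/

/-- The linear component of a symmetric family. -/
def SymFamily.linear {k : Type u} [Field k] {V : PointedGraded.{u, v} k}
    {W : PointedGraded.{u, w} k} {e : ℤ} (f : SymFamily V W e) : V.carrier →ₗ[k] W.carrier :=
  (MultilinearMap.ofSubsingleton k V.carrier W.carrier (0 : Fin 1)).symm (f.map 1)

theorem SymFamily.linear_apply {k : Type u} [Field k] {V : PointedGraded.{u, v} k}
    {W : PointedGraded.{u, w} k} {e : ℤ} (f : SymFamily V W e) (x : V) :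
    f.linear x = f.map 1 fun _ => x := rfl

theorem SymFamily.linear_mem {k : Type u} [Field k] {V : PointedGraded.{u, v} k}
    {W : PointedGraded.{u, w} k} {e : ℤ} (f : SymFamily V W e) {j : ℤ} {x : V}
    (hx : x ∈ V.deg j) : f.linear x ∈ W.deg (j + e) := by
  simpa [linear_apply] using f.map_mem 1 (fun _ => j) (fun _ => x) fun _ => hx

theorem SymFamily.onWord_single {k : Type u} [Field k] {V : PointedGraded.{u, v} k}
    {W : PointedGraded.{u, w} k} {e : ℤ} (f : SymFamily V W e) (j : ℤ) (x : V) :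
    f.onWord [(j, x)] = f.linear x :=
  f.onWord_word (fun _ : Fin 1 => j) fun _ => x

section Descendant

variable {k : Type u} [Field k] {C : PointedGraded.{u, v} k} {S : PointedGraded.{u, w} k}

namespace HomotopyProbabilityAlgebra

theorem density_one (A : HomotopyProbabilityAlgebra C) (φ : SymFamily S C 0) (d : Fin 1 → ℤ)
    (x : Fin 1 → S) : A.density φ 1 d x = φ.linear (x 0) := by
  rw [density_eq_comp]
  have : word d x = [(d 0, x 0)] := by simp [word]
  rw [this, comp, eval_parts_cons, eval_parts_nil, eval_insertLetter, eval_der_nil, add_zero]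
  rw [List.map_singleton, tag, M_onWord_single, SymFamily.onWord_single]

theorem exists_symFamily_density (A : HomotopyProbabilityAlgebra C) (φ : SymFamily S C 0)
    {W : PointedGraded k} (h : C.carrier →ₗ[k] W.carrier)
    (h_mem : ∀ (j : ℤ) (y : C), y ∈ C.deg j → h y ∈ W.deg j) :
    ∃ F : SymFamily S W 0, ∀ n, 1 ≤ n → ∀ (d : Fin n → ℤ) (x : Fin n → S), S.Homog d x →
      F.map n x = h (A.density φ n d x) := by
  have hφ : ∀ L, HomogWord S L → φ.onWord L ∈ C.deg (wt Prod.fst L) := fun L hL => by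
    simpa using φ.onWord_mem hL
  have hs : SwapSymm S (opWord (A.density φ)) := by
    have : opWord (A.density φ) = comp Prod.fst A.M.onWord φ.onWord := by
      funext L
      obtain ⟨d, x, h⟩ := exists_word L
      rw [h, opWord_word, density_eq_comp]
    rw [this]
    exact comp_swapSymm A.M hφ φ.swapSymm
  refine exists_symFamily (l := fun n d x => h (A.density φ n d x)) (fun n d => ?_)
    (fun n _ d x hx => ?_) fun n _ d x σ hx => ?_
  · exact IsML.linear h (compOps_isML (fun n _ => ⟨A.M.map n, fun _ => rfl⟩) φ n d)
  · rw [add_zero]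
    apply h_mem
    have := comp_mem A.M hφ (homogWord_word.2 hx)
    rwa [← density_eq_comp, add_zero, word, wt_ofFn] at this
  · rw [hs.koszulPerm n d x σ hx, Units.smul_def, map_zsmul, Units.smul_def]

variable {A : HomotopyProbabilityAlgebra C}

theorem K_linear (φ : RandomVariables A S) (s : S) : A.K (φ.family.linear s) = 0 := by
  have : A.K ∘ₗ φ.family.linear = 0 := S.linearMap_ext fun j x hx => by
    have := K_density φ le_rfl (d := fun _ => j) (x := fun _ => x) fun _ => hx
    rwa [density_one] at this
  exact LinearMap.congr_fun this s

theorem linear_one (φ : RandomVariables A S) : φ.family.linear S.one = C.one := φ.unit_one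

theorem linear_sub_mem_range [CharZero k] {φ ψ : RandomVariables A S}
    (h : Quot.mk UnitalSLHom.Homotopic φ = Quot.mk UnitalSLHom.Homotopic ψ) (s : S) :
    ∃ z, ψ.family.linear s - φ.family.linear s = A.K z := by
  obtain ⟨z, hz⟩ := S.mem_of_homog
    ((LinearMap.range A.K).comap (ψ.family.linear - φ.family.linear)) (fun j x hx => by
      obtain ⟨z, hz⟩ := density_sub_of_quot_eq h le_rfl (d := fun _ => j) (x := fun _ => x)
        fun _ => hx
      rw [density_one, density_one] at hz
      exact ⟨z, hz.symm⟩) s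
  exact ⟨z, hz.symm⟩

/-- The linear parts differ by exact elements, so they induce the same map into cohomology. -/
theorem IsQuasiIso.of_quot_eq [CharZero k] {φ ψ : RandomVariables A S}
    (h : Quot.mk UnitalSLHom.Homotopic φ = Quot.mk UnitalSLHom.Homotopic ψ)
    (hφ : φ.family.IsQuasiIso 0 A.K) : ψ.family.IsQuasiIso 0 A.K := by
  constructor
  · rintro s - ⟨y, hy⟩
    obtain ⟨z, hz⟩ := linear_sub_mem_range h s
    refine hφ.1 s rfl ⟨y - z, ?_⟩
    rw [map_sub, ← hy, ← hz, SymFamily.linear_apply, SymFamily.linear_apply, sub_sub_cancel]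
  · intro y hy
    obtain ⟨s, -, z, hz⟩ := hφ.2 y hy
    obtain ⟨z', hz'⟩ := linear_sub_mem_range h s
    refine ⟨s, rfl, z - z', ?_⟩
    rw [hz, map_sub, ← hz', SymFamily.linear_apply, SymFamily.linear_apply]
    abel

theorem nonempty_homotopyInverse {φ : RandomVariables A S} (hφ : φ.family.IsQuasiIso 0 A.K) :
    Nonempty (HomotopyInverse A φ) := by
  obtain ⟨h, β, h1, h2, h3⟩ := exists_homotopyInverse_linear (f := φ.family.linear) A.K_K
    (K_linear φ) (fun x y hxy => by
      obtain ⟨z, hz⟩ := hφ.1 x rfl ⟨y, hxy⟩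
      exact hz) (fun y hy => by
      obtain ⟨x, -, z, hz⟩ := hφ.2 y hy
      exact ⟨x, z, hz⟩)
  obtain ⟨h', hh'⟩ := PointedGraded.exists_homogPart h 0
  obtain ⟨β', hβ'⟩ := PointedGraded.exists_homogPart β (-1)
  refine ⟨⟨h', fun j y hy => ?_, β', fun j y hy => ?_, ?_, fun s => ?_, fun y => ?_⟩⟩
  · rw [hh' j y hy, add_zero]
    exact S.proj_mem _ _
  · rw [hβ' j y hy]
    exact C.proj_mem _ _
  -- The unit lies in the image of `f`, on which the linear-algebra homotopy `β` was arranged to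
  -- vanish.
  · rw [hβ' 0 _ C.one_mem, ← linear_one φ, h2, map_zero]
  · have : h' ∘ₗ φ.family.linear = LinearMap.id := S.linearMap_ext fun j x hx => by
      have hfx := φ.family.linear_mem hx
      rw [add_zero] at hfx
      rw [LinearMap.comp_apply, hh' j _ hfx, h1, add_zero, S.proj_self hx, LinearMap.id_apply]
    exact LinearMap.congr_fun this s
  · have : φ.family.linear ∘ₗ h' = LinearMap.id + A.K ∘ₗ β' + β' ∘ₗ A.K :=
      C.linearMap_ext fun j y hy => by
        simp only [LinearMap.comp_apply, LinearMap.add_apply, LinearMap.id_apply]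
        rw [hh' j y hy, hβ' j y hy, hβ' (j + 1) _ (A.K_mem j y hy),
          PointedGraded.map_proj (fun j x hx => φ.family.linear_mem hx), h3,
          PointedGraded.map_proj A.K_mem, map_add, map_add]
        simp only [add_zero, neg_add_cancel_right, add_neg_cancel_right]
        rw [C.proj_self hy]
    exact LinearMap.congr_fun this y

/-- The homotopy formula makes the image of `h (K z)` under `f` exact, and `f` is injective on
cohomology. -/
theorem HomotopyInverse.h_K {φ : RandomVariables A S} (hφ : φ.family.IsQuasiIso 0 A.K)
    (I : HomotopyInverse A φ) (z : C) : I.h (A.K z) = 0 := by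
  obtain ⟨w, hw⟩ := hφ.1 (I.h (A.K z)) rfl ⟨z + I.β (A.K z), by
    rw [I.comp_h, A.K_K, map_zero, add_zero, map_add]⟩
  exact hw

/-- Both values are sent to the class of `y`, by linear parts that agree on cohomology, so
injectivity identifies them. -/
theorem HomotopyInverse.h_eq [CharZero k] {φ ψ : RandomVariables A S}
    (h : Quot.mk UnitalSLHom.Homotopic φ = Quot.mk UnitalSLHom.Homotopic ψ)
    (hφ : φ.family.IsQuasiIso 0 A.K) (I : HomotopyInverse A φ) (J : HomotopyInverse A ψ)
    {y : C} (hy : A.K y = 0) : I.h y = J.h y := by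
  rw [← sub_eq_zero]
  obtain ⟨z, hz⟩ := linear_sub_mem_range h (J.h y)
  have h1 : φ.family.linear (I.h y) = y + A.K (I.β y) := by
    rw [SymFamily.linear_apply, I.comp_h, hy, map_zero, add_zero]
  have h2 : ψ.family.linear (J.h y) = y + A.K (J.β y) := by
    rw [SymFamily.linear_apply, J.comp_h, hy, map_zero, add_zero]
  obtain ⟨w, hw⟩ := hφ.1 (I.h y - J.h y) rfl ⟨I.β y - J.β y + z, by
    rw [← SymFamily.linear_apply, map_sub, h1, eq_sub_of_add_eq' (sub_eq_iff_eq_add.1 hz).symm, h2,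
      map_add, map_sub]
    abel⟩
  exact hw

theorem Hom.map_K_eq_zero (c : A.Hom (groundAlgebra k)) (y : C) : c.toLin (A.K y) = 0 :=
  c.map_K y

theorem Hom.eq_of_quot_eq {c c' : A.Hom (groundAlgebra k)}
    (h : Quot.mk Hom.Homotopic c = Quot.mk Hom.Homotopic c') {y : C} (hy : A.K y = 0) :
    c.toLin y = c'.toLin y := by
  replace h := Quot.eqvGen_exact h
  induction h with
  | rel c c' h =>
    obtain ⟨s, -, -, hs⟩ := h
    have h1 := hs y
    rw [hy, map_zero, add_zero] at h1
    exact sub_eq_zero.1 h1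
  | refl c => rfl
  | symm c c' _ ih => exact ih.symm
  | trans c c' c'' _ _ h₁ h₂ => exact h₁.trans h₂

/-- The expectation of the correlation densities does not depend on the representatives. -/
theorem map_density_eq [CharZero k] {φ ψ : RandomVariables A S}
    (h : Quot.mk UnitalSLHom.Homotopic φ = Quot.mk UnitalSLHom.Homotopic ψ)
    {c c' : A.Hom (groundAlgebra k)} (hc : Quot.mk Hom.Homotopic c = Quot.mk Hom.Homotopic c')
    {n : ℕ} (hn : 1 ≤ n) {d : Fin n → ℤ} {x : Fin n → S} (hx : S.Homog d x) :
    c.toLin (A.density φ.family n d x) = c'.toLin (A.density ψ.family n d x) := by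
  obtain ⟨z, hz⟩ := density_sub_of_quot_eq h hn hx
  rw [sub_eq_iff_eq_add.1 hz, map_add, c'.map_K_eq_zero, zero_add]
  exact Hom.eq_of_quot_eq hc (K_density φ hn hx)

/-! ### Moments and cumulants -/

/-- The moments are the sums over partitions of products of cumulants. -/
theorem map_comp_eq {W : PointedGraded k} {B : HomotopyProbabilityAlgebra W} (hB : B.K = 0)
    (c : A.Hom B) (Λ : DescentHomotopy C W) (φ : RandomVariables A S)
    {L : List (ℤ × S)} (hL : L ≠ []) (hh : HomogWord S L) :
    c.toLin (comp Prod.fst A.M.onWord φ.family.onWord L) =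
      comp Prod.fst B.M.onWord (opWord (compOps (descendantMor c Λ) φ.family)) L := by
  have h1 : opWord (compOps (descendantMor c Λ) φ.family) =
      comp Prod.fst (opWord (descendantMor c Λ)) φ.family.onWord := by
    funext L
    obtain ⟨d, x, h⟩ := exists_word L
    rw [h, opWord_word, compOps_eq_comp]
  have h2 : c.toLin (comp Prod.fst A.M.onWord φ.family.onWord L) =
      eval (parts Prod.fst L) fun p =>
        c.toLin (A.M.onWord (p.map (tag Prod.fst φ.family.onWord))) :=
    map_eval c.toLin.toAddMonoidHom _ _
  -- Composition with `φ` turns the inserted `ℓ` into the composite of `ℓ` with `φ`, which vanishes;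
  -- so no choice of `Λ` matters for the moments.
  have h3 : comp Prod.fst (ins Λ.family.onWord A.ell) φ.family.onWord L = 0 := by
    rw [comp_ins _ Λ.family.multiAdd, markSum,
      eval_parts_congr (G := fun _ => 0) fun p hp => mark_eq_zero Λ.family.multiAdd fun D hD =>
        comp_ell_eq_zero φ (hp.2 D hD) (hh.subset (hp.subset hD)), eval_zero]
  rw [h1, h2, ← comp_assoc _ B.M.multiAdd]
  refine Eq.trans (eval_parts_congr fun p hp => ?_) ((eval_add _ _ _).trans
    ((congrArg _ h3).trans (add_zero _)))
  rw [map_M_onWord c Λ (by simpa using hp.ne_nil hL), hB, LinearMap.zero_apply, add_zero]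

end HomotopyProbabilityAlgebra

/-- A sum over partitions is its one-block summand plus a sum which involves only the values on
shorter words. -/
theorem comp_eq_add {α E X : Type*} [AddCommGroup E] [AddCommGroup X] (g : α → ℤ)
    {f : List (ℤ × E) → X} (hf : MultiAdd f) {φ φ' : List α → E} {L : List α} (hL : L ≠ [])
    (h : ∀ B, B ≠ [] → B.length < L.length → B ⊆ L → φ B = φ' B) (h0 : φ' L = 0) :
    comp g f φ L = f [(wt g L, φ L)] + comp g f φ' L := by
  have h1 : eval (parts g L) (fun p => f (p.map (tag g φ)) - f (p.map (tag g φ'))) =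
      f [(wt g L, φ L)] := by
    rw [eval_parts_eq_single hL]
    · simp [tag, h0, hf.zero_head]
    · intro p hp hp1
      rw [sub_eq_zero]
      congr 1
      refine List.map_congr_left fun B hB => ?_
      rw [tag, tag, h B (hp.2 B hB) (hp.length_lt hp1 hB) (hp.subset hB)]
  rw [← h1, comp, comp, ← eval_add]
  simp

namespace HomotopyProbabilityAlgebra

variable {W : PointedGraded k} {B : HomotopyProbabilityAlgebra W}

/-- Cumulants of degree `0` moments are of degree `0` and inherit their symmetry. -/
theorem cumulant_mem_and_swapSymm {μ κ : List (ℤ × S) → W}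
    (h : ∀ L, L ≠ [] → HomogWord S L → μ L = comp Prod.fst B.M.onWord κ L)
    (hm : ∀ L, L ≠ [] → HomogWord S L → μ L ∈ W.deg (wt Prod.fst L)) (hs : SwapSymm S μ) :
    (∀ L, L ≠ [] → HomogWord S L → κ L ∈ W.deg (wt Prod.fst L)) ∧ SwapSymm S κ := by
  classical
  suffices H : ∀ n, (∀ L, L.length = n → L ≠ [] → HomogWord S L → κ L ∈ W.deg (wt Prod.fst L)) ∧
      ∀ L₁ a b L₂, (L₁ ++ a :: b :: L₂).length = n → HomogWord S (L₁ ++ a :: b :: L₂) →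
        κ (L₁ ++ a :: b :: L₂) = sg (a.1 * b.1) • κ (L₁ ++ b :: a :: L₂) from
    ⟨fun L => (H _).1 L rfl, fun L₁ a b L₂ => (H _).2 L₁ a b L₂ rfl⟩
  intro n
  induction n using Nat.strong_induction_on with
  | _ n ih =>
    -- The truncation is known by induction to have the right degree and symmetry, so `κ` on words
    -- of length `n`, being the moment minus a sum built from `κ'`, has them as well.
    let κ' : List (ℤ × S) → W := fun L => if L ≠ [] ∧ L.length < n then κ L else 0
    have hκ' : ∀ L, HomogWord S L → κ' L ∈ W.deg (wt Prod.fst L) := by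
      intro L hL
      by_cases hc : L ≠ [] ∧ L.length < n
      · simpa only [κ', if_pos hc] using (ih _ hc.2).1 L rfl hc.1 hL
      · simpa only [κ', if_neg hc] using Submodule.zero_mem _
    have hs' : SwapSymm S κ' := by
      intro L₁ a b L₂ hL
      have hc : (L₁ ++ b :: a :: L₂ ≠ [] ∧ (L₁ ++ b :: a :: L₂).length < n) ↔
          (L₁ ++ a :: b :: L₂ ≠ [] ∧ (L₁ ++ a :: b :: L₂).length < n) := by simp
      simp only [κ', hc]
      by_cases h' : L₁ ++ a :: b :: L₂ ≠ [] ∧ (L₁ ++ a :: b :: L₂).length < n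
      · rw [if_pos h', if_pos h', (ih _ h'.2).2 L₁ a b L₂ rfl hL]
      · rw [if_neg h', if_neg h', smul_zero]
    have hκ : ∀ L, L.length = n → L ≠ [] → HomogWord S L →
        κ L = μ L - comp Prod.fst B.M.onWord κ' L := by
      intro L hn hL hh
      rw [h L hL hh, comp_eq_add (φ' := κ') Prod.fst B.M.multiAdd hL, M_onWord_single,
        add_sub_cancel_right]
      · intro D hD hl _
        exact (if_pos ⟨hD, hn ▸ hl⟩).symm
      · exact if_neg fun h' => absurd h'.2 (by omega)
    refine ⟨fun L hn hL hh => ?_, fun L₁ a b L₂ hn hh => ?_⟩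
    · rw [hκ L hn hL hh]
      have := comp_mem B.M hκ' hh
      rw [add_zero] at this
      exact Submodule.sub_mem _ (hm L hL hh) this
    · rw [hκ _ hn (by simp) hh, hκ _ (by simpa using hn) (by simp) (hh.subset
        ((List.Perm.swap a b L₂).append_left L₁).subset), hs _ _ _ _ hh,
        comp_swapSymm B.M hκ' hs' _ _ _ _ hh, smul_sub]

/-- Cumulants are determined by the moments. -/
theorem cumulant_unique {κ κ' : List (ℤ × S) → W}
    (h : ∀ L, L ≠ [] → HomogWord S L →
      comp Prod.fst B.M.onWord κ L = comp Prod.fst B.M.onWord κ' L)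
    {L : List (ℤ × S)} (hL : L ≠ []) (hh : HomogWord S L) : κ L = κ' L := by
  classical
  suffices H : ∀ n, ∀ L, L.length = n → L ≠ [] → HomogWord S L → κ L = κ' L from
    H _ L rfl hL hh
  clear hL hh L
  intro n
  induction n using Nat.strong_induction_on with
  | _ n ih =>
    intro L hn hL hh
    let κ₀ : List (ℤ × S) → W := fun D => if D = L then 0 else κ D
    have hlt : ∀ D : List (ℤ × S), D.length < L.length → κ₀ D = κ D := fun D hD =>
      if_neg fun h' => by rw [h'] at hD; exact lt_irrefl _ hD
    have h1 := h L hL hh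
    rw [comp_eq_add (φ := κ) (φ' := κ₀) Prod.fst B.M.multiAdd hL
        (fun D _ hl _ => (hlt D hl).symm) (if_pos rfl),
      comp_eq_add (φ := κ') (φ' := κ₀) Prod.fst B.M.multiAdd hL
        (fun D hD hl hs => by rw [hlt D hl, ih _ (hn ▸ hl) D rfl hD (hh.subset hs)]) (if_pos rfl),
      M_onWord_single, M_onWord_single] at h1
    exact add_right_cancel h1

/-- The zero homotopy. -/
def DescentHomotopy.zero (V : PointedGraded.{u, v} k) (W : PointedGraded.{u, w} k) :
    DescentHomotopy V W where
  family :=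
    { map := 0
      map_zero_arity := rfl
      map_mem := fun _ _ _ _ => Submodule.zero_mem _
      map_symm := fun _ _ _ _ _ => (smul_zero _).symm }
  unit_one := rfl
  unit_higher := fun _ _ _ => rfl

theorem groundAlgebra_density (κ : SymFamily S (groundSpace k) 0) {n : ℕ} (hn : 1 ≤ n)
    (d : Fin n → ℤ) (s : Fin n → S) :
    (groundAlgebra k).density κ n d s = ∑ π : OrderedFinpartition n,
      π.sign d • ∏ i : Fin π.length, (κ.map (π.partSize i) (π.block s i) : k) := by
  refine Finset.sum_congr rfl fun π _ => ?_
  have hl : π.length ≠ 0 := (π.length_pos hn).ne'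
  congr 1
  change (if π.length = 0 then 0 else MultilinearMap.mkPiAlgebra k (Fin π.length) k)
    (κ.onBlocks π s) = _
  rw [if_neg hl]
  rfl

end HomotopyProbabilityAlgebra

end Descendant

/-! ### The canonical structure on a complete space -/

namespace CompleteRVSpace

variable {k : Type u} [Field k] [CharZero k] {C : PointedGraded.{u, v} k}
  {X : HomotopyProbabilitySpace C} {S : PointedGraded.{u, w} k} (T : CompleteRVSpace X S)

open HomotopyProbabilityAlgebra

theorem isQuasiIso {φ : RandomVariables X.alg S} (hφ : Quot.mk _ φ = T.homotopyType) :
    φ.family.IsQuasiIso 0 X.alg.K := by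
  obtain ⟨φ₀, h₀, hq⟩ := T.quasiIso
  exact IsQuasiIso.of_quot_eq (h₀.trans hφ.symm) hq

theorem exists_representatives : ∃ (φ : RandomVariables X.alg S) (_ : HomotopyInverse X.alg φ)
    (c : X.alg.Hom (groundAlgebra k)), Quot.mk _ φ = T.homotopyType ∧
      Quot.mk _ c = X.expectation := by
  obtain ⟨φ, hφ, hq⟩ := T.quasiIso
  obtain ⟨I⟩ := nonempty_homotopyInverse hq
  obtain ⟨c, hc⟩ := Quot.exists_rep X.expectation
  exact ⟨φ, I, c, hφ, hc⟩

theorem exists_isCanonicalStructure :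
    ∃ P : AlgebraicProbabilitySpace S, T.IsCanonicalStructure P := by
  obtain ⟨φ, I, c, hφ, hc⟩ := T.exists_representatives
  obtain ⟨F, hF⟩ := exists_symFamily_density X.alg φ.family I.h I.h_mem
  have hF1 : F.linear = LinearMap.id := S.linearMap_ext fun j x hx => by
    rw [SymFamily.linear_apply, hF 1 le_rfl (fun _ => j) _ fun _ => hx, density_one]
    exact I.h_comp x
  have hunit : ∀ (n : ℕ), 1 ≤ n → ∀ x : Fin n → S,
      F.map (n + 1) (Fin.snoc (α := fun _ => S.carrier) x S.one) = F.map n x := by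
    intro n hn x
    -- The densities are only described on homogeneous tuples, so the unit law is stated as an
    -- equality of multilinear maps and tested there.
    have : (LinearMap.applyₗ S.one).compMultilinearMap
        (MultilinearMap.curryRight (M := fun _ => S.carrier) (F.map (n + 1))) = F.map n := by
      refine multilinearMap_ext_homog fun d x hx => ?_
      have hx' : S.Homog (Fin.snoc (α := fun _ => ℤ) d 0)
          (Fin.snoc (α := fun _ => S.carrier) x S.one) := by
        rw [← homogWord_word, word_snoc]
        intro a ha
        rcases List.mem_append.1 ha with ha | ha
        · exact homogWord_word.2 hx a ha
        · rw [List.mem_singleton.1 ha]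
          exact S.one_mem
      change F.map (n + 1) (Fin.snoc x S.one) = _
      rw [hF (n + 1) (by omega) _ _ hx', hF n hn d x hx, density_eq_comp, density_eq_comp,
        word_snoc, comp_append_one X.alg.toCorrelationAlgebra φ (word_ne_nil hn d x)]
    exact DFunLike.congr_fun this x
  -- With zero differential on `S`, the unit is outside the image exactly if it is nonzero, and this
  -- is inherited from `C` through `f`.
  have hone : S.one ≠ 0 := fun h => X.alg.one_notMem_range 0 <| by
    rw [map_zero, ← linear_one φ, h, map_zero]
  refine ⟨⟨⟨⟨F, fun x => LinearMap.congr_fun hF1 x, hunit⟩, 0, fun j x _ => Submodule.zero_mem _,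
    fun _ => rfl, rfl, fun _ => hone.symm⟩, rfl, ⟨c.toLin ∘ₗ φ.family.linear, fun j x hx => ?_,
    ?_, fun x => ?_⟩⟩, ?_⟩
  · have := φ.family.linear_mem hx
    rw [add_zero] at this
    exact c.map_mem j _ this
  · rw [LinearMap.comp_apply, linear_one, c.map_one]
  · exact map_zero _
  · intro ψ hψ
    have hq : Quot.mk UnitalSLHom.Homotopic φ = Quot.mk UnitalSLHom.Homotopic ψ :=
      hφ.trans hψ.symm
    refine ⟨fun J n hn d s hs => ?_, fun c' hc' s => ?_⟩
    · change F.map n s = _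
      -- The two densities differ by an exact term, killed by `J.h`; on the remaining cocycle both
      -- inverses agree.
      obtain ⟨z, hz⟩ := density_sub_of_quot_eq hq hn hs
      rw [hF n hn d s hs, sub_eq_iff_eq_add.1 hz, map_add, J.h_K (T.isQuasiIso hψ), zero_add]
      exact I.h_eq hq (T.isQuasiIso hφ) J (K_density φ hn hs)
    · change c.toLin (φ.family.linear s) = c'.toLin (ψ.family.linear s)
      obtain ⟨z, hz⟩ := linear_sub_mem_range hq s
      rw [sub_eq_iff_eq_add.1 hz, map_add, c'.map_K_eq_zero, zero_add]
      exact Hom.eq_of_quot_eq (hc.trans hc'.symm) (K_linear φ s)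

/-- The characterising conditions quantify over all representatives; they pin down the structure
because at least one representative of each kind and one homotopy inverse exist. -/
theorem isCanonicalStructure_unique {P Q : AlgebraicProbabilitySpace S}
    (hP : T.IsCanonicalStructure P) (hQ : T.IsCanonicalStructure Q) : P = Q := by
  obtain ⟨φ, I, c, hφ, hc⟩ := T.exists_representatives
  have hM : P.alg.M = Q.alg.M := SymFamily.ext_homog fun n hn d s hs => by
    rw [(hP φ hφ).1 I n hn d s hs, (hQ φ hφ).1 I n hn d s hs]
  have he : P.expectation.toLin = Q.expectation.toLin := LinearMap.ext fun s => by
    rw [(hP φ hφ).2 c hc, (hQ φ hφ).2 c hc]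
  obtain ⟨⟨⟨M, _, _⟩, K, _, _, _, _⟩, hK, ⟨e, _, _, _⟩⟩ := P
  obtain ⟨⟨⟨M', _, _⟩, K', _, _, _, _⟩, hK', ⟨e', _, _, _⟩⟩ := Q
  obtain rfl : K = 0 := hK
  obtain rfl : K' = 0 := hK'
  obtain rfl : M = M' := hM
  obtain rfl : e = e' := he
  rfl

theorem exists_isMomentMorphism :
    ∃ μ : SymFamily S (groundSpace k) 0, T.IsMomentMorphism μ := by
  obtain ⟨φ, -, c, hφ, hc⟩ := T.exists_representatives
  obtain ⟨F, hF⟩ := exists_symFamily_density X.alg φ.family c.toLin c.map_mem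
  refine ⟨F, fun ψ hψ c' hc' n hn d s hs => ?_⟩
  rw [hF n hn d s hs]
  exact map_density_eq (hφ.trans hψ.symm) (hc.trans hc'.symm) hn hs

theorem isMomentMorphism_unique {μ ν : SymFamily S (groundSpace k) 0}
    (hμ : T.IsMomentMorphism μ) (hν : T.IsMomentMorphism ν) : μ = ν := by
  obtain ⟨φ, -, c, hφ, hc⟩ := T.exists_representatives
  refine SymFamily.ext_homog fun n hn d s hs => ?_
  rw [hμ φ hφ c hc n hn d s hs, hν φ hφ c hc n hn d s hs]

variable {T} in
theorem IsMomentMorphism.onWord_eq {μ : SymFamily S (groundSpace k) 0}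
    (hμ : T.IsMomentMorphism μ) {φ : RandomVariables X.alg S}
    (hφ : Quot.mk _ φ = T.homotopyType) {c : X.alg.Hom (groundAlgebra k)}
    (hc : Quot.mk _ c = X.expectation) (Λ : DescentHomotopy C (groundSpace k))
    {L : List (ℤ × S)} (hL : L ≠ []) (hh : HomogWord S L) : μ.onWord L =
      comp Prod.fst (groundAlgebra k).M.onWord (opWord (compOps (descendantMor c Λ) φ.family))
        L := by
  rw [← map_comp_eq rfl c Λ φ hL hh]
  obtain ⟨d, x, hx, h⟩ := hh.exists_word
  have hn : 1 ≤ L.length := List.length_pos_iff.2 hL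
  generalize L.length = n at *
  subst h
  rw [SymFamily.onWord_word, hμ φ hφ c hc n hn d x hx, density_eq_comp]

theorem exists_isCumulantMorphism :
    ∃ κ : SymFamily S (groundSpace k) 0, T.IsCumulantMorphism κ := by
  obtain ⟨φ, -, c, hφ, hc⟩ := T.exists_representatives
  obtain ⟨μ, hμ⟩ := T.exists_isMomentMorphism
  let l : GradedOps S (groundSpace k) :=
    compOps (descendantMor c (DescentHomotopy.zero C (groundSpace k))) φ.family
  have hl : ∀ L, L ≠ [] → HomogWord S L →
      μ.onWord L = comp Prod.fst (groundAlgebra k).M.onWord (opWord l) L :=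
    fun L hL hh => hμ.onWord_eq hφ hc _ hL hh
  -- Degree and symmetry are read off from the moments rather than from the recursion defining the
  -- descendant of `c`.
  obtain ⟨hmem, hsymm⟩ := cumulant_mem_and_swapSymm hl
    (fun L _ hh => by simpa using μ.onWord_mem hh) μ.swapSymm
  obtain ⟨κ, hκ⟩ := exists_symFamily (e := 0) (l := l)
    (compOps_isML (descendantMor_isML c _) φ.family) (fun n hn d x hx => by
      have := hmem _ (word_ne_nil hn d x) (homogWord_word.2 hx)
      rwa [opWord_word, word, wt_ofFn, ← add_zero (∑ i, _)] at this)
    fun n _ d x σ hx => hsymm.koszulPerm n d x σ hx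
  refine ⟨κ, fun ψ hψ c' hc' Λ n hn d s hs => ?_⟩
  rw [hκ n hn d s hs]
  -- Any other choice of representatives and of `Λ` solves the same moment equations, whose solution
  -- is unique.
  have := cumulant_unique (B := groundAlgebra k) (κ := opWord l)
    (κ' := opWord (compOps (descendantMor c' Λ) ψ.family))
    (fun L hL hh => (hl L hL hh).symm.trans (hμ.onWord_eq hψ hc' Λ hL hh))
    (word_ne_nil hn d s) (homogWord_word.2 hs)
  rwa [opWord_word, opWord_word] at this

theorem isCumulantMorphism_unique {κ κ' : SymFamily S (groundSpace k) 0}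
    (hκ : T.IsCumulantMorphism κ) (hκ' : T.IsCumulantMorphism κ') : κ = κ' := by
  obtain ⟨φ, -, c, hφ, hc⟩ := T.exists_representatives
  refine SymFamily.ext_homog fun n hn d s hs => ?_
  rw [hκ φ hφ c hc (DescentHomotopy.zero C _) n hn d s hs,
    hκ' φ hφ c hc (DescentHomotopy.zero C _) n hn d s hs]

variable {T}

/-- On the cocycle `Π` the homotopy formula reduces `f (h Π)` to `Π + K (β Π)`, and `c` kills the
exact term. -/
theorem IsCanonicalStructure.expectation_eq {P : AlgebraicProbabilitySpace S}
    {μ : SymFamily S (groundSpace k) 0} (hP : T.IsCanonicalStructure P)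
    (hμ : T.IsMomentMorphism μ) {n : ℕ} (hn : 1 ≤ n) {d : Fin n → ℤ} {s : Fin n → S}
    (hs : S.Homog d s) : P.expectation.toLin (P.alg.M.map n s) = μ.map n s := by
  obtain ⟨φ, I, c, hφ, hc⟩ := T.exists_representatives
  rw [(hP φ hφ).2 c hc, (hP φ hφ).1 I n hn d s hs, I.comp_h, K_density φ hn hs, map_zero,
    add_zero, map_add, c.map_K_eq_zero, add_zero, hμ φ hφ c hc n hn d s hs]

theorem IsMomentMorphism.eq_sum {μ κ : SymFamily S (groundSpace k) 0}
    (hμ : T.IsMomentMorphism μ) (hκ : T.IsCumulantMorphism κ) {n : ℕ} (hn : 1 ≤ n)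
    {d : Fin n → ℤ} {s : Fin n → S} (hs : S.Homog d s) :
    μ.map n s = ∑ π : OrderedFinpartition n,
      π.sign d • ∏ i : Fin π.length, (κ.map (π.partSize i) (π.block s i) : k) := by
  obtain ⟨φ, -, c, hφ, hc⟩ := T.exists_representatives
  have hh := homogWord_word.2 hs
  rw [← groundAlgebra_density κ hn d s, density_eq_comp, ← SymFamily.onWord_word μ d s,
    hμ.onWord_eq hφ hc (DescentHomotopy.zero C _) (word_ne_nil hn d s) hh]
  refine comp_congr (fun _ _ => rfl) fun B hB hsub => ?_
  obtain ⟨d', x, hx, h⟩ := (hh.subset hsub).exists_word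
  have hn' : 1 ≤ B.length := List.length_pos_iff.2 hB
  generalize B.length = m at *
  subst h
  rw [opWord_word, SymFamily.onWord_word, hκ φ hφ c hc _ m hn' d' x hx]

end CompleteRVSpace

end

theorem mainTheorem7 {k : Type u} [Field k] [CharZero k] {C : PointedGraded.{u, v} k}
    (X : HomotopyProbabilitySpace C) {S : PointedGraded.{u, w} k} (T : CompleteRVSpace X S) :
    (∀ φ : RandomVariables X.alg S, Quot.mk _ φ = T.homotopyType →
      Nonempty (HomotopyInverse X.alg φ)) ∧
    (∃! P : AlgebraicProbabilitySpace S, T.IsCanonicalStructure P) ∧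
    (∃! μ : SymFamily S (groundSpace k) 0, T.IsMomentMorphism μ) ∧
    (∃! κ : SymFamily S (groundSpace k) 0, T.IsCumulantMorphism κ) ∧
    ∀ (P : AlgebraicProbabilitySpace S) (μ κ : SymFamily S (groundSpace k) 0),
      T.IsCanonicalStructure P → T.IsMomentMorphism μ → T.IsCumulantMorphism κ →
      ∀ n : ℕ, 1 ≤ n → ∀ (d : Fin n → ℤ) (s : Fin n → S), S.Homog d s →
        P.expectation.toLin (P.alg.M.map n s) = μ.map n s ∧
        μ.map n s = ∑ π : OrderedFinpartition n,
          π.sign d • ∏ i : Fin π.length, (κ.map (π.partSize i) (π.block s i) : k) :=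
  ⟨fun _ hφ => HomotopyProbabilityAlgebra.nonempty_homotopyInverse (T.isQuasiIso hφ),
    existsUnique_of_exists_of_unique T.exists_isCanonicalStructure
      fun _ _ => T.isCanonicalStructure_unique,
    existsUnique_of_exists_of_unique T.exists_isMomentMorphism
      fun _ _ => T.isMomentMorphism_unique,
    existsUnique_of_exists_of_unique T.exists_isCumulantMorphism
      fun _ _ => T.isCumulantMorphism_unique,
    fun _ _ _ hP hμ hκ _ hn _ _ hs => ⟨hP.expectation_eq hμ hn hs, hμ.eq_sum hκ hn hs⟩⟩
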